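/- Let $M$ be a smooth manifold and let $(E,\rho,[\,,])$ be a Lie algebroid on $M$: a smooth real vector bundle $E\to M$ of finite rank, a Lie bracket on its sections, and a bundle map $\rho:E\to TM$ inducing a Lie algebra homomorphism on sections, with $[\sigma,f\tau]=\rho(\sigma)(f)\,\tau+f[\sigma,\tau]$. Let $\omega$ be a symplectic structure on $E$, i.e. a fibrewise nondegenerate section of $\Lambda^2E^*$ that is closed for the $E$-de Rham differential. Let ${}^EOp(M)$ be the algebra of $E$-differential operators, i.e. the real unital associative algebra generated by the algebra $C^\infty(M)$ and the vector space $\Gamma(M,E)$ subject to $f\cdot\sigma=f\sigma$, $\sigma\cdot f-f\cdot\sigma=\rho(\sigma)(f)$ and $\sigma\cdot\tau-\tau\cdot\sigma=[\sigma,\tau]$. Let ${}^E\underline{Jets}(M)=\mathrm{Hom}_{C^\infty(M)}({}^EOp(M),C^\infty(M))$ (for the left module structure). These are the sections of the profinite-dimensional vector bundle ${}^EJets$ whose fibre at $m$ is $\mathrm{Hom}_{C^\infty(M)}({}^EOp(M),\mathbb R_m)$, where $\mathbb R_m$ is $\mathbb R$ with $f$ acting as $f(m)$. Let $\Delta_0$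 be the coproduct, $\Delta_0(\sigma)=\sigma\otimes1+1\otimes\sigma$ for $\sigma\in\Gamma(M,E)$, acting by left multiplication on ${}^EOp(M)\otimes_{C^\infty(M)}{}^EOp(M)$ (tensor product of left modules; $\Delta_0(f)$ acts as multiplication by $f$). Jets are multiplied by $(l_1l_2)(D)=(l_1\otimes l_2)(\Delta_0(D))$; the unit is $D\mapsto\rho(D)(1)$, where $\rho$ is extended to the action of ${}^EOp(M)$ on $C^\infty(M)$. The inverse tensor $\varpi\in\Gamma(M,E\otimes E)$ of $\omega$ is the tensor with $(I_\omega\otimes I_\omega)(\varpi)=\omega$, where $I_\omega:E\to E^*$, $I_\omega(e)=\omega(e,\cdot)$. Then: 1. Near each point $\varpi$ is a finite sum $\sum_ie_i\otimes f_i$ with $e_i,f_i\in\Gamma(M,E)$. The formula $$\{l_1,l_2\}(D)=(l_1\otimes l_2)\Big(\Delta_0(D)\cdot\sum_i e_i\otimes f_i\Big)$$ gives a well-defined bracket on each fibre of ${}^EJets$ (the value at $m$ does not depend on the choice of a finite sum representing $\varpi$ near $m$) and on ${}^E\underline{Jets}(M)$, compatibly with evaluation at the points of $M$. 2. With this product and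 bracket, ${}^E\underline{Jets}(M)$ is a commutative unital Poisson algebra over $C^\infty(M)$ and each fibre of ${}^EJets$ is a commutative unital Poisson algebra over $\mathbb R$. 3. ${}^EJets$ is a bundle of Poisson algebras with fibre isomorphic to the Poisson algebra $\big(\mathbb R[[x_1,\dots,x_n,\xi_1,\dots,\xi_n]],\{\,,\}_{st}\big)$, where $n=\tfrac12\operatorname{rank}E$ and $$\{f,g\}_{st}=\sum_{i=1}^n\big(\partial_{x_i}f\,\partial_{\xi_i}g-\partial_{\xi_i}f\,\partial_{x_i}g\big).$$ That is, each point of $M$ has an open neighbourhood $U$ with isomorphisms of unital Poisson algebras $\varphi_x$, $x\in U$, from the fibre of ${}^EJets$ at $x$ to $\mathbb R[[x_1,\dots,\xi_n]]$, which form a smooth trivialization of ${}^EJets$ as a profinite-dimensional vector bundle: each coefficient of $\varphi_x(\lambda)$ is $\lambda(D)$ for an $E$-differential operator $D$ that does not depend on $x\in U$ or $\lambda$, and for each family of smooth functions on $M$, indexed by the monomials, there is an $E$-jet $l$ on $M$ such that for all $x\in U$ the coefficients of $\varphi_x(l_x)$ are the values at $x$ of these functions. -/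

import Mathlib

set_option linter.unusedSectionVars false

open scoped Manifold ContDiff Bundle TensorProduct Topology

noncomputable section

/-! ## Poisson algebras and the standard formal Poisson algebra -/

/-- `P`, with multiplication `mul`, unit `one` and bracket `br`, is a (commutative, unital) Poisson
algebra over `S`. -/
structure IsPoissonAlgebra (S P : Type*) [CommRing S] [AddCommGroup P] [Module S P]
    (mul : P → P → P) (one : P) (br : P → P → P) : Prop where
  mul_comm : ∀ a b, mul a b = mul b a
  mul_assoc : ∀ a b c, mul (mul a b) c = mul a (mul b c)
  one_mul : ∀ a, mul one a = a
  add_mul : ∀ a b c, mul (a + b) c = mul a c + mul b c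
  smul_mul : ∀ (s : S) (a b : P), mul (s • a) b = s • mul a b
  br_self : ∀ a, br a a = 0
  br_skew : ∀ a b, br a b = -br b a
  add_br : ∀ a b c, br (a + b) c = br a c + br b c
  smul_br : ∀ (s : S) (a b : P), br (s • a) b = s • br a b
  leibniz : ∀ a b c, br a (mul b c) = mul b (br a c) + mul c (br a b)
  jacobi : ∀ a b c, br a (br b c) + br b (br c a) + br c (br a b) = 0

/-- `ℝ[[x₁, …, xₙ, ξ₁, …, ξₙ]]`; the variable `xᵢ` is `Sum.inl i` and `ξᵢ` is `Sum.inr i`. -/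
abbrev FormalPhaseSpace (n : ℕ) : Type := MvPowerSeries (Fin n ⊕ Fin n) ℝ

/-- `{f, g}_st = ∑ᵢ (∂_{xᵢ} f ∂_{ξᵢ} g - ∂_{ξᵢ} f ∂_{xᵢ} g)`. -/
def standardBracket (n : ℕ) (f g : FormalPhaseSpace n) : FormalPhaseSpace n :=
  ∑ i : Fin n,
    (MvPowerSeries.pderiv ℝ (Sum.inl i) f * MvPowerSeries.pderiv ℝ (Sum.inr i) g -
      MvPowerSeries.pderiv ℝ (Sum.inr i) f * MvPowerSeries.pderiv ℝ (Sum.inl i) g)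

/-! ## The enveloping algebra of a Lie–Rinehart algebra and its jets

For a Lie algebroid, `A` is the algebra of smooth functions, `L` the Lie algebra of sections and
the enveloping algebra is the algebra of `E`-differential operators. -/

section LieRinehart

variable (R A L : Type*) [CommRing R] [CommRing A] [Algebra R A] [LieRing L] [LieAlgebra R L]
  [Module A L] [LieRingModule L A] [LieRinehartRing A L] [LieRinehartAlgebra R A L]

/-- The relations of the enveloping algebra in the tensor algebra on `A × L`.  The first two turn
the tensor algebra into the free product of the algebra `A` with the tensor algebra of `L`. -/
inductive EnvRel : TensorAlgebra R (A × L) → TensorAlgebra R (A × L) → Prop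
  | one : EnvRel (TensorAlgebra.ι R (1, 0)) 1
  | mul (f g : A) : EnvRel (TensorAlgebra.ι R (f * g, 0))
      (TensorAlgebra.ι R (f, 0) * TensorAlgebra.ι R (g, 0))
  | smul (f : A) (x : L) : EnvRel (TensorAlgebra.ι R (0, f • x))
      (TensorAlgebra.ι R (f, 0) * TensorAlgebra.ι R (0, x))
  | leibniz (x : L) (f : A) : EnvRel (TensorAlgebra.ι R (0, x) * TensorAlgebra.ι R (f, 0))
      (TensorAlgebra.ι R (f, 0) * TensorAlgebra.ι R (0, x) + TensorAlgebra.ι R (⁅x, f⁆, 0))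
  | lie (x y : L) : EnvRel (TensorAlgebra.ι R (0, x) * TensorAlgebra.ι R (0, y))
      (TensorAlgebra.ι R (0, y) * TensorAlgebra.ι R (0, x) + TensorAlgebra.ι R (0, ⁅x, y⁆))

/-- The enveloping algebra of the Lie–Rinehart algebra `(A, L)`. -/
def Env : Type _ := RingQuot (EnvRel R A L)

instance : Ring (Env R A L) := inferInstanceAs (Ring (RingQuot (EnvRel R A L)))

instance : Algebra R (Env R A L) := inferInstanceAs (Algebra R (RingQuot (EnvRel R A L)))

namespace Env

/-- The quotient map from the tensor algebra. -/
def mk : TensorAlgebra R (A × L) →ₐ[R] Env R A L := RingQuot.mkAlgHom R (EnvRel R A L)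

theorem mk_rel {a b : TensorAlgebra R (A × L)} (h : EnvRel R A L a b) :
    mk R A L a = mk R A L b := RingQuot.mkAlgHom_rel R h

/-- Functions as elements of the enveloping algebra. -/
def ofFun : A →ₐ[R] Env R A L :=
  AlgHom.ofLinearMap
    ((mk R A L).toLinearMap ∘ₗ TensorAlgebra.ι R ∘ₗ LinearMap.inl R A L)
    (by simpa using mk_rel R A L (EnvRel.one))
    (fun f g => by simpa using mk_rel R A L (EnvRel.mul f g))

/-- Left multiplication by functions. -/
instance : Module A (Env R A L) := Module.compHom _ (ofFun R A L).toRingHom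

theorem fun_smul_def (f : A) (D : Env R A L) : f • D = ofFun R A L f * D := rfl

instance : IsScalarTower R A (Env R A L) where
  smul_assoc r f D := by simp [fun_smul_def]

instance : SMulCommClass A R (Env R A L) where
  smul_comm f r D := by simp [fun_smul_def]

/-- The elements of `L` in the enveloping algebra. -/
def ι : L →ₗ[A] Env R A L where
  toFun x := mk R A L (TensorAlgebra.ι R (0, x))
  map_add' x y := by
    rw [← map_add, ← map_add]; simp
  map_smul' f x := by
    simpa [fun_smul_def, ofFun] using mk_rel R A L (EnvRel.smul f x)

theorem ι_smul (r : R) (x : L) : ι R A L (r • x) = r • ι R A L x := by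
  rw [← algebraMap_smul A r x, map_smul, algebraMap_smul]

theorem ι_mul_ofFun (x : L) (f : A) :
    ι R A L x * ofFun R A L f = ofFun R A L f * ι R A L x + ofFun R A L ⁅x, f⁆ := by
  simpa [ι, ofFun] using mk_rel R A L (EnvRel.leibniz x f)

theorem ι_mul_ι (x y : L) :
    ι R A L x * ι R A L y = ι R A L y * ι R A L x + ι R A L ⁅x, y⁆ := by
  simpa [ι] using mk_rel R A L (EnvRel.lie x y)

/-- The universal property. -/
def lift {B : Type*} [Ring B] [Algebra R B] (φ : A →ₐ[R] B) (ψ : L →ₗ[R] B)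
    (h₁ : ∀ f x, ψ (f • x) = φ f * ψ x)
    (h₂ : ∀ x f, ψ x * φ f = φ f * ψ x + φ ⁅x, f⁆)
    (h₃ : ∀ x y, ψ x * ψ y = ψ y * ψ x + ψ ⁅x, y⁆) : Env R A L →ₐ[R] B :=
  RingQuot.liftAlgHom R ⟨TensorAlgebra.lift R (φ.toLinearMap.coprod ψ), by
    intro a b h
    induction h with
    | one => simp
    | mul f g => simp
    | smul f x => simp [h₁]
    | leibniz x f => simp [h₂]
    | lie x y => simp [h₃ x y]⟩

theorem lift_mk {B : Type*} [Ring B] [Algebra R B] (φ : A →ₐ[R] B) (ψ : L →ₗ[R] B)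
    (h₁ : ∀ f x, ψ (f • x) = φ f * ψ x)
    (h₂ : ∀ x f, ψ x * φ f = φ f * ψ x + φ ⁅x, f⁆)
    (h₃ : ∀ x y, ψ x * ψ y = ψ y * ψ x + ψ ⁅x, y⁆) (z : TensorAlgebra R (A × L)) :
    lift R A L φ ψ h₁ h₂ h₃ (mk R A L z) = TensorAlgebra.lift R (φ.toLinearMap.coprod ψ) z :=
  RingQuot.liftAlgHom_mkAlgHom_apply R _ _ _

theorem lift_ofFun {B : Type*} [Ring B] [Algebra R B] (φ : A →ₐ[R] B) (ψ : L →ₗ[R] B)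
    (h₁ : ∀ f x, ψ (f • x) = φ f * ψ x)
    (h₂ : ∀ x f, ψ x * φ f = φ f * ψ x + φ ⁅x, f⁆)
    (h₃ : ∀ x y, ψ x * ψ y = ψ y * ψ x + ψ ⁅x, y⁆) (f : A) :
    lift R A L φ ψ h₁ h₂ h₃ (ofFun R A L f) = φ f := by
  simp [ofFun, lift_mk]

theorem lift_ι {B : Type*} [Ring B] [Algebra R B] (φ : A →ₐ[R] B) (ψ : L →ₗ[R] B)
    (h₁ : ∀ f x, ψ (f • x) = φ f * ψ x)
    (h₂ : ∀ x f, ψ x * φ f = φ f * ψ x + φ ⁅x, f⁆)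
    (h₃ : ∀ x y, ψ x * ψ y = ψ y * ψ x + ψ ⁅x, y⁆) (x : L) :
    lift R A L φ ψ h₁ h₂ h₃ (ι R A L x) = ψ x := by
  simp [ι, lift_mk]

/-- The action `ρ` of the enveloping algebra on `A`: functions act by multiplication and elements
of `L` through the anchor. -/
def anchorAction : Env R A L →ₐ[R] Module.End R A :=
  lift R A L (Algebra.lmul R A)
    (LinearMap.mk₂ R (fun (x : L) (f : A) => ⁅x, f⁆) add_lie smul_lie lie_add
      (fun c x f => lie_smul c x f))
    (fun f x => by ext g; simp)
    (fun x f => by ext g; simp)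
    (fun x y => by ext g; simp [add_comm])

/-- `D₁ ⊗ D₂ ↦ x D₁ ⊗ D₂ + D₁ ⊗ x D₂`, on the tensor product of left `A`-modules. -/
def coactι (x : L) : Module.End R (Env R A L ⊗[A] Env R A L) where
  toFun := TensorProduct.liftAddHom
    (AddMonoidHom.mk'
      (fun D₁ => AddMonoidHom.mk' (fun D₂ => (ι R A L x * D₁) ⊗ₜ[A] D₂ + D₁ ⊗ₜ[A] (ι R A L x * D₂))
        (fun a b => by simp only [TensorProduct.tmul_add, mul_add]; abel))
      (fun a b => by
        ext D
        simp only [AddMonoidHom.mk'_apply, AddMonoidHom.add_apply, TensorProduct.add_tmul, mul_add]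
        abel))
    (fun f a b => by
      simp only [AddMonoidHom.mk'_apply, fun_smul_def, ← mul_assoc, ι_mul_ofFun, add_mul]
      simp only [mul_assoc]
      simp only [← fun_smul_def, TensorProduct.add_tmul, TensorProduct.tmul_add,
        TensorProduct.tmul_smul, ← TensorProduct.smul_tmul']
      abel)
  map_add' := map_add _
  map_smul' r z := by
    induction z using TensorProduct.induction_on with
    | zero => simp
    | add a b ha hb => simp only [smul_add, map_add, ha, hb]
    | tmul a b =>
      simp only [TensorProduct.smul_tmul', TensorProduct.liftAddHom_tmul, AddMonoidHom.mk'_apply,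
        RingHom.id_apply, smul_add, mul_smul_comm]

@[simp] theorem coactι_tmul (x : L) (D₁ D₂ : Env R A L) :
    coactι R A L x (D₁ ⊗ₜ[A] D₂) = (ι R A L x * D₁) ⊗ₜ[A] D₂ + D₁ ⊗ₜ[A] (ι R A L x * D₂) := rfl

theorem end_ext {f g : Module.End R (Env R A L ⊗[A] Env R A L)}
    (h : ∀ D₁ D₂, f (D₁ ⊗ₜ[A] D₂) = g (D₁ ⊗ₜ[A] D₂)) : f = g := by
  ext z
  induction z using TensorProduct.induction_on with
  | zero => simp
  | add a b ha hb => simp [ha, hb]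
  | tmul a b => exact h a b

/-- The coproduct `Δ₀`, `x ↦ x ⊗ 1 + 1 ⊗ x` for `x ∈ L`, as multiplication on the left:
`coact D z = Δ₀(D) · z`, with `z` in the tensor product over `A` of the left `A`-modules `Env` and
`Env`.  See `coact_toEnv` for the comparison with the coproduct of the universal enveloping algebra
of `L`. -/
def coact : Env R A L →ₐ[R] Module.End R (Env R A L ⊗[A] Env R A L) :=
  lift R A L (Algebra.lsmul R R (Env R A L ⊗[A] Env R A L))
    { toFun := coactι R A L
      map_add' := fun x y => end_ext R A L fun D₁ D₂ => by
        simp only [coactι_tmul, map_add, add_mul, TensorProduct.add_tmul, TensorProduct.tmul_add,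
          LinearMap.add_apply]
        abel
      map_smul' := fun r x => end_ext R A L fun D₁ D₂ => by
        simp only [coactι_tmul, ι_smul, smul_mul_assoc, RingHom.id_apply, LinearMap.smul_apply, smul_add,
          TensorProduct.smul_tmul', TensorProduct.tmul_smul] }
    (fun f x => end_ext R A L fun D₁ D₂ => by
      simp only [LinearMap.coe_mk, AddHom.coe_mk, coactι_tmul, Module.End.mul_apply,
        Algebra.lsmul_coe, map_smul, fun_smul_def, mul_assoc, smul_add]
      simp only [← fun_smul_def, TensorProduct.smul_tmul', TensorProduct.tmul_smul])
    (fun x f => end_ext R A L fun D₁ D₂ => by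
      simp only [LinearMap.coe_mk, AddHom.coe_mk, Module.End.mul_apply, LinearMap.add_apply,
        Algebra.lsmul_coe, TensorProduct.smul_tmul', coactι_tmul, smul_add]
      simp only [fun_smul_def, ← mul_assoc, ι_mul_ofFun, add_mul, TensorProduct.add_tmul]
      abel)
    (fun x y => end_ext R A L fun D₁ D₂ => by
      simp only [LinearMap.coe_mk, AddHom.coe_mk, Module.End.mul_apply, LinearMap.add_apply,
        coactι_tmul, map_add, ← mul_assoc]
      rw [ι_mul_ι R A L x y]
      simp only [add_mul, TensorProduct.add_tmul, TensorProduct.tmul_add]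
      abel)

theorem coact_ι (x : L) : coact R A L (ι R A L x) = coactι R A L x := lift_ι ..

theorem coact_ofFun (f : A) (z : Env R A L ⊗[A] Env R A L) :
    coact R A L (ofFun R A L f) z = f • z := by
  rw [coact, lift_ofFun]; rfl

theorem coact_fun_smul (f : A) (D : Env R A L) (z : Env R A L ⊗[A] Env R A L) :
    coact R A L (f • D) z = f • coact R A L D z := by
  rw [fun_smul_def, map_mul, Module.End.mul_apply, coact_ofFun]

section Coproduct

attribute [local instance] LieRing.ofAssociativeRing

/-- The natural map from the universal enveloping algebra of the Lie algebra `L`. -/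
def toEnv : UniversalEnvelopingAlgebra R L →ₐ[R] Env R A L :=
  UniversalEnvelopingAlgebra.lift R
    { toFun := ι R A L
      map_add' := map_add _
      map_smul' := ι_smul R A L
      map_lie' := fun {x y} => by
        rw [LieRing.of_associative_ring_bracket, ι_mul_ι R A L x y]; abel }

variable {R L} in
/-- `x ⊗ 1 + 1 ⊗ x`. -/
def primitive (x : L) : UniversalEnvelopingAlgebra R L ⊗[R] UniversalEnvelopingAlgebra R L :=
  UniversalEnvelopingAlgebra.ι R x ⊗ₜ 1 + 1 ⊗ₜ UniversalEnvelopingAlgebra.ι R x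

/-- The coproduct `Δ₀` of the universal enveloping algebra of `L`: the homomorphism of algebras
with `x ↦ x ⊗ 1 + 1 ⊗ x` for `x ∈ L`. -/
def coproduct : UniversalEnvelopingAlgebra R L →ₐ[R]
    UniversalEnvelopingAlgebra R L ⊗[R] UniversalEnvelopingAlgebra R L :=
  UniversalEnvelopingAlgebra.lift R
    { toFun := primitive
      map_add' := fun x y => by
        simp only [primitive, map_add, TensorProduct.add_tmul, TensorProduct.tmul_add]; abel
      map_smul' := fun r x => by
        simp only [primitive, map_smul, TensorProduct.smul_tmul', TensorProduct.tmul_smul,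
          smul_add, RingHom.id_apply]
      map_lie' := fun {x y} => by
        simp only [primitive, LieHom.map_lie, LieRing.of_associative_ring_bracket, mul_add, add_mul,
          Algebra.TensorProduct.tmul_mul_tmul, one_mul, mul_one, TensorProduct.sub_tmul,
          TensorProduct.tmul_sub]
        abel }

/-- The projection from the tensor product over `R` to the tensor product over `A`. -/
def proj : Env R A L ⊗[R] Env R A L →ₗ[R] Env R A L ⊗[A] Env R A L :=
  TensorProduct.lift (LinearMap.mk₂ R (fun D₁ D₂ => D₁ ⊗ₜ[A] D₂)
    (fun a b c => TensorProduct.add_tmul a b c) (fun r a b => (TensorProduct.smul_tmul' r a b).symm)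
    (fun a b c => TensorProduct.tmul_add a b c) (fun r a b => TensorProduct.tmul_smul r a b))

/-- On the image of the universal enveloping algebra of `L`, `coact` is multiplication by the
coproduct `Δ₀`. -/
theorem coact_toEnv (u : UniversalEnvelopingAlgebra R L) (z : Env R A L ⊗[R] Env R A L) :
    coact R A L (toEnv R A L u) (proj R A L z) =
      proj R A L (Algebra.TensorProduct.map (toEnv R A L) (toEnv R A L) (coproduct R L u) * z) := by
  obtain ⟨t, rfl⟩ := RingCon.mkₐ_surjective (α := R) (UniversalEnvelopingAlgebra.ringCon R L) u
  change coact R A L (toEnv R A L (UniversalEnvelopingAlgebra.mkAlgHom R L t)) _ =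
    proj R A L (Algebra.TensorProduct.map (toEnv R A L) (toEnv R A L)
      (coproduct R L (UniversalEnvelopingAlgebra.mkAlgHom R L t)) * z)
  induction t using TensorAlgebra.induction generalizing z with
  | algebraMap r => simp [Algebra.algebraMap_eq_smul_one]
  | mul a b ha hb => simp only [map_mul, Module.End.mul_apply, ha, hb, mul_assoc]
  | add a b ha hb => simp only [map_add, LinearMap.add_apply, ha, hb, add_mul]
  | ι x =>
    have h₁ : toEnv R A L (UniversalEnvelopingAlgebra.mkAlgHom R L (TensorAlgebra.ι R x)) =
        ι R A L x := UniversalEnvelopingAlgebra.lift_ι_apply R _ x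
    have h₂ : coproduct R L (UniversalEnvelopingAlgebra.mkAlgHom R L (TensorAlgebra.ι R x)) =
        primitive x := UniversalEnvelopingAlgebra.lift_ι_apply R _ x
    rw [h₁, h₂, coact_ι]
    induction z using TensorProduct.induction_on with
    | zero => simp
    | add a b ha hb => simp only [map_add, mul_add, ha, hb]
    | tmul a b =>
      simp [primitive, h₁, proj, add_mul]

end Coproduct

end Env

/-- `Hom_A(Env, K)` for a commutative `A`-algebra `K`: jets with values in `K`. -/
abbrev Jet (K : Type*) [CommRing K] [Algebra A K] : Type _ := Env R A L →ₗ[A] K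

namespace Jet

variable {R A L} {K : Type*} [CommRing K] [Algebra A K]

/-- `l₁ ⊗ l₂ : D₁ ⊗ D₂ ↦ l₁(D₁) l₂(D₂)`. -/
def tensor (l₁ l₂ : Jet R A L K) : Env R A L ⊗[A] Env R A L →ₗ[A] K :=
  LinearMap.mul' A K ∘ₗ TensorProduct.map l₁ l₂

/-- `D ↦ (l₁ ⊗ l₂)(Δ₀(D) · z)`. -/
def coactDual (z : Env R A L ⊗[A] Env R A L) (l₁ l₂ : Jet R A L K) : Jet R A L K where
  toFun D := tensor l₁ l₂ (Env.coact R A L D z)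
  map_add' D D' := by simp
  map_smul' f D := by simp [Env.coact_fun_smul]

/-- The product `(l₁ l₂)(D) = (l₁ ⊗ l₂)(Δ₀(D))`. -/
def mul (l₁ l₂ : Jet R A L K) : Jet R A L K := coactDual (1 ⊗ₜ[A] 1) l₁ l₂

/-- The unit jet `D ↦ ρ(D)(1)`. -/
def one : Jet R A L K where
  toFun D := algebraMap A K (Env.anchorAction R A L D 1)
  map_add' D D' := by simp
  map_smul' f D := by
    rw [Env.fun_smul_def, map_mul, Module.End.mul_apply, Env.anchorAction, Env.lift_ofFun]
    simp [Algebra.smul_def]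

/-- The bracket `{l₁, l₂}(D) = (l₁ ⊗ l₂)(Δ₀(D) · ϖ)` defined by a tensor `ϖ = ∑ᵢ eᵢ ⊗ fᵢ`. -/
def bracket (ϖ : L ⊗[A] L) : Jet R A L K → Jet R A L K → Jet R A L K :=
  coactDual (TensorProduct.map (Env.ι R A L) (Env.ι R A L) ϖ)

end Jet

end LieRinehart

/-! ## Lie algebroids -/

section LieAlgebroid

variable {B : Type*} [NormedAddCommGroup B] [NormedSpace ℝ B]
  {H : Type*} [TopologicalSpace H] (I : ModelWithCorners ℝ B H)
  {M : Type*} [TopologicalSpace M] [ChartedSpace H M] [IsManifold I ∞ M]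
  (F : Type*) [NormedAddCommGroup F] [NormedSpace ℝ F]
  (V : M → Type*) [TopologicalSpace (Bundle.TotalSpace F V)]
  [∀ x, AddCommGroup (V x)] [∀ x, Module ℝ (V x)] [∀ x, TopologicalSpace (V x)]
  [FiberBundle F V] [VectorBundle ℝ F V]

/-- Smooth sections form a module over smooth functions. -/
instance ContMDiffSection.instModuleSmoothFunctions :
    Module C^∞⟮I, M; ℝ⟯ Cₛ^∞⟮I; F, V⟯ where
  smul f s := ⟨fun x => f x • s x, f.contMDiff.smul_section s.contMDiff⟩
  one_smul s := by ext x; exact one_smul ℝ (s x)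
  mul_smul f g s := by ext x; exact mul_smul (f x) (g x) (s x)
  smul_zero f := by ext x; exact smul_zero (f x)
  smul_add f s t := by ext x; exact smul_add (f x) (s x) (t x)
  add_smul f g s := by ext x; exact add_smul (f x) (g x) (s x)
  zero_smul s := by ext x; exact zero_smul ℝ (s x)

@[simp] theorem ContMDiffSection.fun_smul_apply (f : C^∞⟮I, M; ℝ⟯) (s : Cₛ^∞⟮I; F, V⟯) (x : M) :
    (f • s) x = f x • s x := rfl

/-- A smooth homomorphism of vector bundles from `V` to the tangent bundle. -/
structure AnchorMap where
  toFun : ∀ x : M, V x →ₗ[ℝ] TangentSpace I x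
  smooth : ContMDiff (I.prod 𝓘(ℝ, F)) I.tangent ∞
    (fun v : Bundle.TotalSpace F V => (⟨v.1, toFun v.1 v.2⟩ : TangentBundle I M))

variable {I F V} in
/-- The derivative `ρ(σ)(f)` of the function `f` along the vector field `ρ(σ)`. -/
def AnchorMap.deriv (ρ : AnchorMap I F V) (σ : Cₛ^∞⟮I; F, V⟯) (f : C^∞⟮I, M; ℝ⟯) :
    C^∞⟮I, M; ℝ⟯ where
  val x := mvfderiv I f x (ρ.toFun x (σ x))
  property :=
    (contMDiff_snd_tangentBundle_modelSpace ℝ 𝓘(ℝ, ℝ)).comp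
      ((f.contMDiff.contMDiff_tangentMap (m := ∞) (by simp)).comp
        (ρ.smooth.comp σ.contMDiff))

/-- A Lie algebroid structure on the vector bundle `V`: an anchor, and a Lie bracket on sections
that is compatible with the anchor and satisfies the Leibniz rule.  In `anchor_lie` the commutator of vector
fields is written as the commutator of the corresponding derivations of functions. -/
class LieAlgebroid where
  anchor : AnchorMap I F V
  lie : Cₛ^∞⟮I; F, V⟯ → Cₛ^∞⟮I; F, V⟯ → Cₛ^∞⟮I; F, V⟯
  lie_add : ∀ σ τ υ, lie σ (τ + υ) = lie σ τ + lie σ υ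
  lie_self : ∀ σ, lie σ σ = 0
  add_lie : ∀ σ τ υ, lie (σ + τ) υ = lie σ υ + lie τ υ
  lie_smul : ∀ (c : ℝ) σ τ, lie σ (c • τ) = c • lie σ τ
  jacobi : ∀ σ τ υ, lie σ (lie τ υ) = lie (lie σ τ) υ + lie τ (lie σ υ)
  anchor_lie : ∀ σ τ f,
    anchor.deriv (lie σ τ) f = anchor.deriv σ (anchor.deriv τ f) - anchor.deriv τ (anchor.deriv σ f)
  lie_fun_smul : ∀ σ (f : C^∞⟮I, M; ℝ⟯) τ, lie σ (f • τ) = anchor.deriv σ f • τ + f • lie σ τ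

variable {I F V}

theorem AnchorMap.deriv_add (ρ : AnchorMap I F V) (σ : Cₛ^∞⟮I; F, V⟯) (f g : C^∞⟮I, M; ℝ⟯) :
    ρ.deriv σ (f + g) = ρ.deriv σ f + ρ.deriv σ g := by
  ext x
  have hf := f.contMDiff.mdifferentiableAt (x := x) (by simp)
  have hg := g.contMDiff.mdifferentiableAt (x := x) (by simp)
  change mvfderiv I (⇑f + ⇑g) x _ = mvfderiv I f x _ + mvfderiv I g x _
  rw [mvfderiv_add hf hg]; rfl

theorem AnchorMap.deriv_mul (ρ : AnchorMap I F V) (σ : Cₛ^∞⟮I; F, V⟯) (f g : C^∞⟮I, M; ℝ⟯) :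
    ρ.deriv σ (f * g) = f * ρ.deriv σ g + ρ.deriv σ f * g := by
  ext x
  have hf := f.contMDiff.mdifferentiableAt (x := x) (by simp)
  have hg := g.contMDiff.mdifferentiableAt (x := x) (by simp)
  change mvfderiv I (⇑f * ⇑g) x _ = f x * mvfderiv I g x _ + mvfderiv I f x _ * g x
  rw [mvfderiv_mul hf hg]
  simp [mul_comm]

theorem AnchorMap.deriv_const_smul (ρ : AnchorMap I F V) (σ : Cₛ^∞⟮I; F, V⟯) (c : ℝ)
    (f : C^∞⟮I, M; ℝ⟯) : ρ.deriv σ (c • f) = c • ρ.deriv σ f := by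
  ext x
  have hf := f.contMDiff.mdifferentiableAt (x := x) (by simp)
  change mvfderiv I (c • ⇑f) x _ = c • mvfderiv I f x _
  have h : mvfderiv I ((fun _ : M => c) • ⇑f) x = _ := mvfderiv_smul mdifferentiableAt_const hf
  rw [mvfderiv_const] at h
  change mvfderiv I ((fun _ : M => c) • ⇑f) x _ = _
  rw [h]; simp

variable [LieAlgebroid I F V]

open LieAlgebroid

instance : LieRing Cₛ^∞⟮I; F, V⟯ where
  bracket := lie
  add_lie := LieAlgebroid.add_lie
  lie_add := LieAlgebroid.lie_add
  lie_self := LieAlgebroid.lie_self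
  leibniz_lie := LieAlgebroid.jacobi

instance : LieAlgebra ℝ Cₛ^∞⟮I; F, V⟯ where
  lie_smul := LieAlgebroid.lie_smul

/-- The action `σ f = ρ(σ)(f)` of sections on functions. -/
instance : LieRingModule Cₛ^∞⟮I; F, V⟯ C^∞⟮I, M; ℝ⟯ where
  bracket := anchor.deriv
  add_lie σ τ f := by
    ext x
    change mvfderiv I f x (anchor.toFun x (σ x + τ x)) = _
    rw [map_add, map_add]; rfl
  lie_add σ f g := anchor.deriv_add σ f g
  leibniz_lie σ τ f := by
    change anchor.deriv σ (anchor.deriv τ f) =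
      anchor.deriv (lie σ τ) f + anchor.deriv τ (anchor.deriv σ f)
    rw [anchor_lie]; abel

instance : LieRinehartRing C^∞⟮I, M; ℝ⟯ Cₛ^∞⟮I; F, V⟯ where
  lie_smul_eq_mul' f g σ := by
    ext x
    change mvfderiv I g x (anchor.toFun x (f x • σ x)) = _
    rw [map_smul, map_smul]; rfl
  leibniz_mul_right' σ f g := anchor.deriv_mul σ f g
  leibniz_smul_right' σ τ f := by
    change lie σ (f • τ) = f • lie σ τ + anchor.deriv σ f • τ
    rw [lie_fun_smul, add_comm]

instance : LieRinehartAlgebra ℝ C^∞⟮I, M; ℝ⟯ Cₛ^∞⟮I; F, V⟯ where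
  smul_assoc c f σ := by ext x; exact mul_smul c (f x) (σ x)
  smul_lie c σ f := by
    ext x
    change mvfderiv I f x (anchor.toFun x (c • σ x)) = _
    rw [map_smul, map_smul]; rfl
  lie_smul c σ f := anchor.deriv_const_smul σ c f

variable (I F V) in
/-- The algebra `ᴱOp(M)` of `E`-differential operators. -/
abbrev EOp : Type _ := Env ℝ C^∞⟮I, M; ℝ⟯ Cₛ^∞⟮I; F, V⟯

variable (I F V) in
/-- The space `ᴱJets(M) = Hom_{C^∞(M)}(ᴱOp(M), C^∞(M))` of `E`-jets on `M`. -/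
abbrev EJets : Type _ := Jet ℝ C^∞⟮I, M; ℝ⟯ Cₛ^∞⟮I; F, V⟯ C^∞⟮I, M; ℝ⟯

/-- The field `ℝ`, regarded as an algebra over smooth functions by evaluation at `m`. -/
def ScalarAt (_m : M) : Type := ℝ

instance (m : M) : CommRing (ScalarAt m) := inferInstanceAs (CommRing ℝ)

instance (m : M) : Algebra ℝ (ScalarAt m) := inferInstanceAs (Algebra ℝ ℝ)

instance (m : M) : Algebra C^∞⟮I, M; ℝ⟯ (ScalarAt m) :=
  (ContMDiffMap.evalRingHom m : C^∞⟮I, M; ℝ⟯ →+* ℝ).toAlgebra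

variable (I F V) in
/-- The fibre at `m` of the bundle of `E`-jets: the dual of the fibre at `m` of `ᴱOp`, that is, the
additive maps `λ : ᴱOp(M) → ℝ` with `λ(f D) = f(m) λ(D)`. -/
abbrev EJetFiber (m : M) : Type _ := Jet ℝ C^∞⟮I, M; ℝ⟯ Cₛ^∞⟮I; F, V⟯ (ScalarAt m)

/-- The value at `m` of an `E`-jet on `M`: `D ↦ l(D)(m)`. -/
def EJets.at (l : EJets I F V) (m : M) : EJetFiber I F V m :=
  Algebra.linearMap C^∞⟮I, M; ℝ⟯ (ScalarAt m) ∘ₗ l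

/-! ## Symplectic Lie algebroids -/

variable (I F V) in
/-- Smooth `E`-two-forms, that is, sections of `Λ² E*`. -/
structure ETwoForm where
  toFun : ∀ x : M, V x →ₗ[ℝ] V x →ₗ[ℝ] ℝ
  alt : ∀ x v, toFun x v v = 0
  smooth : ∀ σ τ : Cₛ^∞⟮I; F, V⟯, ContMDiff I 𝓘(ℝ, ℝ) ∞ fun x => toFun x (σ x) (τ x)

namespace ETwoForm

/-- The function `Ω(σ, τ)`. -/
def eval (Ω : ETwoForm I F V) (σ τ : Cₛ^∞⟮I; F, V⟯) : C^∞⟮I, M; ℝ⟯ :=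
  ⟨fun x => Ω.toFun x (σ x) (τ x), Ω.smooth σ τ⟩

/-- The `E`-de Rham differential of a two-form. -/
def d (Ω : ETwoForm I F V) (σ₁ σ₂ σ₃ : Cₛ^∞⟮I; F, V⟯) : C^∞⟮I, M; ℝ⟯ :=
  -⁅σ₁, Ω.eval σ₂ σ₃⁆ + ⁅σ₂, Ω.eval σ₁ σ₃⁆ - ⁅σ₃, Ω.eval σ₁ σ₂⁆
    + Ω.eval ⁅σ₁, σ₂⁆ σ₃ - Ω.eval ⁅σ₁, σ₃⁆ σ₂ + Ω.eval ⁅σ₂, σ₃⁆ σ₁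

/-- `Ω` is closed and fibrewise nondegenerate. -/
structure IsSymplectic (Ω : ETwoForm I F V) : Prop where
  closed : ∀ σ₁ σ₂ σ₃, Ω.d σ₁ σ₂ σ₃ = 0
  nondegenerate : ∀ x (v : V x), (∀ w, Ω.toFun x v w = 0) → v = 0

/-- `e ↦ (I_Ω e)(σ) = Ω(e, σ)`. -/
def contractLeft (Ω : ETwoForm I F V) (σ : Cₛ^∞⟮I; F, V⟯) :
    Cₛ^∞⟮I; F, V⟯ →ₗ[C^∞⟮I, M; ℝ⟯] C^∞⟮I, M; ℝ⟯ where
  toFun e := Ω.eval e σ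
  map_add' e e' := by
    ext x
    change Ω.toFun x (e x + e' x) (σ x) = _
    rw [map_add]; rfl
  map_smul' f e := by
    ext x
    change Ω.toFun x (f x • e x) (σ x) = _
    rw [map_smul]; rfl

/-- `((I_Ω ⊗ I_Ω) ϖ)(σ, τ)`, that is, `∑ᵢ Ω(eᵢ, σ) Ω(fᵢ, τ)` if `ϖ = ∑ᵢ eᵢ ⊗ fᵢ`. -/
def lower (Ω : ETwoForm I F V) (ϖ : Cₛ^∞⟮I; F, V⟯ ⊗[C^∞⟮I, M; ℝ⟯] Cₛ^∞⟮I; F, V⟯)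
    (σ τ : Cₛ^∞⟮I; F, V⟯) : C^∞⟮I, M; ℝ⟯ :=
  (LinearMap.mul' C^∞⟮I, M; ℝ⟯ C^∞⟮I, M; ℝ⟯ ∘ₗ
    TensorProduct.map (Ω.contractLeft σ) (Ω.contractLeft τ)) ϖ

/-- The tensor `ϖ = ∑ᵢ eᵢ ⊗ fᵢ` represents the inverse of `Ω`, i.e. `(I_Ω ⊗ I_Ω) ϖ = Ω`, on a
neighbourhood of `m`. -/
def IsInverseNear (Ω : ETwoForm I F V) (m : M)
    (ϖ : Cₛ^∞⟮I; F, V⟯ ⊗[C^∞⟮I, M; ℝ⟯] Cₛ^∞⟮I; F, V⟯) : Prop :=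
  ∀ᶠ x in 𝓝 m, ∀ σ τ : Cₛ^∞⟮I; F, V⟯, Ω.lower ϖ σ τ x = Ω.eval σ τ x

end ETwoForm

/-- A smooth local trivialization over `U` of the profinite-dimensional bundle of `E`-jets, with
fibre `ℝ[[x₁, …, xₙ, ξ₁, …, ξₙ]]`.  Each coordinate of the trivialization is the pairing with an
`E`-differential operator (`smooth`), so that it is continuous and takes jets on `M` to smooth
families of power series; conversely each smooth family of power series on `M` is, over `U`, the
image of a jet on `M` (`surjective`). -/
structure IsJetTrivialization (n : ℕ) (U : Set M)
    (φ : ∀ x : U, EJetFiber I F V x.1 ≃ₗ[ℝ] FormalPhaseSpace n) : Prop where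
  smooth : ∀ d : Fin n ⊕ Fin n →₀ ℕ, ∃ D : EOp I F V, ∀ (x : U) (l : EJetFiber I F V x.1),
    MvPowerSeries.coeff d (φ x l) = l D
  surjective : ∀ c : (Fin n ⊕ Fin n →₀ ℕ) → C^∞⟮I, M; ℝ⟯, ∃ l : EJets I F V,
    ∀ (x : U) (d : Fin n ⊕ Fin n →₀ ℕ), MvPowerSeries.coeff d (φ x (l.at x.1)) = c d x.1

/-- `φ` is an isomorphism of Poisson algebras from the fibre at `m`, with the bracket `br`, to the
standard Poisson algebra. -/
structure IsStandardPoissonIso (n : ℕ) {m : M}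
    (br : EJetFiber I F V m → EJetFiber I F V m → EJetFiber I F V m)
    (φ : EJetFiber I F V m ≃ₗ[ℝ] FormalPhaseSpace n) : Prop where
  map_mul : ∀ a b, φ (Jet.mul a b) = φ a * φ b
  map_one : φ Jet.one = 1
  map_bracket : ∀ a b, φ (br a b) = standardBracket n (φ a) (φ b)

end LieAlgebroid

end

/-!
The algebra of jets is dual to the algebra of `E`-differential operators, and its Poisson bracket is
recognised by means of a flat connection in the style of Fedosov.

Around each point `Ω` has a symplectic frame `e_a` (symplectic Gram–Schmidt,
`ETwoForm.exists_symplectic_frame`).  To treat functions near a point as an algebra `S`, restrict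
the functions on `M` to an open set, as the quotient `Restrictions I U` of `C^∞(M)`; a cut-off
function makes the frame expansion of global sections hold over `S`.  The result is the
algebraic structure `SymplecticChart`, to which the main part of the argument applies.

Over a chart, consider connections `F ↦ ρ(σ)(F) + {γ(σ), F}` on `S[[x, ξ]]`, where `ρ(σ)` acts on
the coefficients and `γ` is a one-form with values in Hamiltonians.  Start with the linear `γ(e_a)`
whose Hamiltonian derivation is `-∂_a`.  A correction of order two can be found such that the
curvature of `γ` is the central element `Ω` (`SymplecticChart.exists_connectionForm`): the
correction in radial gauge solves a fixed-point equation, since `N + 1` is invertible on power series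
for the Euler vector field `N`, and the Bianchi identity, which uses `dΩ = 0`, shows that the
solution has the required curvature.  As `Ω` is central, the connection is flat and is
compatible with the product and the Poisson bracket.

A flat connection gives an action of the enveloping algebra on the dual of `S[[x, ξ]]`, and hence a
map `F ↦ (D ↦ (D · ev₀)(F))` from power series to jets (`SymplecticChart.toJet`), where `ev₀` is the
constant term.  It respects products because each `σ` acts by a derivation of the product, and takes
the Poisson bracket to the bracket defined by the inverse tensor because `e_a · ev₀` is the
partial derivative `∂_a` at the origin (`SymplecticChart.bracket_toJet`).  To leading order
`D · ev₀` is a Taylor coefficient, so that each Taylor coefficient is obtained from some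
differential operator, and these operators span modulo functions that vanish on the chart
(`SymplecticChart.toJet_dualOperator`, `SymplecticChart.jet_eq_zero`).  The values of a jet on these
operators are its coordinates.  They identify each fibre with the standard Poisson algebra, from
which the identities of a Poisson algebra are transported to the fibres and to the jets on `M`.

The value of the bracket at a point only depends on the tensor near the point, because the coproduct
preserves the tensors that vanish in `S` (`SymplecticChart.bracket_congr`).
-/

noncomputable section

/-! ### The Poisson bracket on formal power series -/

namespace FormalPoisson

open MvPowerSeries

variable {n : ℕ} {S : Type*} [CommRing S]

/-- The power series ring `S[[x₁, …, xₙ, ξ₁, …, ξₙ]]`. -/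
abbrev Series (n : ℕ) (S : Type*) : Type _ := MvPowerSeries (Fin n ⊕ Fin n) S

/-- The standard Poisson bracket over an arbitrary ring of coefficients. -/
def poisson (F G : Series n S) : Series n S :=
  ∑ i : Fin n, (pderiv S (Sum.inl i) F * pderiv S (Sum.inr i) G -
    pderiv S (Sum.inr i) F * pderiv S (Sum.inl i) G)

theorem pderiv_comm {ι : Type*} (a b : ι) (F : MvPowerSeries ι S) :
    pderiv S a (pderiv S b F) = pderiv S b (pderiv S a F) := by
  classical
  by_cases h : a = b
  · rw [h]
  ext d
  simp only [coeff_pderiv, Finsupp.add_apply, Finsupp.single_eq_of_ne h,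
    Finsupp.single_eq_of_ne (Ne.symm h), add_zero, add_right_comm d]
  ring

theorem poisson_skew (F G : Series n S) : poisson F G = -poisson G F := by
  simp only [poisson, ← Finset.sum_neg_distrib]
  exact Finset.sum_congr rfl fun i _ => by ring

theorem poisson_self (F : Series n S) : poisson F F = 0 :=
  Finset.sum_eq_zero fun i _ => by ring

theorem poisson_add_left (F F' G : Series n S) :
    poisson (F + F') G = poisson F G + poisson F' G := by
  simp only [poisson, ← Finset.sum_add_distrib, map_add]
  exact Finset.sum_congr rfl fun i _ => by ring

theorem poisson_add_right (F G G' : Series n S) :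
    poisson F (G + G') = poisson F G + poisson F G' := by
  simp only [poisson, ← Finset.sum_add_distrib, map_add]
  exact Finset.sum_congr rfl fun i _ => by ring

theorem poisson_smul_left (s : S) (F G : Series n S) : poisson (s • F) G = s • poisson F G := by
  simp only [poisson, Derivation.map_smul, smul_mul_assoc, Finset.smul_sum, smul_sub]

theorem poisson_smul_right (s : S) (F G : Series n S) : poisson F (s • G) = s • poisson F G := by
  simp only [poisson, Derivation.map_smul, mul_smul_comm, Finset.smul_sum, smul_sub]

theorem poisson_mul_right (F G H : Series n S) :
    poisson F (G * H) = G * poisson F H + H * poisson F G := by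
  simp only [poisson, Finset.mul_sum, ← Finset.sum_add_distrib, Derivation.leibniz, smul_eq_mul]
  exact Finset.sum_congr rfl fun i _ => by ring

theorem poisson_C_right (F : Series n S) (s : S) : poisson F (C s) = 0 := by
  simp [poisson]

theorem poisson_C_left (F : Series n S) (s : S) : poisson (C s) F = 0 := by
  simp [poisson]

/-- The bracket as a bilinear map. -/
def poissonBilin (n : ℕ) (S : Type*) [CommRing S] : Series n S →ₗ[S] Series n S →ₗ[S] Series n S :=
  LinearMap.mk₂ S poisson poisson_add_left poisson_smul_left poisson_add_right
    poisson_smul_right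

theorem poissonBilin_apply (F G : Series n S) : poissonBilin n S F G = poisson F G := rfl

/-- The Jacobi identity.  The sum of the double brackets is a sum over pairs of indices `i, j` whose
terms cancel with those for `j, i`; division by two, hence the real scalars, finishes the argument. -/
theorem poisson_jacobi [Algebra ℝ S] (F G H : Series n S) :
    poisson F (poisson G H) + poisson G (poisson H F) + poisson H (poisson F G) = 0 := by
  set x : Fin n → Derivation S (Series n S) (Series n S) := fun i => pderiv S (Sum.inl i)
  set y : Fin n → Derivation S (Series n S) (Series n S) := fun i => pderiv S (Sum.inr i)
  have exp (F G H : Series n S) : poisson F (poisson G H) = ∑ i, ∑ j,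
      (x i F * y i (x j G * y j H - y j G * x j H) -
        y i F * x i (x j G * y j H - y j G * x j H)) := by
    simp only [poisson, map_sum, Finset.mul_sum, ← Finset.sum_sub_distrib, x, y]
  set a : Fin n → Fin n → Series n S := fun i j =>
    (x i F * y i (x j G * y j H - y j G * x j H) -
        y i F * x i (x j G * y j H - y j G * x j H)) +
    (x i G * y i (x j H * y j F - y j H * x j F) -
        y i G * x i (x j H * y j F - y j H * x j F)) +
    (x i H * y i (x j F * y j G - y j F * x j G) -
        y i H * x i (x j F * y j G - y j F * x j G)) with ha
  have h0 : poisson F (poisson G H) + poisson G (poisson H F) + poisson H (poisson F G) =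
      ∑ i, ∑ j, a i j := by
    simp only [exp, ← Finset.sum_add_distrib, ha]
  have h1 (i j : Fin n) : a i j + a j i = 0 := by
    have hx (i j : Fin n) (F : Series n S) (_ : i ≤ j) : x j (x i F) = x i (x j F) :=
      pderiv_comm _ _ _
    have hy (i j : Fin n) (F : Series n S) (_ : i ≤ j) : y j (y i F) = y i (y j F) :=
      pderiv_comm _ _ _
    have hxy (i j : Fin n) (F : Series n S) : y j (x i F) = x i (y j F) := pderiv_comm _ _ _
    simp only [ha, map_sub, Derivation.leibniz, smul_eq_mul]
    simp only [hxy]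
    rcases le_total i j with h | h
    · simp only [hx i j _ h, hy i j _ h]; ring
    · simp only [hx j i _ h, hy j i _ h]; ring
  have h2 : (2 : ℝ) • ∑ i, ∑ j, a i j = 0 := by
    rw [two_smul]
    nth_rw 2 [Finset.sum_comm]
    simp only [← Finset.sum_add_distrib, h1, Finset.sum_const_zero]
  rw [h0]
  have := congrArg (fun z => (2⁻¹ : ℝ) • z) h2
  simpa [smul_smul] using this

/-! ### Operators on power series and the degree filtration -/

section Coefficients

variable {ι : Type*}

/-- A derivation of the coefficients, applied to each coefficient of a power series. -/
def coeffwise [Algebra ℝ S] (D : Derivation ℝ S S) :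
    Derivation ℝ (MvPowerSeries ι S) (MvPowerSeries ι S) where
  toFun F := fun d => D (coeff d F)
  map_add' F G := by ext d; exact map_add D _ _
  map_smul' r F := by ext d; exact D.map_smul r _
  map_one_eq_zero' := by
    classical
    ext d
    change D (coeff d 1) = 0
    rw [coeff_one]
    split_ifs <;> simp
  leibniz' F G := by
    classical
    ext d
    change D (coeff d (F * G)) = coeff d (F * _ + G * _)
    rw [mul_comm G, coeff_mul, map_add, coeff_mul, coeff_mul, map_sum, ← Finset.sum_add_distrib]
    refine Finset.sum_congr rfl fun p _ => ?_
    rw [D.leibniz, smul_eq_mul, smul_eq_mul, mul_comm (coeff p.2 G)]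
    rfl

@[simp] theorem coeff_coeffwise [Algebra ℝ S] (D : Derivation ℝ S S) (d : ι →₀ ℕ)
    (F : MvPowerSeries ι S) : coeff d (coeffwise D F) = D (coeff d F) := rfl

theorem coeffwise_C [Algebra ℝ S] (D : Derivation ℝ S S) (s : S) :
    coeffwise D (C s : MvPowerSeries ι S) = C (D s) := by
  classical
  ext d
  rw [coeff_coeffwise, coeff_C, coeff_C]
  split_ifs <;> simp

theorem coeffwise_X [Algebra ℝ S] (D : Derivation ℝ S S) (a : ι) :
    coeffwise D (X a : MvPowerSeries ι S) = 0 := by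
  classical
  ext d
  rw [coeff_coeffwise, coeff_X]
  split_ifs <;> simp

theorem coeffwise_pderiv [Algebra ℝ S] (D : Derivation ℝ S S) (a : ι) (F : MvPowerSeries ι S) :
    coeffwise D (pderiv S a F) = pderiv S a (coeffwise D F) := by
  ext d
  rw [coeff_coeffwise, coeff_pderiv, coeff_pderiv, coeff_coeffwise, D.leibniz]
  simp [mul_comm]

theorem coeffwise_smul [Algebra ℝ S] (D : Derivation ℝ S S) (s : S) (F : MvPowerSeries ι S) :
    coeffwise D (s • F) = s • coeffwise D F + D s • F := by
  ext d
  simp [mul_comm]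

theorem coeffwise_poisson [Algebra ℝ S] (D : Derivation ℝ S S) (F G : Series n S) :
    coeffwise D (poisson F G) = poisson (coeffwise D F) G + poisson F (coeffwise D G) := by
  simp only [poisson, map_sum, map_sub, Derivation.leibniz, smul_eq_mul, coeffwise_pderiv,
    ← Finset.sum_add_distrib]
  exact Finset.sum_congr rfl fun i _ => by ring

/-- The power series all of whose terms have degree at least `k`. -/
def orderIdeal (ι S : Type*) [CommRing S] (k : ℕ) : Ideal (MvPowerSeries ι S) where
  carrier := {F | ∀ d, d.degree < k → coeff d F = 0}
  add_mem' hF hG d hd := by rw [map_add, hF d hd, hG d hd, add_zero]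
  zero_mem' d _ := map_zero _
  smul_mem' G F hF d hd := by
    classical
    rw [smul_eq_mul, coeff_mul]
    refine Finset.sum_eq_zero fun p hp => ?_
    have := congrArg Finsupp.degree (Finset.HasAntidiagonal.mem_antidiagonal.1 hp)
    rw [map_add] at this
    rw [hF p.2 (by omega), mul_zero]

theorem orderIdeal_mono {j k : ℕ} (h : j ≤ k) {F : MvPowerSeries ι S}
    (hF : F ∈ orderIdeal ι S k) : F ∈ orderIdeal ι S j := fun d hd => hF d (hd.trans_le h)

theorem mem_orderIdeal_zero (F : MvPowerSeries ι S) : F ∈ orderIdeal ι S 0 :=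
  fun _ hd => absurd hd (Nat.not_lt_zero _)

theorem eq_zero_of_forall_mem_orderIdeal {F : MvPowerSeries ι S}
    (h : ∀ k, F ∈ orderIdeal ι S k) : F = 0 := by
  ext d
  exact h (d.degree + 1) d (Nat.lt_succ_self _)

theorem mul_mem_orderIdeal {j k : ℕ} {F G : MvPowerSeries ι S} (hF : F ∈ orderIdeal ι S j)
    (hG : G ∈ orderIdeal ι S k) : F * G ∈ orderIdeal ι S (j + k) := fun d hd => by
  classical
  rw [coeff_mul]
  refine Finset.sum_eq_zero fun p hp => ?_
  have := congrArg Finsupp.degree (Finset.HasAntidiagonal.mem_antidiagonal.1 hp)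
  rw [map_add] at this
  by_cases h : p.1.degree < j
  · rw [hF _ h, zero_mul]
  · rw [hG p.2 (by omega), mul_zero]

theorem pderiv_mem_orderIdeal {k : ℕ} {F : MvPowerSeries ι S} (hF : F ∈ orderIdeal ι S k) (a : ι) :
    pderiv S a F ∈ orderIdeal ι S (k - 1) := fun d hd => by
  rw [coeff_pderiv, hF _ (by rw [map_add, Finsupp.degree_single]; omega), zero_mul]

theorem coeffwise_mem_orderIdeal [Algebra ℝ S] {k : ℕ} {F : MvPowerSeries ι S}
    (hF : F ∈ orderIdeal ι S k) (D : Derivation ℝ S S) : coeffwise D F ∈ orderIdeal ι S k :=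
  fun d hd => by rw [coeff_coeffwise, hF d hd, map_zero]

theorem smul_mem_orderIdeal {k : ℕ} {F : MvPowerSeries ι S} (hF : F ∈ orderIdeal ι S k) (s : S) :
    s • F ∈ orderIdeal ι S k := fun d hd => by rw [map_smul, hF d hd, smul_zero]

theorem X_mem_orderIdeal (a : ι) : (X a : MvPowerSeries ι S) ∈ orderIdeal ι S 1 := fun d hd => by
  classical
  rw [coeff_X, if_neg]
  rintro rfl
  simp at hd

theorem poisson_mem_orderIdeal {j k : ℕ} {F G : Series n S}
    (hF : F ∈ orderIdeal (Fin n ⊕ Fin n) S j) (hG : G ∈ orderIdeal (Fin n ⊕ Fin n) S k) :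
    poisson F G ∈ orderIdeal (Fin n ⊕ Fin n) S (j + k - 2) := by
  refine sum_mem fun i _ => sub_mem ?_ ?_ <;>
  exact orderIdeal_mono (by omega)
    (mul_mem_orderIdeal (pderiv_mem_orderIdeal hF _) (pderiv_mem_orderIdeal hG _))

/-- The Euler vector field multiplies each coefficient by its degree. -/
theorem coeff_euler [Fintype ι] (F : MvPowerSeries ι S) (d : ι →₀ ℕ) :
    coeff d (∑ a, X a * pderiv S a F) = (d.degree : S) * coeff d F := by
  classical
  rw [map_sum, Finsupp.degree_eq_sum, Nat.cast_sum, Finset.sum_mul]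
  refine Finset.sum_congr rfl fun a _ => ?_
  rw [X, coeff_monomial_mul, one_mul, coeff_pderiv]
  split_ifs with h
  · rw [tsub_add_cancel_of_le h, mul_comm]
    congr 1
    have h1 : 1 ≤ d a := by simpa using h a
    rw [Finsupp.tsub_apply, Finsupp.single_eq_same, Nat.cast_sub h1]
    simp
  · have h1 : d a = 0 := by
      by_contra h0
      exact h (Finsupp.single_le_iff.2 (Nat.one_le_iff_ne_zero.2 h0))
    rw [h1, Nat.cast_zero, zero_mul]

/-- Division of the homogeneous component of degree `k` by `k + 1`. -/
def radial [Algebra ℝ S] (F : MvPowerSeries ι S) : MvPowerSeries ι S :=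
  fun d => ((d.degree : ℝ) + 1)⁻¹ • coeff d F

@[simp] theorem coeff_radial [Algebra ℝ S] (F : MvPowerSeries ι S) (d : ι →₀ ℕ) :
    coeff d (radial F) = ((d.degree : ℝ) + 1)⁻¹ • coeff d F := rfl

theorem radial_sub [Algebra ℝ S] (F G : MvPowerSeries ι S) :
    radial (F - G) = radial F - radial G := by
  ext d
  simp [smul_sub]

theorem radial_mem_orderIdeal [Algebra ℝ S] {k : ℕ} {F : MvPowerSeries ι S}
    (hF : F ∈ orderIdeal ι S k) : radial F ∈ orderIdeal ι S k :=
  fun d hd => by rw [coeff_radial, hF d hd, smul_zero]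

/-- `radial` inverts `N + 1`, where `N` is the Euler vector field. -/
theorem euler_radial [Algebra ℝ S] [Fintype ι] (F : MvPowerSeries ι S) :
    ∑ a, X a * pderiv S a (radial F) + radial F = F := by
  ext d
  rw [map_add, coeff_euler, coeff_radial]
  have h : ((d.degree : ℝ) + 1) ≠ 0 := by positivity
  calc (d.degree : S) * ((d.degree : ℝ) + 1)⁻¹ • coeff d F + ((d.degree : ℝ) + 1)⁻¹ • coeff d F
      = ((d.degree : ℝ) + 1) • ((d.degree : ℝ) + 1)⁻¹ • coeff d F := by
        rw [add_smul _ (1 : ℝ), one_smul, Nat.cast_smul_eq_nsmul, nsmul_eq_mul]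
    _ = coeff d F := by rw [smul_smul, mul_inv_cancel₀ h, one_smul]

/-- A power series is determined by its image under `N + k`, `k > 0`, and the same holds in each
degree. -/
theorem coeff_eq_zero_of_euler [Algebra ℝ S] [Fintype ι] {F : MvPowerSeries ι S} {k : ℕ}
    {d : ι →₀ ℕ} (hk : 0 < d.degree + k)
    (h : coeff d (∑ a, X a * pderiv S a F + (k : S) • F) = 0) : coeff d F = 0 := by
  rw [map_add, coeff_euler, map_smul, smul_eq_mul, ← add_mul, ← Nat.cast_add] at h
  have h0 : ((d.degree + k : ℕ) : ℝ) ≠ 0 := Nat.cast_ne_zero.2 hk.ne'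
  rw [← nsmul_eq_mul, ← Nat.cast_smul_eq_nsmul ℝ] at h
  exact (smul_eq_zero_iff_right h0).1 h

/-- A map on families of power series of order at least two that raises the degree of agreement
has a fixed point. -/
theorem exists_fixedPoint {κ : Type*}
    (Φ : (κ → MvPowerSeries ι S) → κ → MvPowerSeries ι S)
    (h₂ : ∀ r, (∀ a, r a ∈ orderIdeal ι S 2) → ∀ a, Φ r a ∈ orderIdeal ι S 2)
    (hc : ∀ k r s, (∀ a, r a ∈ orderIdeal ι S 2) → (∀ a, s a ∈ orderIdeal ι S 2) →
      (∀ a, r a - s a ∈ orderIdeal ι S k) → ∀ a, Φ r a - Φ s a ∈ orderIdeal ι S (k + 1)) :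
    ∃ r, (∀ a, r a ∈ orderIdeal ι S 2) ∧ Φ r = r := by
  -- the iterates of `0`, and their limit, which is taken coefficient by coefficient
  set x : ℕ → κ → MvPowerSeries ι S := fun m => Φ^[m] 0
  have xs (m) : x (m + 1) = Φ (x m) := Function.iterate_succ_apply' Φ m 0
  have x2 (m) : ∀ a, x m a ∈ orderIdeal ι S 2 := by
    induction m with
    | zero => exact fun a => zero_mem _
    | succ m ih => rw [xs]; exact h₂ _ ih
  have x1 (m) : ∀ a, x (m + 1) a - x m a ∈ orderIdeal ι S m := by
    induction m with
    | zero => exact fun a => mem_orderIdeal_zero _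
    | succ m ih => rw [xs (m + 1)]; nth_rw 2 [xs m]; exact hc _ _ _ (x2 _) (x2 _) ih
  have xm (m j) : ∀ a, x (m + j) a - x m a ∈ orderIdeal ι S m := by
    induction j with
    | zero => intro a; simp
    | succ j ih =>
      intro a
      rw [← sub_add_sub_cancel _ (x (m + j) a)]
      exact add_mem (orderIdeal_mono (Nat.le_add_right m j) (x1 (m + j) a)) (ih a)
  set r : κ → MvPowerSeries ι S := fun a d => coeff d (x (d.degree + 1) a)
  have rx (m) : ∀ a, r a - x m a ∈ orderIdeal ι S m := fun a d hd => by
    obtain ⟨j, rfl⟩ := Nat.exists_eq_add_of_lt hd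
    have h := xm (d.degree + 1) j a d (Nat.lt_succ_self _)
    rw [add_right_comm, map_sub, sub_eq_zero] at h
    rw [map_sub, sub_eq_zero, h]
    rfl
  have r2 : ∀ a, r a ∈ orderIdeal ι S 2 := fun a => by
    rw [← sub_add_cancel (r a) (x 2 a)]
    exact add_mem (rx 2 a) (x2 2 a)
  refine ⟨r, r2, funext fun a => sub_eq_zero.1 (eq_zero_of_forall_mem_orderIdeal fun m => ?_)⟩
  rw [← sub_sub_sub_cancel_right _ _ (x (m + 1) a)]
  refine orderIdeal_mono (Nat.le_succ m) (sub_mem ?_ (rx _ a))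
  rw [xs]
  exact hc m _ _ r2 (x2 m) (rx m) a

end Coefficients

end FormalPoisson

end

noncomputable section

/-! ### Flat symplectic connections on formal power series -/

open MvPowerSeries FormalPoisson

/-- The constant matrix `ω(e_a, e_b)` of a symplectic form in a symplectic frame, where
`e_{inl i}` is paired with `e_{inr i}`. -/
def standardForm (n : ℕ) (S : Type*) [CommRing S] : Fin n ⊕ Fin n → Fin n ⊕ Fin n → S
  | Sum.inl i, Sum.inr j => if i = j then 1 else 0
  | Sum.inr i, Sum.inl j => if i = j then -1 else 0
  | _, _ => 0

/-- The linear function with Hamiltonian derivation `-∂_a`, written `u_a` below. -/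
def conjVar (n : ℕ) (S : Type*) [CommRing S] : Fin n ⊕ Fin n → Series n S
  | Sum.inl i => X (Sum.inr i)
  | Sum.inr i => -X (Sum.inl i)

section ConjVar

variable {n : ℕ} {S : Type*} [CommRing S]

theorem poisson_conjVar (a : Fin n ⊕ Fin n) (F : Series n S) :
    poisson (conjVar n S a) F = -pderiv S a F := by
  rcases a with i | i
  · rw [poisson, Finset.sum_eq_single i]
    · simp [conjVar, pderiv_X_self, pderiv_X_of_ne]
    · intro j _ hj
      simp [conjVar, pderiv_X_of_ne, hj.symm]
    · simp
  · rw [poisson, Finset.sum_eq_single i]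
    · simp [conjVar, pderiv_X_self, pderiv_X_of_ne]
    · intro j _ hj
      simp [conjVar, pderiv_X_of_ne, hj.symm]
    · simp

theorem poisson_conjVar_conjVar (a b : Fin n ⊕ Fin n) :
    poisson (conjVar n S a) (conjVar n S b) = C (standardForm n S a b) := by
  rw [poisson_conjVar]
  rcases a with i | i <;> rcases b with j | j <;>
    simp only [conjVar, standardForm, map_neg, pderiv_X, Pi.single_apply, neg_neg]
  · simp
  · by_cases h : i = j <;> simp [h, eq_comm]
  · by_cases h : i = j <;> simp [h, eq_comm]
  · simp

theorem conjVar_mem_orderIdeal (a : Fin n ⊕ Fin n) :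
    conjVar n S a ∈ orderIdeal (Fin n ⊕ Fin n) S 1 := by
  rcases a with i | i
  · exact X_mem_orderIdeal _
  · exact neg_mem (X_mem_orderIdeal _)

theorem coeffwise_conjVar [Algebra ℝ S] (D : Derivation ℝ S S) (a : Fin n ⊕ Fin n) :
    coeffwise D (conjVar n S a) = 0 := by
  rcases a with i | i <;> simp [conjVar, coeffwise_X]

end ConjVar

/-- A Lie–Rinehart algebra `(A, L)` seen over a quotient algebra `S` of `A` over which `L` has a
symplectic frame: `S` carries an action of `L` compatible with that on `A`, elements of `L` have
coordinates `θ a` with respect to `e a` up to multiples of functions that vanish in `S`, and `Ω` is a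
closed form which is standard in the frame.  If `A` and `L` are the smooth functions and sections
on a manifold, `S` consists of the restrictions of functions to an open set. -/
structure SymplecticChart (n : ℕ) (A L S : Type*) [CommRing A] [Algebra ℝ A] [LieRing L]
    [LieAlgebra ℝ L] [Module A L] [LieRingModule L A] [LieRinehartRing A L]
    [LieRinehartAlgebra ℝ A L] [CommRing S] [Algebra ℝ S] [Algebra A S] [IsScalarTower ℝ A S] where
  ρ : L →ₗ[A] Derivation ℝ S S
  ρ_algebraMap : ∀ σ f, ρ σ (algebraMap A S f) = algebraMap A S ⁅σ, f⁆
  ρ_lie : ∀ σ τ s, ρ ⁅σ, τ⁆ s = ρ σ (ρ τ s) - ρ τ (ρ σ s)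
  surj : Function.Surjective (algebraMap A S)
  e : Fin n ⊕ Fin n → L
  θ : Fin n ⊕ Fin n → L →ₗ[A] A
  expand : ∀ σ, σ - ∑ a, θ a σ • e a ∈ RingHom.ker (algebraMap A S) • (⊤ : Submodule A L)
  θ_e : ∀ a b, algebraMap A S (θ a (e b)) = if a = b then 1 else 0
  Ω : L →ₗ[A] L →ₗ[A] S
  Ω_self : ∀ σ, Ω σ σ = 0
  closed : ∀ σ τ υ, ρ σ (Ω τ υ) - Ω ⁅σ, τ⁆ υ + (ρ τ (Ω υ σ) - Ω ⁅τ, υ⁆ σ) +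
    (ρ υ (Ω σ τ) - Ω ⁅υ, σ⁆ τ) = 0
  Ω_e : ∀ a b, Ω (e a) (e b) = standardForm n S a b

namespace SymplecticChart

variable {n : ℕ} {A L S : Type*} [CommRing A] [Algebra ℝ A] [LieRing L]
    [LieAlgebra ℝ L] [Module A L] [LieRingModule L A] [LieRinehartRing A L]
    [LieRinehartAlgebra ℝ A L] [CommRing S] [Algebra ℝ S] [Algebra A S] [IsScalarTower ℝ A S]
    (c : SymplecticChart n A L S)

/-- An `A`-linear map to a module on which `A` acts through `S` is determined by its values on the
frame. -/
theorem map_eq_sum {N : Type*} [AddCommGroup N] [Module A N]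
    (hN : ∀ f ∈ RingHom.ker (algebraMap A S), ∀ x : N, f • x = 0) (g : L →ₗ[A] N) (σ : L) :
    g σ = ∑ a, c.θ a σ • g (c.e a) := by
  have h : ∀ τ ∈ RingHom.ker (algebraMap A S) • (⊤ : Submodule A L), g τ = 0 := fun τ hτ => by
    induction hτ using Submodule.smul_induction_on' with
    | smul f hf x _ => rw [map_smul, hN f hf]
    | add x _ y _ hx hy => rw [map_add, hx, hy, add_zero]
  have := h _ (c.expand σ)
  rw [map_sub, sub_eq_zero, map_sum] at this
  simpa using this

theorem ker_smul {f : A} (hf : f ∈ RingHom.ker (algebraMap A S)) (F : Series n S) : f • F = 0 := by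
  rw [← algebraMap_smul S f F, RingHom.mem_ker.1 hf, zero_smul]

/-- The derivative of a power series along `σ`, in the coefficients. -/
abbrev D (σ : L) : Derivation ℝ (Series n S) (Series n S) := coeffwise (c.ρ σ)

theorem D_add (σ τ : L) (F : Series n S) : c.D (σ + τ) F = c.D σ F + c.D τ F := by
  ext d; simp [D]

theorem D_smul_left (f : A) (σ : L) (F : Series n S) : c.D (f • σ) F = f • c.D σ F := by
  ext d; simp [D]

theorem D_smul (σ : L) (f : A) (F : Series n S) :
    c.D σ (f • F) = f • c.D σ F + ⁅σ, f⁆ • F := by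
  rw [← algebraMap_smul S f F, coeffwise_smul, c.ρ_algebraMap, algebraMap_smul, algebraMap_smul]

theorem D_lie (σ τ : L) (F : Series n S) :
    c.D ⁅σ, τ⁆ F = c.D σ (c.D τ F) - c.D τ (c.D σ F) := by
  ext d; simp [D, c.ρ_lie]

theorem poisson_smul_left' (f : A) (F G : Series n S) : poisson (f • F) G = f • poisson F G := by
  rw [← algebraMap_smul S f F, poisson_smul_left, algebraMap_smul]

theorem poisson_smul_right' (f : A) (F G : Series n S) : poisson F (f • G) = f • poisson F G := by
  rw [← algebraMap_smul S f G, poisson_smul_right, algebraMap_smul]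

theorem poisson_sub_right (F G G' : Series n S) :
    poisson F (G - G') = poisson F G - poisson F G' := map_sub (poissonBilin n S F) G G'

theorem poisson_sub_left (F F' G : Series n S) :
    poisson (F - F') G = poisson F G - poisson F' G := by
  simp only [← poissonBilin_apply, map_sub, LinearMap.sub_apply]

theorem poisson_neg_right (F G : Series n S) :
    poisson F (-G) = -poisson F G := map_neg (poissonBilin n S F) G

/-- The curvature `ρ_σ γ(τ) - ρ_τ γ(σ) + {γ(σ), γ(τ)} - γ([σ, τ])` of the connection
`ρ_σ + {γ(σ), ·}`. -/
def curvature (γ : L →ₗ[A] Series n S) : L →ₗ[A] L →ₗ[A] Series n S :=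
  have add (σ τ υ : L) : c.D σ (γ (τ + υ)) - c.D (τ + υ) (γ σ) + poisson (γ σ) (γ (τ + υ)) -
      γ ⁅σ, τ + υ⁆ = (c.D σ (γ τ) - c.D τ (γ σ) + poisson (γ σ) (γ τ) - γ ⁅σ, τ⁆) +
      (c.D σ (γ υ) - c.D υ (γ σ) + poisson (γ σ) (γ υ) - γ ⁅σ, υ⁆) := by
    rw [map_add, map_add, D_add, poisson_add_right, lie_add, map_add]; abel
  have smul (f : A) (σ τ : L) : c.D σ (γ (f • τ)) - c.D (f • τ) (γ σ) + poisson (γ σ) (γ (f • τ)) -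
      γ ⁅σ, f • τ⁆ = f • (c.D σ (γ τ) - c.D τ (γ σ) + poisson (γ σ) (γ τ) - γ ⁅σ, τ⁆) := by
    rw [map_smul, D_smul, D_smul_left, poisson_smul_right', LieRinehartRing.leibniz_smul_right,
      map_add, map_smul, map_smul]
    simp only [smul_sub, smul_add]
    abel
  have skew (σ τ : L) : c.D σ (γ τ) - c.D τ (γ σ) + poisson (γ σ) (γ τ) - γ ⁅σ, τ⁆ =
      -(c.D τ (γ σ) - c.D σ (γ τ) + poisson (γ τ) (γ σ) - γ ⁅τ, σ⁆) := by
    rw [poisson_skew, ← lie_skew, map_neg]; abel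
  LinearMap.mk₂ A
    (fun σ τ => c.D σ (γ τ) - c.D τ (γ σ) + poisson (γ σ) (γ τ) - γ ⁅σ, τ⁆)
    (fun σ τ υ => by rw [skew, add, neg_add, ← skew, ← skew])
    (fun f σ τ => by rw [skew, smul, ← smul_neg, ← skew])
    add (fun f σ τ => smul f σ τ)

theorem curvature_apply (γ : L →ₗ[A] Series n S) (σ τ : L) : c.curvature γ σ τ =
    c.D σ (γ τ) - c.D τ (γ σ) + poisson (γ σ) (γ τ) - γ ⁅σ, τ⁆ := rfl

/-- The second Bianchi identity. -/
theorem bianchi (γ : L →ₗ[A] Series n S) (σ τ υ : L) :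
    c.D σ (c.curvature γ τ υ) + poisson (γ σ) (c.curvature γ τ υ) - c.curvature γ ⁅σ, τ⁆ υ +
    (c.D τ (c.curvature γ υ σ) + poisson (γ τ) (c.curvature γ υ σ) - c.curvature γ ⁅τ, υ⁆ σ) +
    (c.D υ (c.curvature γ σ τ) + poisson (γ υ) (c.curvature γ σ τ) - c.curvature γ ⁅υ, σ⁆ τ) =
      0 := by
  have h1 := poisson_jacobi (γ σ) (γ τ) (γ υ)
  have h2 : γ ⁅⁅σ, τ⁆, υ⁆ + γ ⁅⁅τ, υ⁆, σ⁆ + γ ⁅⁅υ, σ⁆, τ⁆ = 0 := by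
    rw [← map_add, ← map_add, ← lie_skew ⁅σ, τ⁆ υ, ← lie_skew ⁅τ, υ⁆ σ, ← lie_skew ⁅υ, σ⁆ τ,
      ← neg_add, ← neg_add, map_neg, neg_eq_zero, ← map_zero γ]
    congr 1
    rw [← lie_jacobi σ τ υ]; abel
  have s (F G : Series n S) := poisson_skew F G
  simp only [curvature_apply, map_add, map_sub, D_lie, coeffwise_poisson, poisson_add_right,
    poisson_sub_right]
  rw [s (γ υ) (c.D τ (γ σ)), s (γ υ) (c.D σ (γ τ)), s (γ σ) (c.D τ (γ υ)), s (γ σ) (c.D υ (γ τ)),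
    s (γ τ) (c.D σ (γ υ)), s (γ τ) (c.D υ (γ σ)), s (γ ⁅τ, υ⁆), s (γ ⁅υ, σ⁆), s (γ ⁅σ, τ⁆)]
  linear_combination (exp := 1) h1 + h2

/-- The curvature equation `∂_a r_b - ∂_b r_a = T_{ab}(r)` for `γ_a = u_a + r_a` has right-hand
side `T`. -/
def curvatureRHS (r : Fin n ⊕ Fin n → Series n S) (a b : Fin n ⊕ Fin n) : Series n S :=
  c.D (c.e a) (r b) - c.D (c.e b) (r a) + poisson (r a) (r b) -
    ∑ k, c.θ k ⁅c.e a, c.e b⁆ • (conjVar n S k + r k)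

theorem curvatureRHS_skew (r : Fin n ⊕ Fin n → Series n S) (a b : Fin n ⊕ Fin n) :
    c.curvatureRHS r a b = -c.curvatureRHS r b a := by
  have : ∑ k, c.θ k ⁅c.e a, c.e b⁆ • (conjVar n S k + r k) =
      -∑ k, c.θ k ⁅c.e b, c.e a⁆ • (conjVar n S k + r k) := by
    rw [← Finset.sum_neg_distrib]
    refine Finset.sum_congr rfl fun k _ => ?_
    rw [← lie_skew, map_neg, neg_smul]
  rw [curvatureRHS, curvatureRHS, this, poisson_skew (r a)]
  abel

theorem smul_mem_orderIdeal' {k : ℕ} {F : Series n S}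
    (hF : F ∈ orderIdeal (Fin n ⊕ Fin n) S k) (f : A) : f • F ∈ orderIdeal (Fin n ⊕ Fin n) S k := by
  rw [← algebraMap_smul S f F]
  exact smul_mem_orderIdeal hF _

/-- In the radial gauge `∑ y_a r_a = 0`, where `y_a` are the coordinates, contraction of the curvature
equation with the Euler vector field `N = ∑ y_a ∂_a` gives `(N + 1) r_b = ∑ y_a T_{ab}(r)`.  This is a
fixed-point equation for `r`, with a right-hand side that raises the degree of agreement. -/
theorem exists_radial_solution : ∃ r : Fin n ⊕ Fin n → Series n S,
    (∀ a, r a ∈ orderIdeal (Fin n ⊕ Fin n) S 2) ∧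
      ∀ b, radial (∑ a, X a * c.curvatureRHS r a b) = r b := by
  suffices h : _ ∧ _ by
    obtain ⟨r, h2, hr⟩ := exists_fixedPoint
      (fun (r : Fin n ⊕ Fin n → Series n S) b => radial (∑ a, X a * c.curvatureRHS r a b)) h.1 h.2
    exact ⟨r, h2, fun b => congrFun hr b⟩
  constructor
  · intro r hr b
    refine radial_mem_orderIdeal (sum_mem fun a _ => ?_)
    refine mul_mem_orderIdeal (j := 1) (k := 1) (X_mem_orderIdeal a) ?_
    have hr1 (a) := orderIdeal_mono (one_le_two) (hr a)
    refine sub_mem (add_mem (sub_mem ?_ ?_) ?_) (sum_mem fun k _ => smul_mem_orderIdeal' ?_ _)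
    · exact coeffwise_mem_orderIdeal (hr1 b) _
    · exact coeffwise_mem_orderIdeal (hr1 a) _
    · exact orderIdeal_mono (by norm_num) (poisson_mem_orderIdeal (hr a) (hr b))
    · exact add_mem (conjVar_mem_orderIdeal k) (hr1 k)
  · intro k r s hr hs h b
    rw [← radial_sub, ← Finset.sum_sub_distrib]
    refine radial_mem_orderIdeal (sum_mem fun a _ => ?_)
    rw [← mul_sub, add_comm k]
    refine mul_mem_orderIdeal (X_mem_orderIdeal a) ?_
    have : c.curvatureRHS r a b - c.curvatureRHS s a b =
        c.D (c.e a) (r b - s b) - c.D (c.e b) (r a - s a) +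
        (poisson (r a - s a) (r b) + poisson (s a) (r b - s b)) -
        ∑ k, c.θ k ⁅c.e a, c.e b⁆ • (r k - s k) := by
      simp only [curvatureRHS, map_sub, poisson_sub_left, poisson_sub_right, smul_add, smul_sub,
        Finset.sum_add_distrib, Finset.sum_sub_distrib]
      abel
    rw [this]
    refine sub_mem (add_mem (sub_mem ?_ ?_) (add_mem ?_ ?_))
      (sum_mem fun k _ => smul_mem_orderIdeal' (h k) _)
    · exact coeffwise_mem_orderIdeal (h b) _
    · exact coeffwise_mem_orderIdeal (h a) _
    · exact orderIdeal_mono (by omega) (poisson_mem_orderIdeal (h a) (hr b))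
    · exact orderIdeal_mono (by omega) (poisson_mem_orderIdeal (hs a) (h b))

/-- The connection form with values `u_a + r_a` on the frame. -/
def connectionForm (r : Fin n ⊕ Fin n → Series n S) : L →ₗ[A] Series n S :=
  ∑ a, (c.θ a).smulRight (conjVar n S a + r a)

theorem connectionForm_apply (r : Fin n ⊕ Fin n → Series n S) (σ : L) :
    c.connectionForm r σ = ∑ a, c.θ a σ • (conjVar n S a + r a) := by
  simp [connectionForm]

theorem connectionForm_e (r : Fin n ⊕ Fin n → Series n S) (a : Fin n ⊕ Fin n) :
    c.connectionForm r (c.e a) = conjVar n S a + r a := by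
  rw [connectionForm_apply, Finset.sum_eq_single a]
  · rw [← algebraMap_smul S, c.θ_e, if_pos rfl, one_smul]
  · intro b _ hb
    rw [← algebraMap_smul S, c.θ_e, if_neg hb, zero_smul]
  · simp

theorem C_smul' (f : A) (s : S) : (C (f • s) : Series n S) = f • C s := by
  rw [← algebraMap_smul S f s, ← algebraMap_smul S f (C s : Series n S), smul_eq_C_mul, smul_eq_mul,
    map_mul]

/-- The difference of the curvature and the symplectic form. -/
def curvatureDefect (r : Fin n ⊕ Fin n → Series n S) : L →ₗ[A] L →ₗ[A] Series n S :=
  c.curvature (c.connectionForm r) -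
    LinearMap.mk₂ A (fun σ τ => C (c.Ω σ τ)) (fun σ τ υ => by simp)
      (fun f σ τ => by rw [map_smul, LinearMap.smul_apply, C_smul'])
      (fun σ τ υ => by simp)
      (fun f σ τ => by rw [map_smul, C_smul'])

theorem curvatureDefect_apply (r : Fin n ⊕ Fin n → Series n S) (σ τ : L) :
    c.curvatureDefect r σ τ = c.curvature (c.connectionForm r) σ τ - C (c.Ω σ τ) := rfl

theorem curvatureDefect_e (r : Fin n ⊕ Fin n → Series n S) (a b : Fin n ⊕ Fin n) :
    c.curvatureDefect r (c.e a) (c.e b) =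
      c.curvatureRHS r a b - (pderiv S a (r b) - pderiv S b (r a)) := by
  rw [curvatureDefect_apply, curvature_apply, connectionForm_e, connectionForm_e, c.Ω_e, map_add,
    map_add, coeffwise_conjVar, coeffwise_conjVar, connectionForm_apply, curvatureRHS,
    poisson_add_left, poisson_add_right, poisson_add_right, poisson_conjVar_conjVar,
    poisson_conjVar, poisson_skew (r a) (conjVar n S b), poisson_conjVar]
  abel

theorem curvatureDefect_skew (r : Fin n ⊕ Fin n → Series n S) (a b : Fin n ⊕ Fin n) :
    c.curvatureDefect r (c.e a) (c.e b) = -c.curvatureDefect r (c.e b) (c.e a) := by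
  rw [curvatureDefect_e, curvatureDefect_e, curvatureRHS_skew]
  abel

/-- The Bianchi identity for `curvature - Ω`, where `Ω` contributes nothing as it is closed. -/
theorem bianchi_curvatureDefect (r : Fin n ⊕ Fin n → Series n S) (σ τ υ : L) :
    c.D σ (c.curvatureDefect r τ υ) + poisson (c.connectionForm r σ) (c.curvatureDefect r τ υ) -
      c.curvatureDefect r ⁅σ, τ⁆ υ +
    (c.D τ (c.curvatureDefect r υ σ) + poisson (c.connectionForm r τ) (c.curvatureDefect r υ σ) -
      c.curvatureDefect r ⁅τ, υ⁆ σ) +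
    (c.D υ (c.curvatureDefect r σ τ) + poisson (c.connectionForm r υ) (c.curvatureDefect r σ τ) -
      c.curvatureDefect r ⁅υ, σ⁆ τ) = 0 := by
  have h := congrArg (C : S → Series n S) (c.closed σ τ υ)
  simp only [map_add, map_sub, map_zero] at h
  simp only [curvatureDefect_apply, map_sub, coeffwise_C, poisson_sub_right, poisson_C_right]
  linear_combination (exp := 1) c.bianchi (c.connectionForm r) σ τ υ - h

/-- The contraction of `curvature - Ω` with the Euler vector field `N` vanishes.  In terms of the
coordinates `y_a` it is `∑ y_a T_{ab}(r) - (N + 1) r_b + ∂_b (∑ y_a r_a)`, and the equation for `r`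
implies the gauge condition `∑ y_a r_a = 0` since `T` is skew. -/
theorem sum_X_mul_curvatureDefect {r : Fin n ⊕ Fin n → Series n S}
    (h2 : ∀ a, r a ∈ orderIdeal (Fin n ⊕ Fin n) S 2)
    (hr : ∀ b, radial (∑ a, X a * c.curvatureRHS r a b) = r b) (b : Fin n ⊕ Fin n) :
    ∑ a, X a * c.curvatureDefect r (c.e a) (c.e b) = 0 := by
  have hN (b) : ∑ a, X a * pderiv S a (r b) + r b = ∑ a, X a * c.curvatureRHS r a b := by
    have := euler_radial (∑ a, X a * c.curvatureRHS r a b)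
    rwa [hr b] at this
  -- the gauge condition: the sum is annihilated by `N`, and has no constant term
  have hs : ∑ b, X b * r b = 0 := by
    ext d
    rw [map_zero]
    by_cases hd : d.degree = 0
    · exact sum_mem (fun b _ => Ideal.mul_mem_left _ _ (h2 b)) d (by omega)
    refine coeff_eq_zero_of_euler (k := 0) (by omega) ?_
    rw [Nat.cast_zero, zero_smul, add_zero]
    have h1 : ∑ a, X a * pderiv S a (∑ b, X b * r b) =
        ∑ b, ∑ a, X b * (X a * c.curvatureRHS r a b) := by
      have (a : Fin n ⊕ Fin n) : X a * pderiv S a (∑ b, X b * r b) =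
          ∑ b, X b * (X a * pderiv S a (r b)) + X a * r a := by
        rw [map_sum, Finset.mul_sum]
        simp only [Derivation.leibniz, smul_eq_mul, mul_add, Finset.sum_add_distrib]
        congr 1
        · exact Finset.sum_congr rfl fun b _ => by ring
        · rw [Finset.sum_eq_single a]
          · rw [pderiv_X_self, mul_one]
          · intro b _ hb
            rw [pderiv_X_of_ne hb, mul_zero, mul_zero]
          · simp
      simp only [this, Finset.sum_add_distrib]
      rw [Finset.sum_comm]
      simp only [← Finset.mul_sum, ← hN, mul_add, Finset.sum_add_distrib]
    rw [h1]
    have h3 : ∑ b, ∑ a, X b * (X a * c.curvatureRHS r a b) =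
        -∑ b, ∑ a, X b * (X a * c.curvatureRHS r a b) := by
      nth_rw 2 [Finset.sum_comm]
      simp only [← Finset.sum_neg_distrib]
      refine Finset.sum_congr rfl fun b _ => Finset.sum_congr rfl fun a _ => ?_
      rw [c.curvatureRHS_skew r a b]; ring
    have h4 := eq_neg_iff_add_eq_zero.1 h3
    rw [← two_smul ℝ] at h4
    rw [(smul_eq_zero_iff_right two_ne_zero).1 h4, map_zero]
  have hs' := congrArg (pderiv S b) hs
  rw [map_sum, map_zero] at hs'
  simp only [Derivation.leibniz, smul_eq_mul, Finset.sum_add_distrib] at hs'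
  have h5 : ∑ a, r a * pderiv S b (X a) = r b := by
    rw [Finset.sum_eq_single b]
    · rw [pderiv_X_self, mul_one]
    · intro a _ ha
      rw [pderiv_X_of_ne ha, mul_zero]
    · simp
  rw [h5] at hs'
  simp only [curvatureDefect_e, mul_sub, Finset.sum_sub_distrib, ← hN b]
  linear_combination (exp := 1) hs'

/-- By the Bianchi identity, `K = curvature - Ω` is closed up to terms that preserve the order.
Contraction with the Euler vector field `N`, which annihilates `K`, leaves `(N + 2) K` on the left, and
raises the order by one on the right. -/
theorem curvatureDefect_mem {r : Fin n ⊕ Fin n → Series n S}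
    (h2 : ∀ a, r a ∈ orderIdeal (Fin n ⊕ Fin n) S 2)
    (hr : ∀ b, radial (∑ a, X a * c.curvatureRHS r a b) = r b) (m : ℕ) :
    ∀ b b', c.curvatureDefect r (c.e b) (c.e b') ∈ orderIdeal (Fin n ⊕ Fin n) S m := by
  set K : Fin n ⊕ Fin n → Fin n ⊕ Fin n → Series n S :=
    fun a b => c.curvatureDefect r (c.e a) (c.e b)
  have Kskew (a b) : K a b = -K b a := c.curvatureDefect_skew r a b
  have KX (b) : ∑ a, X a * K a b = 0 := c.sum_X_mul_curvatureDefect h2 hr b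
  induction m with
  | zero => exact fun b b' => mem_orderIdeal_zero _
  | succ m ih =>
    intro b b'
    set Q : Fin n ⊕ Fin n → Fin n ⊕ Fin n → Fin n ⊕ Fin n → Series n S := fun a b b' =>
      c.D (c.e a) (K b b') + poisson (r a) (K b b') - ∑ k, c.θ k ⁅c.e a, c.e b⁆ • K k b' with hQ
    have Qm (a b b') : Q a b b' ∈ orderIdeal (Fin n ⊕ Fin n) S m := by
      refine sub_mem (add_mem (coeffwise_mem_orderIdeal (ih _ _) _)
        (orderIdeal_mono (by omega) (poisson_mem_orderIdeal (h2 a) (ih _ _))))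
        (sum_mem fun k _ => smul_mem_orderIdeal' (ih _ _) _)
    have hKsum (σ : L) (b') : c.curvatureDefect r σ (c.e b') = ∑ k, c.θ k σ • K k b' := by
      exact c.map_eq_sum (fun f hf x => ker_smul hf x) ((c.curvatureDefect r).flip (c.e b')) σ
    have hB (a b b') : pderiv S a (K b b') + pderiv S b (K b' a) + pderiv S b' (K a b) =
        Q a b b' + Q b b' a + Q b' a b := by
      have := c.bianchi_curvatureDefect r (c.e a) (c.e b) (c.e b')
      rw [hKsum ⁅_, _⁆, hKsum ⁅_, _⁆, hKsum ⁅_, _⁆, connectionForm_e, connectionForm_e, connectionForm_e,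
        poisson_add_left, poisson_add_left, poisson_add_left, poisson_conjVar, poisson_conjVar,
        poisson_conjVar] at this
      simp only [hQ]
      linear_combination (exp := 1) -this
    have hX (b b') : ∑ a, X a * pderiv S b (K a b') = -K b b' := by
      have := congrArg (pderiv S b) (KX b')
      rw [map_sum, map_zero] at this
      simp only [Derivation.leibniz, smul_eq_mul, Finset.sum_add_distrib] at this
      rw [eq_neg_iff_add_eq_zero, ← this]
      congr 1
      rw [Finset.sum_eq_single b]
      · rw [pderiv_X_self, mul_one]
      · intro a _ ha
        rw [pderiv_X_of_ne ha, mul_zero]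
      · simp
    have key : ∑ a, X a * pderiv S a (K b b') + ((2 : ℕ) : S) • K b b' =
        ∑ a, X a * (Q a b b' + Q b b' a + Q b' a b) := by
      simp only [← hB, mul_add, Finset.sum_add_distrib]
      have h1 : ∑ a, X a * pderiv S b (K b' a) = K b b' := by
        simp only [Kskew b', map_neg, mul_neg, Finset.sum_neg_distrib, hX, neg_neg]
      rw [h1, hX, Kskew b' b, Nat.cast_two, two_smul, neg_neg, add_assoc]
    intro d hd
    refine coeff_eq_zero_of_euler (k := 2) (by omega) ?_
    rw [key]
    suffices h : ∑ a, X a * (Q a b b' + Q b b' a + Q b' a b) ∈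
        orderIdeal (Fin n ⊕ Fin n) S (m + 1) from h d hd
    refine sum_mem fun a _ => ?_
    rw [add_comm m]
    exact mul_mem_orderIdeal (X_mem_orderIdeal a) (add_mem (add_mem (Qm _ _ _) (Qm _ _ _)) (Qm _ _ _))

/-- Over a symplectic chart there is a connection form `γ` with `γ(e_a) = u_a + O(2)` and
curvature `Ω`; as constants are central for the Poisson bracket, the connection is flat. -/
theorem exists_connectionForm : ∃ γ : L →ₗ[A] Series n S,
    (∀ a, γ (c.e a) - conjVar n S a ∈ orderIdeal (Fin n ⊕ Fin n) S 2) ∧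
      ∀ σ τ, c.curvature γ σ τ = C (c.Ω σ τ) := by
  obtain ⟨r, h2, hr⟩ := c.exists_radial_solution
  refine ⟨c.connectionForm r, fun a => ?_, fun σ τ => ?_⟩
  · rw [connectionForm_e, add_sub_cancel_left]
    exact h2 a
  · rw [← sub_eq_zero, ← curvatureDefect_apply]
    have h (a b) : c.curvatureDefect r (c.e a) (c.e b) = 0 :=
      eq_zero_of_forall_mem_orderIdeal fun m => c.curvatureDefect_mem h2 hr m a b
    have h' (a) : c.curvatureDefect r (c.e a) τ = 0 := by
      rw [c.map_eq_sum (S := S) (fun f hf x => ker_smul hf x)]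
      simp [h]
    have := c.map_eq_sum (S := S) (fun f hf x => ker_smul hf x) ((c.curvatureDefect r).flip τ) σ
    simpa [h'] using this

end SymplecticChart
end

noncomputable section

/-! ### Jets of flat sections -/

/-- The enveloping algebra is generated from `1` under left multiplication by `A` and `L`. -/
theorem Env.left_induction {R A L : Type*} [CommRing R] [CommRing A] [Algebra R A] [LieRing L]
    [LieAlgebra R L] [Module A L] [LieRingModule L A] [LieRinehartRing A L]
    [LieRinehartAlgebra R A L] {p : Env R A L → Prop} (one : p 1)
    (add : ∀ D D', p D → p D' → p (D + D')) (smul : ∀ (f : A) D, p D → p (f • D))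
    (ι_mul : ∀ x D, p D → p (Env.ι R A L x * D)) (D : Env R A L) : p D := by
  obtain ⟨t, rfl⟩ : ∃ t, Env.mk R A L t = D := RingQuot.mkAlgHom_surjective R (EnvRel R A L) D
  suffices h : ∀ z, p z → p (Env.mk R A L t * z) by simpa using h 1 one
  induction t using TensorAlgebra.induction with
  | algebraMap r =>
    intro z hz
    rw [AlgHom.commutes, ← Algebra.smul_def, ← algebraMap_smul A r z]
    exact smul _ _ hz
  | mul a b ha hb => intro z hz; rw [map_mul, mul_assoc]; exact ha _ (hb _ hz)
  | add a b ha hb => intro z hz; rw [map_add, add_mul]; exact add _ _ (ha _ hz) (hb _ hz)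
  | ι x =>
    intro z hz
    have h : Env.mk R A L (TensorAlgebra.ι R x) =
        Env.ofFun R A L x.1 + Env.ι R A L x.2 := by
      simp only [Env.ofFun, Env.ι, AlgHom.ofLinearMap_apply, LinearMap.comp_apply,
        AlgHom.toLinearMap_apply, LinearMap.coe_mk, AddHom.coe_mk, LinearMap.inl_apply]
      rw [← map_add, ← map_add]
      simp
    rw [h, add_mul, ← Env.fun_smul_def]
    exact add _ _ (smul _ _ hz) (ι_mul _ _ hz)

namespace Jet

variable {R A L : Type*} [CommRing R] [CommRing A] [Algebra R A] [LieRing L]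
    [LieAlgebra R L] [Module A L] [LieRingModule L A] [LieRinehartRing A L]
    [LieRinehartAlgebra R A L] {K K' : Type*} [CommRing K] [Algebra A K] [CommRing K']
    [Algebra A K']

@[simp] theorem tensor_tmul (l₁ l₂ : Jet R A L K) (D₁ D₂ : Env R A L) :
    tensor l₁ l₂ (D₁ ⊗ₜ[A] D₂) = l₁ D₁ * l₂ D₂ := by
  simp [tensor]

theorem coactDual_apply (z : Env R A L ⊗[A] Env R A L) (l₁ l₂ : Jet R A L K) (D : Env R A L) :
    coactDual z l₁ l₂ D = tensor l₁ l₂ (Env.coact R A L D z) := rfl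

theorem one_apply (D : Env R A L) :
    (one : Jet R A L K) D = algebraMap A K (Env.anchorAction R A L D 1) := rfl

theorem tensor_comp (g : K →ₐ[A] K') (l₁ l₂ : Jet R A L K) (z : Env R A L ⊗[A] Env R A L) :
    tensor (g.toLinearMap ∘ₗ l₁) (g.toLinearMap ∘ₗ l₂) z = g (tensor l₁ l₂ z) := by
  induction z using TensorProduct.induction_on with
  | zero => simp
  | add x y hx hy => simp only [map_add, hx, hy]
  | tmul x y => simp

/-- The product and the brackets are natural in the coefficients. -/
theorem coactDual_comp (g : K →ₐ[A] K') (z : Env R A L ⊗[A] Env R A L) (l₁ l₂ : Jet R A L K) :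
    coactDual z (g.toLinearMap ∘ₗ l₁) (g.toLinearMap ∘ₗ l₂) =
      g.toLinearMap ∘ₗ coactDual z l₁ l₂ :=
  LinearMap.ext fun _ => tensor_comp g l₁ l₂ _

theorem one_comp (g : K →ₐ[A] K') : (one : Jet R A L K') = g.toLinearMap ∘ₗ one := by
  ext
  simp [one_apply]

end Jet

namespace SymplecticChart

open MvPowerSeries FormalPoisson

variable {n : ℕ} {A L S : Type*} [CommRing A] [Algebra ℝ A] [LieRing L]
    [LieAlgebra ℝ L] [Module A L] [LieRingModule L A] [LieRinehartRing A L]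
    [LieRinehartAlgebra ℝ A L] [CommRing S] [Algebra ℝ S] [Algebra A S] [IsScalarTower ℝ A S]
    (c : SymplecticChart n A L S) (γ : L →ₗ[A] Series n S)

/-- The connection `ρ_σ + {γ(σ), ·}`. -/
def conn (σ : L) (F : Series n S) : Series n S := c.D σ F + poisson (γ σ) F

theorem conn_add (σ : L) (F G : Series n S) :
    c.conn γ σ (F + G) = c.conn γ σ F + c.conn γ σ G := by
  simp only [conn, map_add, poisson_add_right]; abel

theorem conn_smul (σ : L) (f : A) (F : Series n S) :
    c.conn γ σ (f • F) = f • c.conn γ σ F + ⁅σ, f⁆ • F := by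
  rw [conn, conn, D_smul, poisson_smul_right', smul_add]; abel

theorem conn_add_left (σ τ : L) (F : Series n S) :
    c.conn γ (σ + τ) F = c.conn γ σ F + c.conn γ τ F := by
  rw [conn, conn, conn, D_add, map_add, poisson_add_left]; abel

theorem conn_smul_left (f : A) (σ : L) (F : Series n S) :
    c.conn γ (f • σ) F = f • c.conn γ σ F := by
  rw [conn, conn, D_smul_left, map_smul, poisson_smul_left', smul_add]

theorem conn_mul (σ : L) (F G : Series n S) :
    c.conn γ σ (F * G) = c.conn γ σ F * G + F * c.conn γ σ G := by
  rw [conn, conn, conn, Derivation.leibniz, poisson_mul_right, smul_eq_mul, smul_eq_mul]; ring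

theorem conn_poisson (σ : L) (F G : Series n S) :
    c.conn γ σ (poisson F G) = poisson (c.conn γ σ F) G + poisson F (c.conn γ σ G) := by
  have h := poisson_jacobi (γ σ) F G
  rw [poisson_skew G (poisson (γ σ) F), poisson_skew G (γ σ), poisson_neg_right] at h
  rw [conn, conn, conn, coeffwise_poisson, poisson_add_left, poisson_add_right]
  linear_combination (exp := 1) h

theorem conn_one (σ : L) : c.conn γ σ 1 = 0 := by
  rw [conn, Derivation.map_one_eq_zero, ← map_one (C : S →+* Series n S), poisson_C_right, add_zero]

variable {γ} in
/-- The connection is flat, since the curvature is central for the Poisson bracket. -/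
theorem conn_lie (hγ : ∀ σ τ, c.curvature γ σ τ = C (c.Ω σ τ)) (σ τ : L) (F : Series n S) :
    c.conn γ ⁅σ, τ⁆ F = c.conn γ σ (c.conn γ τ F) - c.conn γ τ (c.conn γ σ F) := by
  have h1 := congrArg (poisson · F) (hγ σ τ)
  have h2 := poisson_jacobi (γ σ) (γ τ) F
  rw [poisson_skew F (γ σ), poisson_neg_right, poisson_skew F (poisson _ _)] at h2
  simp only [curvature_apply, poisson_C_left, poisson_sub_left, poisson_add_left] at h1
  simp only [conn, D_lie, map_add, coeffwise_poisson, poisson_add_right]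
  linear_combination (exp := 1) -h1 - h2

theorem ρ_smul (σ : L) (f : A) (s : S) :
    c.ρ σ (f • s) = f • c.ρ σ s + ⁅σ, f⁆ • s := by
  rw [Algebra.smul_def f s, Derivation.leibniz, c.ρ_algebraMap, Algebra.smul_def f,
    Algebra.smul_def ⁅σ, f⁆, smul_eq_mul, smul_eq_mul, mul_comm s]

/-- The connection on the `A`-linear forms on power series that is dual to `conn`. -/
def dualConn (σ : L) : Module.End ℝ (Series n S →ₗ[A] S) where
  toFun Λ :=
    { toFun := fun F => c.ρ σ (Λ F) - Λ (c.conn γ σ F)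
      map_add' := fun F G => by simp only [map_add, conn_add]; abel
      map_smul' := fun f F => by
        rw [conn_smul, map_smul Λ, map_add, map_smul Λ, map_smul Λ, ρ_smul, RingHom.id_apply, smul_sub]
        abel }
  map_add' Λ Λ' := by
    ext F
    simp only [LinearMap.add_apply, map_add, LinearMap.coe_mk, AddHom.coe_mk]
    abel
  map_smul' r Λ := by
    ext F
    simp [smul_sub]

theorem dualConn_apply (σ : L) (Λ : Series n S →ₗ[A] S) (F : Series n S) :
    c.dualConn γ σ Λ F = c.ρ σ (Λ F) - Λ (c.conn γ σ F) := rfl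

variable {γ} (hγ : ∀ σ τ, c.curvature γ σ τ = C (c.Ω σ τ))

/-- As the connection is flat, the enveloping algebra acts on the linear forms. -/
def envAction : Env ℝ A L →ₐ[ℝ] Module.End ℝ (Series n S →ₗ[A] S) :=
  Env.lift ℝ A L (Algebra.lsmul ℝ ℝ (Series n S →ₗ[A] S))
    { toFun := c.dualConn γ
      map_add' := fun σ τ => by
        ext Λ F
        simp only [dualConn_apply, LinearMap.add_apply, map_add, conn_add_left,
          Derivation.add_apply]
        abel
      map_smul' := fun r σ => by
        ext Λ F
        rw [RingHom.id_apply, LinearMap.smul_apply, LinearMap.smul_apply, dualConn_apply,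
          dualConn_apply, ← algebraMap_smul A r σ, conn_smul_left, map_smul, map_smul, Derivation.smul_apply,
          ← smul_sub, algebraMap_smul] }
    (fun f σ => by
      ext Λ F
      simp [dualConn_apply, conn_smul_left, smul_sub])
    (fun σ f => by
      ext Λ F
      simp only [LinearMap.coe_mk, AddHom.coe_mk, Module.End.mul_apply, LinearMap.add_apply,
        Algebra.lsmul_coe, dualConn_apply, LinearMap.smul_apply, ρ_smul, smul_sub]
      abel)
    (fun σ τ => by
      ext Λ F
      simp only [LinearMap.coe_mk, AddHom.coe_mk, Module.End.mul_apply, LinearMap.add_apply,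
        dualConn_apply, c.conn_lie hγ, c.ρ_lie, map_sub]
      ring)

/-- The `S`-valued jet of the power series `F`, namely `D ↦ (D · ev₀)(F)`. -/
def toJet : Series n S →ₗ[A] Jet ℝ A L S where
  toFun F :=
    { toFun := fun D => c.envAction hγ D ((coeff (R := S) 0).restrictScalars A) F
      map_add' := fun D D' => by rw [map_add]; rfl
      map_smul' := fun f D => by
        rw [Env.fun_smul_def, map_mul, Module.End.mul_apply, envAction, Env.lift_ofFun]
        rfl }
  map_add' F G := by
    ext D
    exact map_add (c.envAction hγ D _) F G
  map_smul' f F := by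
    ext D
    exact map_smul (c.envAction hγ D _) f F

theorem toJet_one (F : Series n S) : c.toJet hγ F 1 = coeff 0 F := by
  change c.envAction hγ 1 _ F = _
  rw [map_one]
  rfl

/-- The recursion that determines the jet of a power series. -/
theorem toJet_ι_mul (F : Series n S) (σ : L) (D : Env ℝ A L) :
    c.toJet hγ F (Env.ι ℝ A L σ * D) =
      c.ρ σ (c.toJet hγ F D) - c.toJet hγ (c.conn γ σ F) D := by
  change c.envAction hγ (Env.ι ℝ A L σ * D) _ F = _
  rw [map_mul, Module.End.mul_apply, envAction, Env.lift_ι]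
  rfl

/-- `toJet_ι_mul` for the coproduct. -/
theorem tensor_coactι (σ : L) (F G : Series n S) (z : Env ℝ A L ⊗[A] Env ℝ A L) :
    Jet.tensor (c.toJet hγ F) (c.toJet hγ G) (Env.coactι ℝ A L σ z) =
      c.ρ σ (Jet.tensor (c.toJet hγ F) (c.toJet hγ G) z) -
        Jet.tensor (c.toJet hγ (c.conn γ σ F)) (c.toJet hγ G) z -
        Jet.tensor (c.toJet hγ F) (c.toJet hγ (c.conn γ σ G)) z := by
  induction z using TensorProduct.induction_on with
  | zero => simp
  | add x y hx hy => simp only [map_add, hx, hy]; abel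
  | tmul x y =>
    simp only [Env.coactι_tmul, map_add, Jet.tensor_tmul, toJet_ι_mul, Derivation.leibniz,
      smul_eq_mul]
    ring

/-- A flat bidifferential operation on power series goes over to the operation on jets given
by an element of `Env ⊗ Env`, if the two agree at the operator `1`. -/
theorem coactDual_toJet (z : Env ℝ A L ⊗[A] Env ℝ A L)
    (β : Series n S → Series n S → Series n S)
    (hβ : ∀ σ F G, c.conn γ σ (β F G) = β (c.conn γ σ F) G + β F (c.conn γ σ G))
    (h0 : ∀ F G, Jet.tensor (c.toJet hγ F) (c.toJet hγ G) z = coeff 0 (β F G))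
    (F G : Series n S) :
    Jet.coactDual z (c.toJet hγ F) (c.toJet hγ G) = c.toJet hγ (β F G) := by
  ext D
  induction D using Env.left_induction generalizing F G with
  | one => rw [Jet.coactDual_apply, map_one, Module.End.one_apply, h0, toJet_one]
  | add D D' h h' => rw [map_add, map_add, h, h']
  | smul f D h => rw [map_smul, map_smul, h]
  | ι_mul σ D h =>
    rw [Jet.coactDual_apply, map_mul, Module.End.mul_apply, Env.coact_ι, tensor_coactι,
      ← Jet.coactDual_apply, ← Jet.coactDual_apply, ← Jet.coactDual_apply, h, h, h, toJet_ι_mul, hβ,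
      map_add, LinearMap.add_apply]
    abel

theorem mul_toJet (F G : Series n S) :
    Jet.mul (c.toJet hγ F) (c.toJet hγ G) = c.toJet hγ (F * G) :=
  c.coactDual_toJet hγ _ _ (c.conn_mul γ)
    (fun F G => by
      simp only [Jet.tensor_tmul, toJet_one, coeff_zero_eq_constantCoeff_apply, map_mul]) F G

theorem one_toJet : (Jet.one : Jet ℝ A L S) = c.toJet hγ 1 := by
  ext D
  induction D using Env.left_induction with
  | one => rw [toJet_one, Jet.one_apply]; simp
  | add D D' h h' => rw [map_add, map_add, h, h']
  | smul f D h => rw [map_smul, map_smul, h]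
  | ι_mul σ D h =>
    rw [toJet_ι_mul, conn_one, map_zero, LinearMap.zero_apply, sub_zero, ← h, Jet.one_apply,
      Jet.one_apply, c.ρ_algebraMap, map_mul, Module.End.mul_apply]
    congr 1
    rw [Env.anchorAction, Env.lift_ι]
    rfl

/-- The inverse tensor `∑ᵢ pᵢ ⊗ qᵢ - qᵢ ⊗ pᵢ` of the form, in the symplectic frame `p, q`. -/
def inverseTensor : L ⊗[A] L :=
  ∑ i : Fin n, (c.e (Sum.inl i) ⊗ₜ[A] c.e (Sum.inr i) - c.e (Sum.inr i) ⊗ₜ[A] c.e (Sum.inl i))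

theorem conn_e (γ : L →ₗ[A] Series n S) (a : Fin n ⊕ Fin n) (F : Series n S) : c.conn γ (c.e a) F =
    c.D (c.e a) F - pderiv S a F + poisson (γ (c.e a) - conjVar n S a) F := by
  rw [conn, poisson_sub_left, poisson_conjVar]; abel

/-- At the origin `e_a` acts as `∂_a`, since the rest of `γ(e_a)` generates derivations that vanish
there. -/
theorem toJet_ι_e
    (hγ₁ : ∀ a, γ (c.e a) - conjVar n S a ∈ orderIdeal (Fin n ⊕ Fin n) S 2)
    (a : Fin n ⊕ Fin n) (F : Series n S) :
    c.toJet hγ F (Env.ι ℝ A L (c.e a)) = coeff 0 (pderiv S a F) := by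
  rw [← mul_one (Env.ι ℝ A L (c.e a)), toJet_ι_mul, toJet_one, toJet_one, c.conn_e, map_add,
    map_sub, coeff_coeffwise]
  have h : coeff 0 (poisson (γ (c.e a) - conjVar n S a) F) = 0 := by
    simp only [poisson, map_sum, map_sub, coeff_zero_eq_constantCoeff_apply, map_mul]
    refine Finset.sum_eq_zero fun i _ => ?_
    have h (b) : constantCoeff (pderiv S b (γ (c.e a) - conjVar n S a)) = 0 := by
      rw [← coeff_zero_eq_constantCoeff_apply]
      exact pderiv_mem_orderIdeal (hγ₁ a) b 0 (by simp)
    rw [← map_sub, ← map_sub, ← map_sub, ← map_sub, h, h]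
    ring
  rw [h]
  ring

theorem bracket_toJet
    (hγ₁ : ∀ a, γ (c.e a) - conjVar n S a ∈ orderIdeal (Fin n ⊕ Fin n) S 2)
    (F G : Series n S) :
    Jet.bracket c.inverseTensor (c.toJet hγ F) (c.toJet hγ G) = c.toJet hγ (poisson F G) := by
  refine c.coactDual_toJet hγ _ _ (c.conn_poisson γ) (fun F G => ?_) F G
  simp only [inverseTensor, map_sum, map_sub, TensorProduct.map_tmul, Jet.tensor_tmul, poisson,
    c.toJet_ι_e hγ hγ₁, coeff_zero_eq_constantCoeff_apply, map_mul]

end SymplecticChart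
end

noncomputable section

/-! ### A dual basis of differential operators -/

namespace SymplecticChart

open MvPowerSeries FormalPoisson

variable {n : ℕ} {A L S : Type*} [CommRing A] [Algebra ℝ A] [LieRing L]
    [LieAlgebra ℝ L] [Module A L] [LieRingModule L A] [LieRinehartRing A L]
    [LieRinehartAlgebra ℝ A L] [CommRing S] [Algebra ℝ S] [Algebra A S] [IsScalarTower ℝ A S]
    (c : SymplecticChart n A L S)

/-- The product in the enveloping algebra of a word in the frame. -/
def word (w : List (Fin n ⊕ Fin n)) : Env ℝ A L := (w.map fun a => Env.ι ℝ A L (c.e a)).prod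

theorem word_cons (a : Fin n ⊕ Fin n) (w : List (Fin n ⊕ Fin n)) :
    c.word (a :: w) = Env.ι ℝ A L (c.e a) * c.word w := by simp [word]

/-- The operators of order less than `k`, up to operators whose coefficients vanish in `S`. -/
def filtration (k : ℕ) : Submodule A (Env ℝ A L) :=
  Submodule.span A {D | ∃ w : List (Fin n ⊕ Fin n), w.length < k ∧ c.word w = D} ⊔
    RingHom.ker (algebraMap A S) • ⊤

theorem filtration_mono {j k : ℕ} (h : j ≤ k) : c.filtration j ≤ c.filtration k :=
  sup_le_sup_right (Submodule.span_mono (by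
    rintro _ ⟨w, hw, e⟩
    exact ⟨w, hw.trans_le h, e⟩)) _

theorem word_mem_filtration {k : ℕ} {w : List (Fin n ⊕ Fin n)} (h : w.length < k) :
    c.word w ∈ c.filtration k :=
  Submodule.mem_sup_left (Submodule.subset_span ⟨w, h, rfl⟩)

theorem smul_mem_filtration (r : ℝ) {k : ℕ} {D : Env ℝ A L} (h : D ∈ c.filtration k) :
    r • D ∈ c.filtration k := by
  rw [← algebraMap_smul A r D]
  exact Submodule.smul_mem _ _ h

theorem ι_mul_smul (σ : L) (f : A) (D : Env ℝ A L) :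
    Env.ι ℝ A L σ * (f • D) = f • (Env.ι ℝ A L σ * D) + ⁅σ, f⁆ • D := by
  rw [Env.fun_smul_def, ← mul_assoc, Env.ι_mul_ofFun, add_mul, mul_assoc, ← Env.fun_smul_def,
    ← Env.fun_smul_def]

theorem lie_mem_ker (c : SymplecticChart n A L S) (σ : L) {f : A}
    (hf : f ∈ RingHom.ker (algebraMap A S)) : ⁅σ, f⁆ ∈ RingHom.ker (algebraMap A S) := by
  rw [RingHom.mem_ker, ← c.ρ_algebraMap, RingHom.mem_ker.1 hf, map_zero]

/-- Left multiplication by an element of `L` raises the order by at most one. -/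
theorem ι_mul_mem_filtration (σ : L) {k : ℕ} {D : Env ℝ A L} (h : D ∈ c.filtration k) :
    Env.ι ℝ A L σ * D ∈ c.filtration (k + 1) := by
  obtain ⟨x, hx, y, hy, rfl⟩ := Submodule.mem_sup.1 h
  rw [mul_add]
  refine add_mem ?_ ?_
  · refine (Submodule.span_induction (p := fun x _ => Env.ι ℝ A L σ * x ∈ c.filtration (k + 1) ∧
      x ∈ c.filtration (k + 1)) ?_ ?_ ?_ ?_ hx).1
    · rintro _ ⟨w, hw, rfl⟩
      refine ⟨?_, c.word_mem_filtration (by omega)⟩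
      have h1 : ∀ τ ∈ RingHom.ker (algebraMap A S) • (⊤ : Submodule A L),
          Env.ι ℝ A L τ * c.word w ∈ c.filtration (k + 1) := fun τ hτ => by
        induction hτ using Submodule.smul_induction_on' with
        | smul f hf x _ =>
          rw [map_smul, Env.fun_smul_def, mul_assoc, ← Env.fun_smul_def]
          exact Submodule.mem_sup_right (Submodule.smul_mem_smul hf trivial)
        | add x _ y _ hx hy => rw [map_add, add_mul]; exact add_mem hx hy
      have h2 := h1 _ (c.expand σ)
      rw [map_sub, sub_mul] at h2
      rw [← sub_add_cancel (Env.ι ℝ A L σ * c.word w)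
        (Env.ι ℝ A L (∑ a, c.θ a σ • c.e a) * c.word w)]
      refine add_mem h2 ?_
      rw [map_sum, Finset.sum_mul]
      refine sum_mem fun a _ => ?_
      rw [map_smul, Env.fun_smul_def, mul_assoc, ← Env.fun_smul_def, ← word_cons]
      exact Submodule.smul_mem _ _ (c.word_mem_filtration (by simpa using hw))
    · simp
    · intro x y _ _ hx hy
      rw [mul_add]
      exact ⟨add_mem hx.1 hy.1, add_mem hx.2 hy.2⟩
    · intro f x _ hx
      rw [ι_mul_smul]
      exact ⟨add_mem (Submodule.smul_mem _ _ hx.1) (Submodule.smul_mem _ _ hx.2),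
        Submodule.smul_mem _ _ hx.2⟩
  · refine Submodule.mem_sup_right ?_
    clear h
    induction hy using Submodule.smul_induction_on' with
    | smul f hf x _ =>
      rw [ι_mul_smul]
      exact add_mem (Submodule.smul_mem_smul hf trivial)
        (Submodule.smul_mem_smul (c.lie_mem_ker σ hf) trivial)
    | add x _ y _ hx hy => rw [mul_add]; exact add_mem hx hy

theorem exists_mem_filtration (D : Env ℝ A L) : ∃ k, D ∈ c.filtration k := by
  induction D using Env.left_induction with
  | one => exact ⟨1, c.word_mem_filtration (w := []) (by simp)⟩
  | add D D' h h' =>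
    obtain ⟨k, hk⟩ := h
    obtain ⟨k', hk'⟩ := h'
    exact ⟨max k k', add_mem (c.filtration_mono (le_max_left _ _) hk)
      (c.filtration_mono (le_max_right _ _) hk')⟩
  | smul f D h => exact h.imp fun k hk => Submodule.smul_mem _ _ hk
  | ι_mul σ D h =>
    obtain ⟨k, hk⟩ := h
    exact ⟨k + 1, c.ι_mul_mem_filtration σ hk⟩

/-- Operators commute up to operators of lower order. -/
theorem word_sub_word_mem_filtration {w w' : List (Fin n ⊕ Fin n)} (h : w.Perm w') :
    c.word w - c.word w' ∈ c.filtration w.length := by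
  induction h with
  | nil => simp
  | cons a h ih =>
    rw [word_cons, word_cons, ← mul_sub]
    exact c.ι_mul_mem_filtration _ ih
  | swap a b w =>
    rw [word_cons, word_cons, word_cons, word_cons, ← mul_assoc, ← mul_assoc, Env.ι_mul_ι, add_mul,
      add_sub_cancel_left]
    exact c.ι_mul_mem_filtration _ (c.word_mem_filtration (by simp))
  | trans h _ ih ih' =>
    rw [← sub_add_sub_cancel]
    exact add_mem ih (h.length_eq ▸ ih')

/-- The multi-index of a word. -/
def content (w : List (Fin n ⊕ Fin n)) : Fin n ⊕ Fin n →₀ ℕ := Multiset.toFinsupp (w : Multiset _)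

theorem content_cons (a : Fin n ⊕ Fin n) (w : List (Fin n ⊕ Fin n)) :
    content (a :: w) = content w + Finsupp.single a 1 := by
  rw [content, ← Multiset.cons_coe, ← Multiset.singleton_add, map_add, Multiset.toFinsupp_singleton,
    add_comm]
  rfl

theorem degree_content (w : List (Fin n ⊕ Fin n)) : (content w).degree = w.length := by
  induction w with
  | nil => simp [content]
  | cons a w ih => rw [content_cons, map_add, ih, Finsupp.degree_single, List.length_cons]

theorem exists_content_eq (d : Fin n ⊕ Fin n →₀ ℕ) : ∃ w, content w = d :=
  ⟨(Finsupp.toMultiset d).toList, by rw [content, Multiset.coe_toList, Finsupp.toMultiset_toFinsupp]⟩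

theorem perm_of_content_eq {w w' : List (Fin n ⊕ Fin n)} (h : content w = content w') :
    w.Perm w' :=
  Multiset.coe_eq_coe.1 (Multiset.toFinsupp.injective h)

variable {γ : L →ₗ[A] Series n S} (hγ : ∀ σ τ, c.curvature γ σ τ = C (c.Ω σ τ))

/-- The functional `Λ` on power series is the pairing with an operator of order less than `k`. -/
def IsRepresented (k : ℕ) (Λ : Series n S → S) : Prop :=
  ∃ D ∈ c.filtration k, ∀ F, c.toJet hγ F D = Λ F

variable {c hγ}

theorem IsRepresented.zero (k : ℕ) : c.IsRepresented hγ k fun _ => 0 :=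
  ⟨0, zero_mem _, fun _ => map_zero _⟩

theorem IsRepresented.add {k : ℕ} {Λ Λ' : Series n S → S} (h : c.IsRepresented hγ k Λ)
    (h' : c.IsRepresented hγ k Λ') : c.IsRepresented hγ k fun F => Λ F + Λ' F := by
  obtain ⟨D, hD, e⟩ := h
  obtain ⟨D', hD', e'⟩ := h'
  exact ⟨D + D', add_mem hD hD', fun F => by rw [map_add, e, e']⟩

theorem IsRepresented.mul {k : ℕ} {Λ : Series n S → S} (h : c.IsRepresented hγ k Λ) (s : S) :
    c.IsRepresented hγ k fun F => s * Λ F := by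
  obtain ⟨D, hD, e⟩ := h
  obtain ⟨f, rfl⟩ := c.surj s
  exact ⟨f • D, Submodule.smul_mem _ _ hD, fun F => by rw [map_smul, e, Algebra.smul_def]⟩

theorem IsRepresented.sum {κ : Type*} (t : Finset κ) {k : ℕ} {Λ : κ → Series n S → S}
    (h : ∀ i ∈ t, c.IsRepresented hγ k (Λ i)) : c.IsRepresented hγ k fun F => ∑ i ∈ t, Λ i F := by
  classical
  induction t using Finset.induction_on with
  | empty => simpa using IsRepresented.zero k
  | insert a t ha ih =>
    simp only [Finset.sum_insert ha]
    exact (h a (Finset.mem_insert_self a t)).add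
      (ih fun i hi => h i (Finset.mem_insert_of_mem hi))

/-- The coefficients of the bracket with a power series of order two are represented by operators
of the same order as the coefficients themselves. -/
theorem isRepresented_poisson {m : ℕ}
    (ih : ∀ d : Fin n ⊕ Fin n →₀ ℕ, d.degree ≤ m → c.IsRepresented hγ (m + 1) (coeff d))
    {r : Series n S} (hr : r ∈ orderIdeal (Fin n ⊕ Fin n) S 2) {d : Fin n ⊕ Fin n →₀ ℕ}
    (hd : d.degree = m) : c.IsRepresented hγ (m + 1) fun F => coeff d (poisson r F) := by
  have h (a b) : c.IsRepresented hγ (m + 1) fun F => coeff d (pderiv S a r * pderiv S b F) := by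
    simp only [coeff_mul]
    refine IsRepresented.sum _ fun p hp => ?_
    have hp' := congrArg Finsupp.degree (Finset.HasAntidiagonal.mem_antidiagonal.1 hp)
    rw [map_add] at hp'
    by_cases h0 : p.1.degree < 1
    · simp only [pderiv_mem_orderIdeal hr a p.1 h0, zero_mul]
      exact IsRepresented.zero _
    · have := ((ih (p.2 + Finsupp.single b 1)
        (by rw [map_add, Finsupp.degree_single]; omega)).mul
          (coeff p.1 (pderiv S a r) * (p.2 b + 1)))
      simpa only [mul_comm, mul_left_comm, mul_assoc, coeff_pderiv] using this
  simp only [poisson, map_sum, map_sub]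
  refine IsRepresented.sum _ fun i _ => ?_
  have := (h (Sum.inl i) (Sum.inr i)).add ((h (Sum.inr i) (Sum.inl i)).mul (-1))
  simpa [sub_eq_add_neg] using this

variable (hγ₁ : ∀ a, γ (c.e a) - conjVar n S a ∈ orderIdeal (Fin n ⊕ Fin n) S 2)

variable (c hγ) in
/-- Each coefficient of a power series is the pairing of its jet with an operator, whose symbol is a
multiple of the corresponding monomial. -/
theorem exists_dual_operator
    (hγ₁ : ∀ a, γ (c.e a) - conjVar n S a ∈ orderIdeal (Fin n ⊕ Fin n) S 2)
    (w : List (Fin n ⊕ Fin n)) : ∃ (D : Env ℝ A L) (r : ℝ), r ≠ 0 ∧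
      D - r • c.word w ∈ c.filtration w.length ∧ ∀ F, c.toJet hγ F D = coeff (content w) F := by
  induction h : w.length using Nat.strong_induction_on generalizing w with
  | _ m ih =>
  subst h
  rcases w with _ | ⟨a, w⟩
  · refine ⟨1, 1, one_ne_zero, by simp [word], fun F => ?_⟩
    rw [toJet_one]
    simp [content]
  · obtain ⟨D, r, hr, hD, e⟩ := ih w.length (by simp) w rfl
    have hrep (d : Fin n ⊕ Fin n →₀ ℕ) (hd : d.degree ≤ w.length) :
        c.IsRepresented hγ (w.length + 1) (coeff d) := by
      obtain ⟨w', rfl⟩ := exists_content_eq d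
      rw [degree_content] at hd
      obtain ⟨D, r, -, hD, e⟩ := ih w'.length (by simpa using Nat.lt_succ_of_le hd) w' rfl
      refine ⟨D, ?_, e⟩
      rw [← sub_add_cancel D (r • c.word w')]
      exact add_mem (c.filtration_mono (by omega) hD)
        (c.smul_mem_filtration _ (c.word_mem_filtration (by omega)))
    -- `e_a D` yields `∂_a` of the coefficient and the bracket with `γ(e_a) - u_a`; `E` removes the
    -- latter
    obtain ⟨E, hE, eE⟩ := isRepresented_poisson hrep (hγ₁ a) (degree_content w)
    have h0 : ((content w a : ℝ) + 1) ≠ 0 := by positivity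
    refine ⟨((content w a : ℝ) + 1)⁻¹ • (Env.ι ℝ A L (c.e a) * D + E),
      ((content w a : ℝ) + 1)⁻¹ * r, mul_ne_zero (inv_ne_zero h0) hr, ?_, fun F => ?_⟩
    · rw [mul_smul, ← smul_sub, word_cons, ← mul_smul_comm, add_sub_right_comm, ← mul_sub]
      exact c.smul_mem_filtration _ (add_mem (c.ι_mul_mem_filtration _ hD) hE)
    · have h1 : c.toJet hγ F (Env.ι ℝ A L (c.e a) * D + E) =
          ((content w a : ℝ) + 1) • coeff (content (a :: w)) F := by
        rw [map_add, eE, toJet_ι_mul, e, e, conn_e, map_add, map_sub, coeff_coeffwise, coeff_pderiv,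
          content_cons, add_smul, one_smul, Nat.cast_smul_eq_nsmul, nsmul_eq_mul]
        ring
      rw [← algebraMap_smul A, map_smul, h1, algebraMap_smul, smul_smul, inv_mul_cancel₀ h0,
        one_smul]

variable (c hγ) in
theorem exists_dual_operator_of_index
    (hγ₁ : ∀ a, γ (c.e a) - conjVar n S a ∈ orderIdeal (Fin n ⊕ Fin n) S 2)
    (d : Fin n ⊕ Fin n →₀ ℕ) : ∃ (D : Env ℝ A L) (w : List (Fin n ⊕ Fin n)) (r : ℝ),
      content w = d ∧ r ≠ 0 ∧ D - r • c.word w ∈ c.filtration w.length ∧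
      ∀ F, c.toJet hγ F D = coeff d F := by
  obtain ⟨w, rfl⟩ := exists_content_eq d
  obtain ⟨D, r, h⟩ := c.exists_dual_operator hγ hγ₁ w
  exact ⟨D, w, r, rfl, h⟩

variable (c hγ) in
/-- The operators dual to the monomials. -/
def dualOperator (hγ₁ : ∀ a, γ (c.e a) - conjVar n S a ∈ orderIdeal (Fin n ⊕ Fin n) S 2)
    (d : Fin n ⊕ Fin n →₀ ℕ) : Env ℝ A L :=
  (c.exists_dual_operator_of_index hγ hγ₁ d).choose

theorem toJet_dualOperator (d : Fin n ⊕ Fin n →₀ ℕ) (F : Series n S) :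
    c.toJet hγ F (c.dualOperator hγ hγ₁ d) = coeff d F :=
  (c.exists_dual_operator_of_index hγ hγ₁ d).choose_spec.choose_spec.choose_spec.2.2.2 F

/-- A jet that vanishes on the dual operators vanishes, because these operators span the enveloping
algebra up to coefficients that vanish in `S`: they are triangular with respect to words. -/
theorem jet_eq_zero {K : Type*} [CommRing K] [Algebra A K]
    (hK : ∀ f ∈ RingHom.ker (algebraMap A S), algebraMap A K f = 0) (l : Jet ℝ A L K)
    (hl : ∀ d, l (c.dualOperator hγ hγ₁ d) = 0) : l = 0 := by
  have h (k : ℕ) : ∀ D ∈ c.filtration k, l D = 0 := by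
    induction k with
    | zero =>
      intro D hD
      simp only [filtration, Nat.not_lt_zero, false_and, exists_false, Set.ofPred_false,
        Submodule.span_empty, bot_sup_eq] at hD
      induction hD using Submodule.smul_induction_on' with
      | smul f hf x _ => rw [map_smul, Algebra.smul_def, hK f hf, zero_mul]
      | add x _ y _ hx hy => rw [map_add, hx, hy, add_zero]
    | succ k ih =>
      have hw (w : List (Fin n ⊕ Fin n)) (hw : w.length = k) : l (c.word w) = 0 := by
        obtain ⟨w', r, hw', hr, hD, -⟩ :=
          (c.exists_dual_operator_of_index hγ hγ₁ (content w)).choose_spec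
        have hp := perm_of_content_eq hw'
        have hlen := hp.length_eq.trans hw
        have h1 := ih _ (hlen ▸ hD)
        have h2 := ih _ (hlen ▸ c.word_sub_word_mem_filtration hp)
        have h3 : l (c.exists_dual_operator_of_index hγ hγ₁ (content w)).choose = 0 :=
          hl (content w)
        rw [map_sub, h3, zero_sub, neg_eq_zero, ← algebraMap_smul A, map_smul] at h1
        rw [map_sub, sub_eq_zero] at h2
        rw [← h2, ← one_smul A (l _), ← map_one (algebraMap ℝ A), ← inv_mul_cancel₀ hr, map_mul,
          mul_smul, h1, smul_zero]
      intro D hD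
      obtain ⟨x, hx, y, hy, rfl⟩ := Submodule.mem_sup.1 hD
      rw [map_add, ih y (Submodule.mem_sup_right hy), add_zero]
      refine Submodule.span_induction (p := fun x _ => l x = 0) ?_ (map_zero _) ?_ ?_ hx
      · rintro _ ⟨w, hlt, rfl⟩
        rcases Nat.lt_succ_iff_lt_or_eq.1 hlt with h | h
        · exact ih _ (c.word_mem_filtration h)
        · exact hw w h
      · intro x y _ _ hx hy
        rw [map_add, hx, hy, add_zero]
      · intro f x _ hx
        rw [map_smul, hx, smul_zero]
  ext D
  obtain ⟨k, hk⟩ := c.exists_mem_filtration D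
  exact h k D hk

/-! ### The Poisson algebra of jets with values in a quotient of `S` -/

variable {K : Type*} [CommRing K] [Algebra A K]

variable (c hγ K) in
/-- The coordinates of a jet: its values on the dual operators, as the coefficients of a power
series. -/
def coords (hγ₁ : ∀ a, γ (c.e a) - conjVar n S a ∈ orderIdeal (Fin n ⊕ Fin n) S 2)
    (l : Jet ℝ A L K) : Series n K := fun d => l (c.dualOperator hγ hγ₁ d)

theorem coeff_coords (l : Jet ℝ A L K) (d : Fin n ⊕ Fin n →₀ ℕ) :
    coeff d (c.coords hγ K hγ₁ l) = l (c.dualOperator hγ hγ₁ d) := rfl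

theorem coords_toJet (ev : S →ₐ[A] K) (F : Series n S) :
    c.coords hγ K hγ₁ (ev.toLinearMap ∘ₗ c.toJet hγ F) = map ev.toRingHom F := by
  ext d
  rw [coeff_coords, LinearMap.comp_apply, toJet_dualOperator hγ₁]
  rfl

theorem coords_injective (ev : S →ₐ[A] K) :
    Function.Injective (c.coords (S := S) hγ K hγ₁) := fun l l' h => by
  rw [← sub_eq_zero]
  refine jet_eq_zero (hγ := hγ) hγ₁ (fun f hf => ?_) _ fun d => ?_
  · rw [← ev.commutes, RingHom.mem_ker.1 hf, map_zero]
  · have := congrArg (coeff d) h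
    rw [coeff_coords, coeff_coords] at this
    rw [LinearMap.sub_apply, this, sub_self]

theorem map_surjective {ev : S →ₐ[A] K} (hev : Function.Surjective ev) (G : Series n K) :
    ∃ F : Series n S, map ev.toRingHom F = G := by
  choose g hg using hev
  exact ⟨fun d => g (coeff d G), by ext d; exact hg _⟩

/-- Every jet comes from a power series over `S`, which reduces identities for jets to those for
power series. -/
theorem exists_toJet
    (hγ₁ : ∀ a, γ (c.e a) - conjVar n S a ∈ orderIdeal (Fin n ⊕ Fin n) S 2)
    {ev : S →ₐ[A] K} (hev : Function.Surjective ev) (l : Jet ℝ A L K) :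
    ∃ F, ev.toLinearMap ∘ₗ c.toJet hγ F = l := by
  obtain ⟨F, hF⟩ := map_surjective hev (c.coords hγ K hγ₁ l)
  exact ⟨F, coords_injective hγ₁ ev (by rw [coords_toJet, hF])⟩

theorem coords_surjective {ev : S →ₐ[A] K} (hev : Function.Surjective ev) :
    Function.Surjective (c.coords (S := S) hγ K hγ₁) := fun G => by
  obtain ⟨F, rfl⟩ := map_surjective hev G
  exact ⟨_, coords_toJet hγ₁ ev F⟩

theorem coords_mul {ev : S →ₐ[A] K} (hev : Function.Surjective ev) (l l' : Jet ℝ A L K) :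
    c.coords hγ K hγ₁ (Jet.mul l l') = c.coords hγ K hγ₁ l * c.coords hγ K hγ₁ l' := by
  obtain ⟨F, rfl⟩ := exists_toJet (hγ := hγ) hγ₁ hev l
  obtain ⟨F', rfl⟩ := exists_toJet (hγ := hγ) hγ₁ hev l'
  rw [Jet.mul, Jet.coactDual_comp, ← Jet.mul, mul_toJet, coords_toJet, coords_toJet, coords_toJet,
    map_mul]

theorem coords_one (ev : S →ₐ[A] K) : c.coords hγ K hγ₁ Jet.one = 1 := by
  rw [Jet.one_comp ev, c.one_toJet hγ, coords_toJet, map_one]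

theorem map_poisson (ev : S →ₐ[A] K) (F G : Series n S) :
    map ev.toRingHom (poisson F G) = poisson (map ev.toRingHom F) (map ev.toRingHom G) := by
  have h (a) (F : Series n S) : map ev.toRingHom (pderiv S a F) =
      pderiv K a (map ev.toRingHom F) := by
    ext d
    rw [coeff_map, coeff_pderiv, coeff_pderiv, coeff_map, map_mul]
    simp
  simp only [poisson, map_sum, map_sub, map_mul, h]

theorem coords_bracket {ev : S →ₐ[A] K} (hev : Function.Surjective ev) (l l' : Jet ℝ A L K) :
    c.coords hγ K hγ₁ (Jet.bracket c.inverseTensor l l') =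
      poisson (c.coords hγ K hγ₁ l) (c.coords hγ K hγ₁ l') := by
  obtain ⟨F, rfl⟩ := exists_toJet (hγ := hγ) hγ₁ hev l
  obtain ⟨F', rfl⟩ := exists_toJet (hγ := hγ) hγ₁ hev l'
  rw [Jet.bracket, Jet.coactDual_comp, ← Jet.bracket, c.bracket_toJet hγ hγ₁, coords_toJet,
    coords_toJet, coords_toJet, map_poisson]

end SymplecticChart
end

noncomputable section

/-! ### Smooth functions and sections near a point -/

section LieAlgebroidGeometry

variable {B : Type*} [NormedAddCommGroup B] [NormedSpace ℝ B]
  {H : Type*} [TopologicalSpace H] {I : ModelWithCorners ℝ B H}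
  {M : Type*} [TopologicalSpace M] [ChartedSpace H M] [IsManifold I ∞ M]
  {F : Type*} [NormedAddCommGroup F] [NormedSpace ℝ F]
  {V : M → Type*} [TopologicalSpace (Bundle.TotalSpace F V)]
  [∀ x, AddCommGroup (V x)] [∀ x, Module ℝ (V x)] [∀ x, TopologicalSpace (V x)]
  [FiberBundle F V] [VectorBundle ℝ F V]

theorem exists_bump [FiniteDimensional ℝ B] [T2Space M] {m : M} {U : Set M} (hU : U ∈ 𝓝 m) :
    ∃ χ : C^∞⟮I, M; ℝ⟯, (∀ᶠ x in 𝓝 m, χ x = 1) ∧ tsupport χ ⊆ U := by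
  obtain ⟨f, -, hf⟩ := (SmoothBumpFunction.nhds_basis_tsupport (I := I) (c := m)).mem_iff.1 hU
  exact ⟨⟨f, f.contMDiff⟩, f.eventuallyEq_one, hf⟩

theorem exists_inverse_near [FiniteDimensional ℝ B] [T2Space M] {m : M} (f : C^∞⟮I, M; ℝ⟯)
    (hf : f m ≠ 0) : ∃ g : C^∞⟮I, M; ℝ⟯, ∀ᶠ x in 𝓝 m, f x * g x = 1 := by
  have hU : {x | f x ≠ 0} ∈ 𝓝 m := f.contMDiff.continuous.continuousAt.eventually_ne hf
  obtain ⟨χ, h1, h2⟩ := exists_bump (I := I) hU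
  refine ⟨⟨fun x => χ x * (f x)⁻¹, contMDiff_of_tsupport fun x hx => ?_⟩, ?_⟩
  · have hx' : f x ≠ 0 := h2 (tsupport_mul_subset_left hx)
    exact χ.contMDiff.contMDiffAt.mul (f.contMDiff.contMDiffAt.inv₀ hx')
  · filter_upwards [h1, hU] with x hx hx'
    change f x * (χ x * (f x)⁻¹) = 1
    rw [hx, one_mul, mul_inv_cancel₀ hx']

theorem exists_section_eq [FiniteDimensional ℝ B] [T2Space M] [ContMDiffVectorBundle ∞ F V I]
    {m : M} (v : V m) : ∃ σ : Cₛ^∞⟮I; F, V⟯, σ m = v := by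
  obtain ⟨s, hs, h⟩ := FiberBundle.exists_contMDiffOn_extend (k := ∞) I F v
  obtain ⟨t, hts, ht, hmt⟩ := mem_nhds_iff.1 hs
  obtain ⟨χ, h1, h2⟩ := exists_bump (I := I) (ht.mem_nhds hmt)
  refine ⟨⟨fun x => χ x • FiberBundle.extend F v x,
    ContMDiffOn.smul_section_of_tsupport χ.contMDiff.contMDiffOn ht h2 (h.mono hts)⟩, ?_⟩
  change χ m • FiberBundle.extend F v m = v
  rw [h1.self_of_nhds, one_smul, FiberBundle.extend_apply_self]

variable (F) in
theorem finrank_fiber (x : M) : Module.finrank ℝ (V x) = Module.finrank ℝ F :=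
  LinearEquiv.finrank_eq ((trivializationAt F V x).continuousLinearEquivAt ℝ x
    (FiberBundle.mem_baseSet_trivializationAt' x)).toLinearEquiv

variable (F) in
theorem finite_fiber [FiniteDimensional ℝ F] (x : M) : Module.Finite ℝ (V x) :=
  Module.Finite.equiv ((trivializationAt F V x).continuousLinearEquivAt ℝ x
    (FiberBundle.mem_baseSet_trivializationAt' x)).toLinearEquiv.symm

namespace ETwoForm

variable (Ω : ETwoForm I F V)

@[simp] theorem eval_apply (σ τ : Cₛ^∞⟮I; F, V⟯) (x : M) :
    Ω.eval σ τ x = Ω.toFun x (σ x) (τ x) := rfl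

theorem toFun_skew (x : M) (v w : V x) : Ω.toFun x v w = -Ω.toFun x w v := by
  have h := Ω.alt x (v + w)
  simp only [map_add, LinearMap.add_apply, Ω.alt] at h
  linarith

/-- The vectors `p i x`, `q i x` are symplectic, that is, dual to each other and isotropic. -/
structure IsSymplecticAt {k : ℕ} (p q : Fin k → Cₛ^∞⟮I; F, V⟯) (x : M) : Prop where
  pq : ∀ i j, Ω.toFun x (p i x) (q j x) = if i = j then 1 else 0
  pp : ∀ i j, Ω.toFun x (p i x) (p j x) = 0
  qq : ∀ i j, Ω.toFun x (q i x) (q j x) = 0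

/-- The component of `v` in the span of `p i x` and `q i x`, with coefficients given by pairing; this
is the symplectic projection if the family is symplectic at `x`. -/
def component {k : ℕ} (p q : Fin k → Cₛ^∞⟮I; F, V⟯) (x : M) (v : V x) : V x :=
  ∑ i, (Ω.toFun x v (q i x) • p i x - Ω.toFun x v (p i x) • q i x)

variable {Ω}

namespace IsSymplecticAt

variable {k : ℕ} {p q : Fin k → Cₛ^∞⟮I; F, V⟯} {x : M}

theorem qp (h : Ω.IsSymplecticAt p q x) (i j : Fin k) :
    Ω.toFun x (q i x) (p j x) = if i = j then -1 else 0 := by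
  rw [Ω.toFun_skew, h.pq]
  by_cases hij : i = j
  · simp [hij]
  · simp [hij, Ne.symm hij]

theorem component_p (h : Ω.IsSymplecticAt p q x) (v : V x) (j : Fin k) :
    Ω.toFun x (Ω.component p q x v) (p j x) = Ω.toFun x v (p j x) := by
  simp [component, h.pp, h.qp]

theorem component_q (h : Ω.IsSymplecticAt p q x) (v : V x) (j : Fin k) :
    Ω.toFun x (Ω.component p q x v) (q j x) = Ω.toFun x v (q j x) := by
  simp [component, h.qq, h.pq]

variable [FiniteDimensional ℝ F]

/-- The linear combinations of a symplectic family. -/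
def combination (p q : Fin k → Cₛ^∞⟮I; F, V⟯) (x : M) :
    ((Fin k → ℝ) × (Fin k → ℝ)) →ₗ[ℝ] V x :=
  (Fintype.linearCombination ℝ fun i => p i x).coprod (Fintype.linearCombination ℝ fun i => q i x)

theorem combination_apply (p q : Fin k → Cₛ^∞⟮I; F, V⟯) (x : M) (a b : Fin k → ℝ) :
    combination p q x (a, b) = ∑ i, a i • p i x + ∑ i, b i • q i x := rfl

theorem component_eq_combination (v : V x) : Ω.component p q x v =
    combination p q x (fun i => Ω.toFun x v (q i x), fun i => -Ω.toFun x v (p i x)) := by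
  simp [component, combination_apply, Finset.sum_add_distrib, sub_eq_add_neg]

theorem component_combination (h : Ω.IsSymplecticAt p q x) (a b : Fin k → ℝ) :
    Ω.component p q x (combination p q x (a, b)) = combination p q x (a, b) := by
  rw [component_eq_combination]
  congr 1
  ext i <;> simp [combination_apply, h.pp, h.pq, h.qp, h.qq]

theorem combination_injective (h : Ω.IsSymplecticAt p q x) :
    Function.Injective (combination p q x) := by
  rw [injective_iff_map_eq_zero]
  rintro ⟨a, b⟩ hab
  ext i
  · have := congrArg (fun v => Ω.toFun x v (q i x)) hab
    simpa [combination_apply, h.pq, h.qq] using this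
  · have := congrArg (fun v => Ω.toFun x v (p i x)) hab
    simpa [combination_apply, h.pp, h.qp] using this

theorem le_finrank (h : Ω.IsSymplecticAt p q x) : k + k ≤ Module.finrank ℝ F := by
  have := finite_fiber F (V := V) x
  simpa [finrank_fiber F] using
    LinearMap.finrank_le_finrank_of_injective h.combination_injective

/-- A symplectic family of the right size is a basis. -/
theorem component_eq_self (h : Ω.IsSymplecticAt p q x) (hk : k + k = Module.finrank ℝ F)
    (v : V x) : Ω.component p q x v = v := by
  have := finite_fiber F (V := V) x
  obtain ⟨⟨a, b⟩, rfl⟩ := (LinearMap.injective_iff_surjective_of_finrank_eq_finrank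
    (by simpa [finrank_fiber F] using hk)).1 h.combination_injective v
  exact h.component_combination a b

theorem eq_finrank (h : Ω.IsSymplecticAt p q x) (hc : ∀ v, Ω.component p q x v = v) :
    k + k = Module.finrank ℝ F := by
  have := finite_fiber F (V := V) x
  have := (LinearEquiv.ofBijective (combination p q x) ⟨h.combination_injective, fun v =>
    ⟨_, (component_eq_combination v).symm.trans (hc v)⟩⟩).finrank_eq
  simpa [finrank_fiber F] using this

end IsSymplecticAt

/-- The part of a section that, wherever the family is symplectic, is orthogonal to `p i` and `q i`. -/
def orthogonalPart (Ω : ETwoForm I F V) {k : ℕ} (p q : Fin k → Cₛ^∞⟮I; F, V⟯)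
    (σ : Cₛ^∞⟮I; F, V⟯) : Cₛ^∞⟮I; F, V⟯ :=
  σ - ∑ i, (Ω.eval σ (q i) • p i - Ω.eval σ (p i) • q i)

theorem section_sum_apply {κ : Type*} (t : Finset κ) (σ : κ → Cₛ^∞⟮I; F, V⟯) (x : M) :
    (∑ i ∈ t, σ i) x = ∑ i ∈ t, σ i x := by
  classical
  induction t using Finset.induction_on with
  | empty => rfl
  | insert a t ha ih =>
    rw [Finset.sum_insert ha, Finset.sum_insert ha, ← ih]
    rfl

theorem orthogonalPart_apply {k : ℕ} (p q : Fin k → Cₛ^∞⟮I; F, V⟯) (σ : Cₛ^∞⟮I; F, V⟯) (x : M) :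
    Ω.orthogonalPart p q σ x = σ x - Ω.component p q x (σ x) := by
  change σ x - (∑ i, (Ω.eval σ (q i) • p i - Ω.eval σ (p i) • q i)) x = _
  rw [section_sum_apply]
  rfl

variable [FiniteDimensional ℝ B] [T2Space M] [ContMDiffVectorBundle ∞ F V I]
  [FiniteDimensional ℝ F]

/-- The inductive step in the construction of a local symplectic frame: a symplectic family that
does not span can be enlarged. -/
theorem exists_larger_symplectic
    (hΩ : ∀ x (v : V x), (∀ w, Ω.toFun x v w = 0) → v = 0) {m : M} {k : ℕ}
    {p q : Fin k → Cₛ^∞⟮I; F, V⟯} (h : ∀ᶠ x in 𝓝 m, Ω.IsSymplecticAt p q x)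
    (hk : k + k ≠ Module.finrank ℝ F) :
    ∃ p q : Fin (k + 1) → Cₛ^∞⟮I; F, V⟯, ∀ᶠ x in 𝓝 m, Ω.IsSymplecticAt p q x := by
  obtain ⟨v, hv⟩ : ∃ v, Ω.component p q m v ≠ v := by
    by_contra! hc
    exact hk (h.self_of_nhds.eq_finrank hc)
  obtain ⟨u, hu⟩ : ∃ u, Ω.toFun m (v - Ω.component p q m v) u ≠ 0 := by
    by_contra! hc
    exact hv (sub_eq_zero.1 (hΩ m _ hc)).symm
  obtain ⟨σ, rfl⟩ := exists_section_eq (I := I) (F := F) v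
  obtain ⟨τ, rfl⟩ := exists_section_eq (I := I) (F := F) u
  set σ' := Ω.orthogonalPart p q σ
  set τ' := Ω.orthogonalPart p q τ
  have orth {x : M} (hx : Ω.IsSymplecticAt p q x) (σ : Cₛ^∞⟮I; F, V⟯) (i : Fin k) :
      Ω.toFun x (Ω.orthogonalPart p q σ x) (p i x) = 0 ∧
      Ω.toFun x (Ω.orthogonalPart p q σ x) (q i x) = 0 := by
    rw [orthogonalPart_apply, map_sub, LinearMap.sub_apply, LinearMap.sub_apply, hx.component_p,
      hx.component_q, sub_self, sub_self]
    exact ⟨rfl, rfl⟩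
  have hf : Ω.eval σ' τ' m ≠ 0 := by
    have h1 : Ω.toFun m (σ' m) (Ω.component p q m (τ m)) = 0 := by
      simp [component, (orth h.self_of_nhds σ _).1, (orth h.self_of_nhds σ _).2, σ']
    rwa [eval_apply, orthogonalPart_apply (σ := τ), map_sub, h1, sub_zero, orthogonalPart_apply]
  obtain ⟨g, hg⟩ := exists_inverse_near _ hf
  refine ⟨Fin.cons σ' p, Fin.cons (g • τ') q, ?_⟩
  filter_upwards [h, hg] with x hx hgx
  have hs (i) := orth hx σ i
  have ht (i) := orth hx τ i
  have hs' (i) : Ω.toFun x (p i x) (σ' x) = 0 := by rw [Ω.toFun_skew, (hs i).1, neg_zero]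
  have ht' (i) : Ω.toFun x (p i x) (τ' x) = 0 := by rw [Ω.toFun_skew, (ht i).1, neg_zero]
  have ht'' (i) : Ω.toFun x (q i x) (τ' x) = 0 := by rw [Ω.toFun_skew, (ht i).2, neg_zero]
  refine ⟨fun i j => ?_, fun i j => ?_, fun i j => ?_⟩
  · refine Fin.cases ?_ (fun i => ?_) i <;> refine Fin.cases ?_ (fun j => ?_) j
    · simpa [mul_comm] using hgx
    · simpa [(Fin.succ_ne_zero j).symm] using (hs j).2
    · simp [ht']
    · simpa using hx.pq i j
  · refine Fin.cases ?_ (fun i => ?_) i <;> refine Fin.cases ?_ (fun j => ?_) j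
    · simpa using Ω.alt x _
    · simpa using (hs j).1
    · simpa using hs' i
    · simpa using hx.pp i j
  · refine Fin.cases ?_ (fun i => ?_) i <;> refine Fin.cases ?_ (fun j => ?_) j
    · simp [Ω.alt]
    · simp only [Fin.cons_zero, Fin.cons_succ, ContMDiffSection.fun_smul_apply, map_smul,
        LinearMap.smul_apply]
      rw [(ht j).2, smul_zero]
    · simp [ht'']
    · simpa using hx.qq i j

/-- Local symplectic frames exist; in particular the rank is even. -/
theorem exists_symplectic_frame
    (hΩ : ∀ x (v : V x), (∀ w, Ω.toFun x v w = 0) → v = 0) (m : M) :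
    Module.finrank ℝ F / 2 + Module.finrank ℝ F / 2 = Module.finrank ℝ F ∧
    ∃ p q : Fin (Module.finrank ℝ F / 2) → Cₛ^∞⟮I; F, V⟯,
      ∀ᶠ x in 𝓝 m, Ω.IsSymplecticAt p q x := by
  obtain ⟨k, hk, h⟩ : ∃ k, k + k = Module.finrank ℝ F ∧
      ∃ p q : Fin k → Cₛ^∞⟮I; F, V⟯, ∀ᶠ x in 𝓝 m, Ω.IsSymplecticAt p q x := by
    by_contra hc
    have h (k : ℕ) : ∃ p q : Fin k → Cₛ^∞⟮I; F, V⟯, ∀ᶠ x in 𝓝 m, Ω.IsSymplecticAt p q x := by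
      induction k with
      | zero =>
        exact ⟨0, 0, Filter.Eventually.of_forall fun x =>
          ⟨fun i => i.elim0, fun i => i.elim0, fun i => i.elim0⟩⟩
      | succ k ih =>
        obtain ⟨p, q, h⟩ := ih
        exact exists_larger_symplectic hΩ h fun hk => hc ⟨k, hk, p, q, h⟩
    obtain ⟨p, q, h⟩ := h (Module.finrank ℝ F + 1)
    have := h.self_of_nhds.le_finrank
    omega
  obtain rfl : k = Module.finrank ℝ F / 2 := by omega
  exact ⟨hk, h⟩

end ETwoForm

end LieAlgebroidGeometry
end

noncomputable section

/-! ### Independence of the bracket of the representing tensor -/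

namespace SymplecticChart

open MvPowerSeries FormalPoisson

variable {n : ℕ} {A L S : Type*} [CommRing A] [Algebra ℝ A] [LieRing L]
    [LieAlgebra ℝ L] [Module A L] [LieRingModule L A] [LieRinehartRing A L]
    [LieRinehartAlgebra ℝ A L] [CommRing S] [Algebra ℝ S] [Algebra A S] [IsScalarTower ℝ A S]
    (c : SymplecticChart n A L S)

/-- A tensor whose components in the frame vanish in `S` is a combination of tensors with
coefficients that vanish in `S`. -/
theorem mem_ker_smul_top (ϖ : L ⊗[A] L)
    (h : ∀ a b, (LinearMap.mul' A A ∘ₗ TensorProduct.map (c.θ a) (c.θ b)) ϖ ∈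
      RingHom.ker (algebraMap A S)) :
    ϖ ∈ RingHom.ker (algebraMap A S) • (⊤ : Submodule A (L ⊗[A] L)) := by
  set J := RingHom.ker (algebraMap A S) • (⊤ : Submodule A (L ⊗[A] L)) with hJ
  have hN : ∀ f ∈ RingHom.ker (algebraMap A S), ∀ x : (L ⊗[A] L) ⧸ J, f • x = 0 := fun f hf x => by
    obtain ⟨x, rfl⟩ := J.mkQ_surjective x
    rw [← map_smul, Submodule.mkQ_apply, Submodule.Quotient.mk_eq_zero]
    exact Submodule.smul_mem_smul hf trivial
  have hsum : J.mkQ ϖ = ∑ a, ∑ b, (LinearMap.mul' A A ∘ₗ TensorProduct.map (c.θ a) (c.θ b)) ϖ •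
      J.mkQ (c.e a ⊗ₜ c.e b) := by
    clear h
    induction ϖ using TensorProduct.induction_on with
    | zero => simp
    | add x y hx hy => simp only [map_add, hx, hy, add_smul, Finset.sum_add_distrib]
    | tmul σ τ =>
      have h1 := c.map_eq_sum hN (J.mkQ ∘ₗ (TensorProduct.mk A L L).flip τ) σ
      have h2 (a) := c.map_eq_sum hN (J.mkQ ∘ₗ TensorProduct.mk A L L (c.e a)) τ
      simp only [LinearMap.comp_apply, LinearMap.flip_apply, TensorProduct.mk_apply] at h1 h2
      rw [h1]
      refine Finset.sum_congr rfl fun a _ => ?_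
      rw [h2, Finset.smul_sum]
      refine Finset.sum_congr rfl fun b _ => ?_
      rw [smul_smul]
      simp
  rw [← Submodule.Quotient.mk_eq_zero, ← Submodule.mkQ_apply, hsum]
  exact Finset.sum_eq_zero fun a _ => Finset.sum_eq_zero fun b _ => hN _ (h a b) _

/-- Tensors with coefficients that vanish in `S` are preserved by the coproduct. -/
theorem coact_mem_ker_smul_top (c : SymplecticChart n A L S) (D : Env ℝ A L)
    {z : Env ℝ A L ⊗[A] Env ℝ A L}
    (hz : z ∈ RingHom.ker (algebraMap A S) • (⊤ : Submodule A (Env ℝ A L ⊗[A] Env ℝ A L))) :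
    Env.coact ℝ A L D z ∈
      RingHom.ker (algebraMap A S) • (⊤ : Submodule A (Env ℝ A L ⊗[A] Env ℝ A L)) := by
  induction D using Env.left_induction with
  | one => rwa [map_one]
  | add D D' h h' => rw [map_add]; exact add_mem h h'
  | smul f D h => rw [Env.coact_fun_smul]; exact Submodule.smul_mem _ _ h
  | ι_mul σ D h =>
    rw [map_mul, Module.End.mul_apply]
    generalize Env.coact ℝ A L D z = y at h
    induction h using Submodule.smul_induction_on' with
    | smul f hf y _ =>
      rw [← Env.coact_ofFun, ← Module.End.mul_apply, ← map_mul, Env.ι_mul_ofFun, map_add, map_mul,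
        LinearMap.add_apply, Module.End.mul_apply, Env.coact_ofFun, Env.coact_ofFun]
      exact add_mem (Submodule.smul_mem_smul hf trivial)
        (Submodule.smul_mem_smul (c.lie_mem_ker σ hf) trivial)
    | add x _ y _ hx hy => rw [map_add]; exact add_mem hx hy

/-- The bracket of jets only depends on the components of the tensor in `S`. -/
theorem bracket_congr {K : Type*} [CommRing K] [Algebra A K]
    (hK : ∀ f ∈ RingHom.ker (algebraMap A S), algebraMap A K f = 0) {ϖ ϖ' : L ⊗[A] L}
    (h : ∀ a b, (LinearMap.mul' A A ∘ₗ TensorProduct.map (c.θ a) (c.θ b)) (ϖ - ϖ') ∈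
      RingHom.ker (algebraMap A S)) :
    (Jet.bracket ϖ : Jet ℝ A L K → Jet ℝ A L K → Jet ℝ A L K) = Jet.bracket ϖ' := by
  ext l l' D
  have h0 : ∀ z ∈ RingHom.ker (algebraMap A S) • (⊤ : Submodule A (Env ℝ A L ⊗[A] Env ℝ A L)),
      Jet.tensor l l' z = 0 := fun z hz => by
    induction hz using Submodule.smul_induction_on' with
    | smul f hf y _ => rw [map_smul, Algebra.smul_def, hK f hf, zero_mul]
    | add x _ y _ hx hy => rw [map_add, hx, hy, add_zero]
  have h1 : TensorProduct.map (Env.ι ℝ A L) (Env.ι ℝ A L) (ϖ - ϖ') ∈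
      RingHom.ker (algebraMap A S) • (⊤ : Submodule A (Env ℝ A L ⊗[A] Env ℝ A L)) := by
    have h2 := c.mem_ker_smul_top _ h
    generalize ϖ - ϖ' = z at h2
    induction h2 using Submodule.smul_induction_on' with
    | smul f hf y _ => rw [map_smul]; exact Submodule.smul_mem_smul hf trivial
    | add x _ y _ hx hy => rw [map_add]; exact add_mem hx hy
  have h3 := h0 _ (c.coact_mem_ker_smul_top D h1)
  rw [map_sub, map_sub, map_sub, sub_eq_zero] at h3
  exact h3

/-- A jet over `A` that has prescribed values in `S` up to a cut-off function. -/
theorem exists_jet_of_cutoff (c : SymplecticChart n A L S) (χ : A)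
    (hχ : ∀ f ∈ RingHom.ker (algebraMap A S), χ * f = 0) (l : Jet ℝ A L S) :
    ∃ l' : Jet ℝ A L A, ∀ D, algebraMap A S (l' D) = algebraMap A S χ * l D := by
  choose g hg using c.surj
  have h {f f' : A} (hf : algebraMap A S f = algebraMap A S f') : χ * f = χ * f' := by
    rw [← sub_eq_zero, ← mul_sub]
    exact hχ _ (by rw [RingHom.mem_ker, map_sub, hf, sub_self])
  exact ⟨{ toFun := fun D => χ * g (l D)
           map_add' := fun D D' => by
             rw [← mul_add]
             exact h (by rw [hg, map_add l, map_add (algebraMap A S), hg, hg])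
           map_smul' := fun f D => by
             rw [RingHom.id_apply, smul_eq_mul, mul_left_comm]
             exact h (by rw [hg, map_smul, map_mul, hg, Algebra.smul_def]) },
    fun D => by simp [hg]⟩

end SymplecticChart

/-! ### Symplectic charts of a Lie algebroid -/

section LieAlgebroidCharts

variable {B : Type*} [NormedAddCommGroup B] [NormedSpace ℝ B]
  {H : Type*} [TopologicalSpace H] {I : ModelWithCorners ℝ B H}
  {M : Type*} [TopologicalSpace M] [ChartedSpace H M] [IsManifold I ∞ M]
  {F : Type*} [NormedAddCommGroup F] [NormedSpace ℝ F]
  {V : M → Type*} [TopologicalSpace (Bundle.TotalSpace F V)]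
  [∀ x, AddCommGroup (V x)] [∀ x, Module ℝ (V x)] [∀ x, TopologicalSpace (V x)]
  [FiberBundle F V] [VectorBundle ℝ F V]

variable (I) in
/-- The smooth functions that vanish on `U`. -/
def vanishingFunctions (U : Set M) : Ideal C^∞⟮I, M; ℝ⟯ where
  carrier := {f | ∀ x ∈ U, f x = 0}
  add_mem' hf hg x hx := by
    change _ + _ = (0 : ℝ)
    rw [hf x hx, hg x hx, add_zero]
  zero_mem' x _ := rfl
  smul_mem' g f hf x hx := by
    change g x * f x = 0
    rw [hf x hx, mul_zero]

variable (I) in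
/-- The restrictions to `U` of the smooth functions on `M`, as a quotient of the algebra of the
latter. -/
abbrev Restrictions (U : Set M) : Type _ := C^∞⟮I, M; ℝ⟯ ⧸ vanishingFunctions I U

theorem algebraMap_restrictions_eq_zero {U : Set M} {f : C^∞⟮I, M; ℝ⟯} :
    algebraMap C^∞⟮I, M; ℝ⟯ (Restrictions I U) f = 0 ↔ ∀ x ∈ U, f x = 0 :=
  Ideal.Quotient.eq_zero_iff_mem

theorem algebraMap_restrictions_eq {U : Set M} {f g : C^∞⟮I, M; ℝ⟯} :
    algebraMap C^∞⟮I, M; ℝ⟯ (Restrictions I U) f = algebraMap _ _ g ↔ ∀ x ∈ U, f x = g x := by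
  rw [← sub_eq_zero, ← map_sub, algebraMap_restrictions_eq_zero]
  refine forall₂_congr fun x _ => ?_
  exact sub_eq_zero (a := f x) (b := g x)

theorem ker_restrictions {U : Set M} {f : C^∞⟮I, M; ℝ⟯} :
    f ∈ RingHom.ker (algebraMap C^∞⟮I, M; ℝ⟯ (Restrictions I U)) ↔ ∀ x ∈ U, f x = 0 :=
  algebraMap_restrictions_eq_zero

/-- Evaluation at a point of `U`. -/
def evalAt {U : Set M} {x : M} (hx : x ∈ U) : Restrictions I U →ₐ[C^∞⟮I, M; ℝ⟯] ScalarAt x :=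
  Ideal.Quotient.liftₐ _ (Algebra.ofId _ _) fun _ hf => hf x hx

theorem evalAt_surjective {U : Set M} {x : M} (hx : x ∈ U) :
    Function.Surjective (evalAt (I := I) hx) := fun r =>
  ⟨algebraMap C^∞⟮I, M; ℝ⟯ (Restrictions I U) (algebraMap ℝ C^∞⟮I, M; ℝ⟯ r), rfl⟩

variable [LieAlgebroid I F V]

theorem lie_apply_eq_zero {U : Set M} (hU : IsOpen U) {f : C^∞⟮I, M; ℝ⟯} (hf : ∀ x ∈ U, f x = 0)
    (σ : Cₛ^∞⟮I; F, V⟯) : ∀ x ∈ U, ⁅σ, f⁆ x = 0 := fun x hx => by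
  change mvfderiv I f x _ = 0
  have h : (f : M → ℝ) =ᶠ[𝓝 x] fun _ => 0 := Filter.eventually_of_mem (hU.mem_nhds hx) hf
  have h2 : mvfderiv I f x = 0 := by
    rw [← mvfderiv_const (I := I) (0 : ℝ) (x := x)]
    ext v
    simp only [mvfderiv, h.mfderiv_eq]
    rfl
  rw [h2]
  rfl

/-- The action of sections on functions is local; `Quotient.out` chooses an extension to `M`. -/
theorem algebraMap_lie_out {U : Set M} (hU : IsOpen U) (σ : Cₛ^∞⟮I; F, V⟯)
    (f : C^∞⟮I, M; ℝ⟯) :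
    algebraMap C^∞⟮I, M; ℝ⟯ (Restrictions I U)
      ⁅σ, Quotient.out (algebraMap C^∞⟮I, M; ℝ⟯ (Restrictions I U) f)⁆ =
    algebraMap C^∞⟮I, M; ℝ⟯ (Restrictions I U) ⁅σ, f⁆ := by
  rw [← sub_eq_zero, ← map_sub, ← lie_sub, algebraMap_restrictions_eq_zero]
  refine lie_apply_eq_zero hU ?_ σ
  rw [← algebraMap_restrictions_eq_zero, map_sub, sub_eq_zero]
  exact Quotient.out_eq _

theorem algebraMap_restrictions_surjective (U : Set M) :
    Function.Surjective (algebraMap C^∞⟮I, M; ℝ⟯ (Restrictions I U)) :=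
  Ideal.Quotient.mk_surjective

/-- The derivation along a section, as a linear map on the restrictions of functions to an open
set. -/
def restrictedLie {U : Set M} (hU : IsOpen U) (σ : Cₛ^∞⟮I; F, V⟯) :
    Restrictions I U →ₗ[ℝ] Restrictions I U where
  toFun s := algebraMap C^∞⟮I, M; ℝ⟯ (Restrictions I U) ⁅σ, Quotient.out s⁆
  map_add' s t := by
    obtain ⟨f, rfl⟩ := algebraMap_restrictions_surjective U s
    obtain ⟨g, rfl⟩ := algebraMap_restrictions_surjective U t
    rw [← map_add, algebraMap_lie_out hU, algebraMap_lie_out hU, algebraMap_lie_out hU, lie_add,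
      map_add]
  map_smul' r s := by
    obtain ⟨f, rfl⟩ := algebraMap_restrictions_surjective U s
    have : r • algebraMap C^∞⟮I, M; ℝ⟯ (Restrictions I U) f =
      algebraMap C^∞⟮I, M; ℝ⟯ (Restrictions I U) (r • f) := rfl
    rw [this, algebraMap_lie_out hU, algebraMap_lie_out hU, lie_smul]
    rfl

theorem restrictedLie_algebraMap {U : Set M} (hU : IsOpen U) (σ : Cₛ^∞⟮I; F, V⟯)
    (f : C^∞⟮I, M; ℝ⟯) :
    restrictedLie hU σ (algebraMap C^∞⟮I, M; ℝ⟯ (Restrictions I U) f) =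
      algebraMap C^∞⟮I, M; ℝ⟯ (Restrictions I U) ⁅σ, f⁆ :=
  algebraMap_lie_out hU σ f

/-- The derivation along a section, on the restrictions of functions to an open set. -/
def restrictedDeriv {U : Set M} (hU : IsOpen U) :
    Cₛ^∞⟮I; F, V⟯ →ₗ[C^∞⟮I, M; ℝ⟯] Derivation ℝ (Restrictions I U) (Restrictions I U) where
  toFun σ := Derivation.mk' (restrictedLie hU σ) fun s t => by
    obtain ⟨f, rfl⟩ := algebraMap_restrictions_surjective U s
    obtain ⟨g, rfl⟩ := algebraMap_restrictions_surjective U t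
    rw [← map_mul, restrictedLie_algebraMap, restrictedLie_algebraMap, restrictedLie_algebraMap,
      LieRinehartRing.leibniz_mul_right, smul_eq_mul, smul_eq_mul, smul_eq_mul, map_add, map_mul, map_mul,
      mul_comm (algebraMap C^∞⟮I, M; ℝ⟯ (Restrictions I U) ⁅σ, f⁆)]
  map_add' σ τ := by
    ext s
    obtain ⟨f, rfl⟩ := algebraMap_restrictions_surjective U s
    change restrictedLie hU (σ + τ) (algebraMap C^∞⟮I, M; ℝ⟯ (Restrictions I U) f) =
      restrictedLie hU σ (algebraMap C^∞⟮I, M; ℝ⟯ (Restrictions I U) f) +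
      restrictedLie hU τ (algebraMap C^∞⟮I, M; ℝ⟯ (Restrictions I U) f)
    rw [restrictedLie_algebraMap, restrictedLie_algebraMap, restrictedLie_algebraMap, add_lie,
      map_add]
  map_smul' f σ := by
    ext s
    obtain ⟨g, rfl⟩ := algebraMap_restrictions_surjective U s
    change restrictedLie hU (f • σ) (algebraMap C^∞⟮I, M; ℝ⟯ (Restrictions I U) g) =
      f • restrictedLie hU σ (algebraMap C^∞⟮I, M; ℝ⟯ (Restrictions I U) g)
    rw [restrictedLie_algebraMap, restrictedLie_algebraMap, LieRinehartRing.lie_smul_eq_mul]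
    rfl

theorem restrictedDeriv_algebraMap {U : Set M} (hU : IsOpen U) (σ : Cₛ^∞⟮I; F, V⟯)
    (f : C^∞⟮I, M; ℝ⟯) :
    restrictedDeriv hU σ (algebraMap C^∞⟮I, M; ℝ⟯ (Restrictions I U) f) =
      algebraMap C^∞⟮I, M; ℝ⟯ (Restrictions I U) ⁅σ, f⁆ :=
  restrictedLie_algebraMap hU σ f

namespace ETwoForm

variable {Ω : ETwoForm I F V}

theorem eval_skew (σ τ : Cₛ^∞⟮I; F, V⟯) : Ω.eval σ τ = -Ω.eval τ σ := by
  ext x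
  exact Ω.toFun_skew x _ _

theorem eval_closed (hΩ : Ω.IsSymplectic) (σ τ υ : Cₛ^∞⟮I; F, V⟯) :
    ⁅σ, Ω.eval τ υ⁆ - Ω.eval ⁅σ, τ⁆ υ + (⁅τ, Ω.eval υ σ⁆ - Ω.eval ⁅τ, υ⁆ σ) +
    (⁅υ, Ω.eval σ τ⁆ - Ω.eval ⁅υ, σ⁆ τ) = 0 := by
  have h := hΩ.closed σ τ υ
  have h1 : Ω.eval ⁅υ, σ⁆ τ = -Ω.eval ⁅σ, υ⁆ τ := by
    rw [← lie_skew σ υ]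
    ext x
    change _ = -Ω.toFun x (-_) _
    rw [map_neg, LinearMap.neg_apply, neg_neg]
    rfl
  rw [d, eval_skew σ υ, lie_neg] at h
  rw [h1]
  linear_combination -h

/-- The symplectic chart defined by sections `p`, `q` that are symplectic on `W`, over a smaller
open set `U` that is separated from the complement of `W` by a cut-off function. -/
def chart (hΩ : Ω.IsSymplectic) [FiniteDimensional ℝ F] {n : ℕ} (hn : n + n = Module.finrank ℝ F)
    (p q : Fin n → Cₛ^∞⟮I; F, V⟯) {U W : Set M} (hU : IsOpen U) (hUW : U ⊆ W)
    (hW : ∀ x ∈ W, Ω.IsSymplecticAt p q x)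
    (χ : C^∞⟮I, M; ℝ⟯) (hχU : ∀ x ∈ U, χ x = 1) (hχW : ∀ x, x ∉ W → χ x = 0) :
    SymplecticChart n C^∞⟮I, M; ℝ⟯ Cₛ^∞⟮I; F, V⟯ (Restrictions I U) where
  ρ := restrictedDeriv hU
  ρ_algebraMap σ f := restrictedDeriv_algebraMap hU σ f
  ρ_lie σ τ s := by
    obtain ⟨f, rfl⟩ := algebraMap_restrictions_surjective U s
    rw [restrictedDeriv_algebraMap, restrictedDeriv_algebraMap, restrictedDeriv_algebraMap,
      restrictedDeriv_algebraMap, restrictedDeriv_algebraMap, ← map_sub, lie_lie]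
  surj := Ideal.Quotient.mk_surjective
  e := Sum.elim p q
  θ a := Ω.contractLeft (Sum.elim q (-p) a)
  expand σ := by
    set δ := σ - ∑ a, Ω.contractLeft (Sum.elim q (-p) a) σ • Sum.elim p q a with hδ
    -- `δ` vanishes on `W`, and `1 - χ` vanishes on `U` and equals `1` off `W`
    have h : δ = (1 - χ) • δ := by
      ext x
      rw [ContMDiffSection.fun_smul_apply]
      by_cases hx : x ∈ W
      · have h0 : δ x = 0 := by
          have := (hW x hx).component_eq_self hn (σ x)
          rw [component, Finset.sum_sub_distrib] at this
          rw [hδ, Fintype.sum_sum_type]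
          change σ x - (_ + _ : Cₛ^∞⟮I; F, V⟯) x = 0
          rw [ContMDiffSection.coe_add, Pi.add_apply, section_sum_apply, section_sum_apply,
            sub_eq_zero]
          nth_rw 1 [← this]
          rw [sub_eq_add_neg, ← Finset.sum_neg_distrib]
          congr 1
          refine Finset.sum_congr rfl fun i _ => ?_
          rw [ContMDiffSection.fun_smul_apply, ← neg_smul]
          congr 1
          change _ = Ω.toFun x (σ x) (-(p i x))
          rw [map_neg]
        rw [h0, smul_zero]
      · have : (1 - χ) x = 1 := by
          change 1 - χ x = 1
          rw [hχW x hx, sub_zero]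
        rw [this, one_smul]
    rw [h]
    refine Submodule.smul_mem_smul (ker_restrictions.2 fun x hx => ?_) trivial
    change 1 - χ x = 0
    rw [hχU x hx, sub_self]
  θ_e a b := by
    rw [← map_one (algebraMap C^∞⟮I, M; ℝ⟯ (Restrictions I U)),
      ← map_zero (algebraMap C^∞⟮I, M; ℝ⟯ (Restrictions I U)), ← apply_ite,
      algebraMap_restrictions_eq]
    intro x hx
    have hx := hW x (hUW hx)
    rcases a with i | i <;> rcases b with j | j
    · change Ω.toFun x (p j x) (q i x) = _
      rw [hx.pq]
      by_cases h : i = j <;> simp [h, eq_comm]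
    · change Ω.toFun x (q j x) (q i x) = _
      rw [hx.qq]
      simp
    · change Ω.toFun x (p j x) (-(p i x)) = _
      rw [map_neg, hx.pp]
      simp
    · change Ω.toFun x (q j x) (-(p i x)) = _
      rw [map_neg, hx.qp]
      by_cases h : i = j <;> simp [h, eq_comm]
  Ω := LinearMap.mk₂ C^∞⟮I, M; ℝ⟯ (fun σ τ => algebraMap _ _ (Ω.eval σ τ))
    (fun σ σ' τ => by rw [← map_add]; congr 1; exact map_add (Ω.contractLeft τ) σ σ')
    (fun f σ τ => by
      rw [Algebra.smul_def, ← map_mul]; congr 1; exact map_smul (Ω.contractLeft τ) f σ)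
    (fun σ τ τ' => by
      rw [← map_add]; congr 1; ext x; exact map_add (Ω.toFun x (σ x)) _ _)
    (fun f σ τ => by
      rw [Algebra.smul_def, ← map_mul]; congr 1; ext x; exact map_smul (Ω.toFun x (σ x)) _ _)
  Ω_self σ := algebraMap_restrictions_eq_zero.2 fun x _ => Ω.alt x _
  closed σ τ υ := by
    simp only [LinearMap.mk₂_apply, restrictedDeriv_algebraMap]
    simp only [← map_sub, ← map_add, eval_closed hΩ, map_zero]
  Ω_e a b := by
    have h1 : standardForm n (Restrictions I U) a b =
        algebraMap C^∞⟮I, M; ℝ⟯ _ (standardForm n C^∞⟮I, M; ℝ⟯ a b) := by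
      rcases a with i | i <;> rcases b with j | j <;> simp only [standardForm, map_zero] <;>
        split_ifs <;> simp
    rw [h1, LinearMap.mk₂_apply, algebraMap_restrictions_eq]
    intro x hx
    have hx := hW x (hUW hx)
    rcases a with i | i <;> rcases b with j | j
    · exact hx.pp i j
    · refine (hx.pq i j).trans ?_
      rw [standardForm]
      split_ifs <;> rfl
    · refine (hx.qp i j).trans ?_
      rw [standardForm]
      split_ifs <;> rfl
    · exact hx.qq i j

end ETwoForm

end LieAlgebroidCharts
end

noncomputable section

/-! ### Poisson algebras isomorphic to the standard one -/

theorem isPoissonAlgebra_standard (n : ℕ) :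
    IsPoissonAlgebra ℝ (FormalPhaseSpace n) (· * ·) 1 (standardBracket n) where
  mul_comm := mul_comm
  mul_assoc := mul_assoc
  one_mul := one_mul
  add_mul := add_mul
  smul_mul := smul_mul_assoc
  br_self := FormalPoisson.poisson_self
  br_skew := FormalPoisson.poisson_skew
  add_br := FormalPoisson.poisson_add_left
  smul_br := FormalPoisson.poisson_smul_left
  leibniz := FormalPoisson.poisson_mul_right
  jacobi := FormalPoisson.poisson_jacobi

section LieAlgebroidJets

variable {B : Type*} [NormedAddCommGroup B] [NormedSpace ℝ B]
  {H : Type*} [TopologicalSpace H] {I : ModelWithCorners ℝ B H}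
  {M : Type*} [TopologicalSpace M] [ChartedSpace H M] [IsManifold I ∞ M]
  {F : Type*} [NormedAddCommGroup F] [NormedSpace ℝ F]
  {V : M → Type*} [TopologicalSpace (Bundle.TotalSpace F V)]
  [∀ x, AddCommGroup (V x)] [∀ x, Module ℝ (V x)] [∀ x, TopologicalSpace (V x)]
  [FiberBundle F V] [VectorBundle ℝ F V] [LieAlgebroid I F V]

theorem IsStandardPoissonIso.isPoissonAlgebra {n : ℕ} {m : M}
    {br : EJetFiber I F V m → EJetFiber I F V m → EJetFiber I F V m}
    {φ : EJetFiber I F V m ≃ₗ[ℝ] FormalPhaseSpace n} (h : IsStandardPoissonIso n br φ) :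
    IsPoissonAlgebra ℝ (EJetFiber I F V m) Jet.mul Jet.one br := by
  have hs := isPoissonAlgebra_standard n
  have h1 := h.map_mul
  have h2 := h.map_one
  have h3 := h.map_bracket
  constructor
  · intro a b
    apply φ.injective
    rw [h1, h1]
    exact hs.mul_comm _ _
  · intro a b c
    apply φ.injective
    rw [h1, h1, h1, h1]
    exact hs.mul_assoc _ _ _
  · intro a
    apply φ.injective
    rw [h1, h2]
    exact hs.one_mul _
  · intro a b c
    apply φ.injective
    rw [map_add, h1, h1, h1, map_add]
    exact hs.add_mul _ _ _
  · intro s a b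
    apply φ.injective
    rw [map_smul, h1, h1, map_smul]
    exact hs.smul_mul _ _ _
  · intro a
    apply φ.injective
    rw [map_zero, h3]
    exact hs.br_self _
  · intro a b
    apply φ.injective
    rw [map_neg, h3, h3]
    exact hs.br_skew _ _
  · intro a b c
    apply φ.injective
    rw [map_add, h3, h3, h3, map_add]
    exact hs.add_br _ _ _
  · intro s a b
    apply φ.injective
    rw [map_smul, h3, h3, map_smul]
    exact hs.smul_br _ _ _
  · intro a b c
    apply φ.injective
    rw [map_add, h1, h1, h3, h3, h3, h1]
    exact hs.leibniz _ _ _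
  · intro a b c
    apply φ.injective
    simp only [map_add, map_zero, h3]
    exact hs.jacobi _ _ _

/-! ### Values of jets at points -/

namespace EJets

theorem ext_at {l l' : EJets I F V} (h : ∀ m, l.at m = l'.at m) : l = l' := by
  ext D m
  exact LinearMap.congr_fun (h m) D

theorem add_at (l l' : EJets I F V) (m : M) : (l + l').at m = l.at m + l'.at m := rfl

theorem neg_at (l : EJets I F V) (m : M) : (-l).at m = -l.at m := rfl

theorem zero_at (m : M) : (0 : EJets I F V).at m = 0 := rfl

theorem smul_at (f : C^∞⟮I, M; ℝ⟯) (l : EJets I F V) (m : M) : (f • l).at m = f m • l.at m := rfl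

theorem coactDual_at (z : EOp I F V ⊗[C^∞⟮I, M; ℝ⟯] EOp I F V) (l l' : EJets I F V) (m : M) :
    EJets.at (Jet.coactDual z l l') m = Jet.coactDual z (l.at m) (l'.at m) :=
  (Jet.coactDual_comp (Algebra.ofId C^∞⟮I, M; ℝ⟯ (ScalarAt m)) z l l').symm

theorem mul_at (l l' : EJets I F V) (m : M) :
    EJets.at (Jet.mul l l') m = Jet.mul (l.at m) (l'.at m) := coactDual_at _ l l' m

theorem one_at (m : M) : EJets.at (Jet.one : EJets I F V) m = Jet.one :=
  (Jet.one_comp (Algebra.ofId C^∞⟮I, M; ℝ⟯ (ScalarAt m))).symm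

theorem bracket_at (ϖ : Cₛ^∞⟮I; F, V⟯ ⊗[C^∞⟮I, M; ℝ⟯] Cₛ^∞⟮I; F, V⟯) (l l' : EJets I F V) (m : M) :
    EJets.at (Jet.bracket ϖ l l') m = Jet.bracket ϖ (l.at m) (l'.at m) := coactDual_at _ l l' m

/-- The identities of a Poisson algebra may be checked on the fibres. -/
theorem isPoissonAlgebra {br : EJets I F V → EJets I F V → EJets I F V}
    {brAt : ∀ m : M, EJetFiber I F V m → EJetFiber I F V m → EJetFiber I F V m}
    (hbr : ∀ l l' m, (br l l').at m = brAt m (l.at m) (l'.at m))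
    (h : ∀ m, IsPoissonAlgebra ℝ (EJetFiber I F V m) Jet.mul Jet.one (brAt m)) :
    IsPoissonAlgebra C^∞⟮I, M; ℝ⟯ (EJets I F V) Jet.mul Jet.one br := by
  constructor
  · exact fun a b => ext_at fun m => by
      rw [mul_at, mul_at]; exact (h m).mul_comm _ _
  · exact fun a b c => ext_at fun m => by
      rw [mul_at, mul_at, mul_at, mul_at]; exact (h m).mul_assoc _ _ _
  · exact fun a => ext_at fun m => by
      rw [mul_at, one_at]; exact (h m).one_mul _
  · exact fun a b c => ext_at fun m => by
      rw [add_at, mul_at, mul_at, mul_at, add_at]; exact (h m).add_mul _ _ _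
  · exact fun s a b => ext_at fun m => by
      rw [smul_at, mul_at, mul_at, smul_at]; exact (h m).smul_mul _ _ _
  · exact fun a => ext_at fun m => by
      rw [zero_at, hbr]; exact (h m).br_self _
  · exact fun a b => ext_at fun m => by
      rw [neg_at, hbr, hbr]; exact (h m).br_skew _ _
  · exact fun a b c => ext_at fun m => by
      rw [add_at, hbr, hbr, hbr, add_at]; exact (h m).add_br _ _ _
  · exact fun s a b => ext_at fun m => by
      rw [smul_at, hbr, hbr, smul_at]; exact (h m).smul_br _ _ _
  · exact fun a b c => ext_at fun m => by
      rw [add_at, mul_at, mul_at, hbr, hbr, hbr, mul_at]; exact (h m).leibniz _ _ _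
  · exact fun a b c => ext_at fun m => by
      simp only [add_at, zero_at, hbr]; exact (h m).jacobi _ _ _

end EJets

/-! ### The bracket of jets and its trivializations -/

namespace ETwoForm

variable {Ω : ETwoForm I F V}

theorem lower_sub (ϖ ϖ' : Cₛ^∞⟮I; F, V⟯ ⊗[C^∞⟮I, M; ℝ⟯] Cₛ^∞⟮I; F, V⟯) (σ τ : Cₛ^∞⟮I; F, V⟯) :
    Ω.lower (ϖ - ϖ') σ τ = Ω.lower ϖ σ τ - Ω.lower ϖ' σ τ := map_sub _ _ _

theorem lower_chart (hΩ : Ω.IsSymplectic) [FiniteDimensional ℝ F] {n : ℕ}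
    (hn : n + n = Module.finrank ℝ F)
    (p q : Fin n → Cₛ^∞⟮I; F, V⟯) {U W : Set M} (hU : IsOpen U) (hUW : U ⊆ W)
    (hW : ∀ x ∈ W, Ω.IsSymplecticAt p q x)
    (χ : C^∞⟮I, M; ℝ⟯) (hχU : ∀ x ∈ U, χ x = 1) (hχW : ∀ x, x ∉ W → χ x = 0)
    (σ τ : Cₛ^∞⟮I; F, V⟯) {x : M} (hx : x ∈ U) :
    Ω.lower (chart hΩ hn p q hU hUW hW χ hχU hχW).inverseTensor σ τ x = Ω.eval σ τ x := by
  have h1 : Ω.lower (chart hΩ hn p q hU hUW hW χ hχU hχW).inverseTensor σ τ =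
      ∑ i, (Ω.eval (p i) σ * Ω.eval (q i) τ - Ω.eval (q i) σ * Ω.eval (p i) τ) := by
    rw [lower, SymplecticChart.inverseTensor, map_sum]
    refine Finset.sum_congr rfl fun i _ => ?_
    rw [map_sub]
    rfl
  have h2 : Ω.toFun x (Ω.component p q x (σ x)) (τ x) =
      ∑ i, (Ω.toFun x (σ x) (q i x) * Ω.toFun x (p i x) (τ x) -
        Ω.toFun x (σ x) (p i x) * Ω.toFun x (q i x) (τ x)) := by
    rw [component, map_sum, LinearMap.sum_apply]
    refine Finset.sum_congr rfl fun i _ => ?_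
    rw [map_sub, map_smul, map_smul]
    rfl
  rw [(hW x (hUW hx)).component_eq_self hn] at h2
  rw [h1, eval_apply, h2]
  have h3 : (ContMDiffMap.evalRingHom x : C^∞⟮I, M; ℝ⟯ →+* ℝ)
      (∑ i, (Ω.eval (p i) σ * Ω.eval (q i) τ - Ω.eval (q i) σ * Ω.eval (p i) τ)) = _ :=
    map_sum _ _ _
  refine h3.trans (Finset.sum_congr rfl fun i _ => ?_)
  change Ω.toFun x (p i x) (σ x) * Ω.toFun x (q i x) (τ x) -
    Ω.toFun x (q i x) (σ x) * Ω.toFun x (p i x) (τ x) = _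
  rw [Ω.toFun_skew x (p i x) (σ x), Ω.toFun_skew x (q i x) (σ x)]
  ring

variable [FiniteDimensional ℝ B] [T2Space M] [FiniteDimensional ℝ F] [ContMDiffVectorBundle ∞ F V I]

/-- Arbitrarily small symplectic charts around each point. -/
theorem exists_chart (hΩ : Ω.IsSymplectic) {m : M} {N : Set M} (hN : N ∈ 𝓝 m) :
    ∃ U : Set M, IsOpen U ∧ m ∈ U ∧ U ⊆ N ∧
      ∃ c : SymplecticChart (Module.finrank ℝ F / 2) C^∞⟮I, M; ℝ⟯ Cₛ^∞⟮I; F, V⟯ (Restrictions I U),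
        (∀ x ∈ U, ∀ σ τ, Ω.lower c.inverseTensor σ τ x = Ω.eval σ τ x) ∧
        ∀ a, ∃ σ, c.θ a = Ω.contractLeft σ := by
  obtain ⟨hn, p, q, hpq⟩ := exists_symplectic_frame hΩ.nondegenerate m
  obtain ⟨W, hWpq, hW, hmW⟩ := eventually_nhds_iff.1 (hpq.and hN)
  obtain ⟨χ, hχ, hχW⟩ := exists_bump (I := I) (hW.mem_nhds hmW)
  obtain ⟨U, hUχ, hU, hmU⟩ := eventually_nhds_iff.1 (hχ.and (hW.mem_nhds hmW))
  exact ⟨U, hU, hmU, fun x hx => (hWpq x (hUχ x hx).2).2,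
    chart hΩ hn p q hU (fun x hx => (hUχ x hx).2) (fun x hx => (hWpq x hx).1) χ
      (fun x hx => (hUχ x hx).1)
      (fun x hx => by_contra fun h => hx (hχW (subset_tsupport _ h))),
    fun x hx σ τ => lower_chart hΩ hn p q hU _ _ χ _ _ σ τ hx, fun a => ⟨_, rfl⟩⟩

theorem exists_isInverseNear (hΩ : Ω.IsSymplectic) (m : M) : ∃ ϖ, Ω.IsInverseNear m ϖ := by
  obtain ⟨U, hU, hm, -, c, hc, -⟩ := exists_chart hΩ (m := m) Filter.univ_mem
  exact ⟨_, Filter.eventually_of_mem (hU.mem_nhds hm) hc⟩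

/-- Two tensors that represent the inverse of `Ω` near `m` define the same bracket on the fibre: in a
small chart their components agree. -/
theorem IsInverseNear.bracket_eq (hΩ : Ω.IsSymplectic) {m : M}
    {ϖ ϖ' : Cₛ^∞⟮I; F, V⟯ ⊗[C^∞⟮I, M; ℝ⟯] Cₛ^∞⟮I; F, V⟯}
    (h : Ω.IsInverseNear m ϖ) (h' : Ω.IsInverseNear m ϖ') :
    (Jet.bracket ϖ : EJetFiber I F V m → EJetFiber I F V m → EJetFiber I F V m) =
      Jet.bracket ϖ' := by
  obtain ⟨U, -, hm, hU, c, -, hθ⟩ := exists_chart hΩ (h.and h')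
  refine c.bracket_congr (fun f hf => ker_restrictions.1 hf m hm) fun a b =>
    ker_restrictions.2 fun x hx => ?_
  obtain ⟨σ, hσ⟩ := hθ a
  obtain ⟨τ, hτ⟩ := hθ b
  rw [hσ, hτ]
  change Ω.lower (ϖ - ϖ') σ τ x = 0
  rw [lower_sub]
  change Ω.lower ϖ σ τ x - Ω.lower ϖ' σ τ x = 0
  rw [(hU hx).1, (hU hx).2, sub_self]

/-- Over a chart, the values of jets on the dual operators trivialize the bundle of jets as a bundle
of Poisson algebras. -/
theorem exists_trivialization (hΩ : Ω.IsSymplectic) (m : M) :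
    ∃ U : Set M, IsOpen U ∧ m ∈ U ∧
      ∃ φ : ∀ x : U, EJetFiber I F V x.1 ≃ₗ[ℝ] FormalPhaseSpace (Module.finrank ℝ F / 2),
        IsJetTrivialization (Module.finrank ℝ F / 2) U φ ∧
        ∀ x : U, ∃ ϖ, Ω.IsInverseNear x.1 ϖ ∧
          IsStandardPoissonIso (Module.finrank ℝ F / 2) (Jet.bracket ϖ) (φ x) := by
  obtain ⟨W, hW, hmW, -, c, hc, -⟩ := exists_chart hΩ (m := m) Filter.univ_mem
  obtain ⟨γ, hγ₁, hγ⟩ := c.exists_connectionForm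
  obtain ⟨χ, hχ, hχW⟩ := exists_bump (I := I) (hW.mem_nhds hmW)
  obtain ⟨U, hUχ, hU, hmU⟩ := eventually_nhds_iff.1 (hχ.and (hW.mem_nhds hmW))
  have hUW : U ⊆ W := fun x hx => (hUχ x hx).2
  refine ⟨U, hU, hmU, fun x => LinearEquiv.ofBijective
    { toFun := c.coords hγ (ScalarAt x.1) hγ₁
      map_add' := fun l l' => rfl
      map_smul' := fun r l => rfl }
    ⟨SymplecticChart.coords_injective hγ₁ (evalAt (hUW x.2)),
      SymplecticChart.coords_surjective hγ₁ (evalAt_surjective (hUW x.2))⟩, ⟨?_, ?_⟩, ?_⟩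
  · exact fun d => ⟨c.dualOperator hγ hγ₁ d, fun x l => rfl⟩
  · intro f
    let G : FormalPoisson.Series (Module.finrank ℝ F / 2) (Restrictions I W) :=
      fun d => algebraMap C^∞⟮I, M; ℝ⟯ (Restrictions I W) (f d)
    -- the series `G` defines a jet over `W`, which a cut-off extends to `M` without a change on `U`
    obtain ⟨l, hl⟩ := c.exists_jet_of_cutoff χ (fun g hg => by
      ext x
      change χ x * g x = 0
      by_cases hx : x ∈ W
      · rw [ker_restrictions.1 hg x hx, mul_zero]
      · rw [show χ x = 0 from by_contra fun h => hx (hχW (subset_tsupport _ h)), zero_mul])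
      (c.toJet hγ G)
    refine ⟨l, fun x d => ?_⟩
    have h := congrArg (evalAt (hUW x.2)) ((hl (c.dualOperator hγ hγ₁ d)).trans
      (congrArg _ (SymplecticChart.toJet_dualOperator hγ₁ d G)))
    change (l (c.dualOperator hγ hγ₁ d) x.1 : ℝ) = χ x.1 * f d x.1 at h
    rw [(hUχ x.1 x.2).1, one_mul] at h
    exact h
  · exact fun x => ⟨c.inverseTensor, Filter.eventually_of_mem (hW.mem_nhds (hUW x.2)) hc,
      SymplecticChart.coords_mul hγ₁ (evalAt_surjective (hUW x.2)),
      SymplecticChart.coords_one hγ₁ (evalAt (hUW x.2)),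
      SymplecticChart.coords_bracket hγ₁ (evalAt_surjective (hUW x.2))⟩

end ETwoForm

end LieAlgebroidJets

end

theorem mainTheorem10
    {B : Type*} [NormedAddCommGroup B] [NormedSpace ℝ B] [FiniteDimensional ℝ B]
    {H : Type*} [TopologicalSpace H] {I : ModelWithCorners ℝ B H}
    {M : Type*} [TopologicalSpace M] [ChartedSpace H M] [IsManifold I ∞ M] [T2Space M]
    {F : Type*} [NormedAddCommGroup F] [NormedSpace ℝ F] [FiniteDimensional ℝ F]
    {V : M → Type*} [TopologicalSpace (Bundle.TotalSpace F V)]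
    [∀ x, AddCommGroup (V x)] [∀ x, Module ℝ (V x)] [∀ x, TopologicalSpace (V x)]
    [FiberBundle F V] [VectorBundle ℝ F V] [ContMDiffVectorBundle ∞ F V I]
    [LieAlgebroid I F V] (Ω : ETwoForm I F V) (hΩ : Ω.IsSymplectic) :
    -- the inverse tensor of `Ω` exists, locally, as a finite sum `∑ᵢ eᵢ ⊗ fᵢ`
    (∀ m : M, ∃ ϖ, Ω.IsInverseNear m ϖ) ∧
    -- there are brackets on the space of jets and on the fibres of the bundle of jets
    ∃ (br : EJets I F V → EJets I F V → EJets I F V)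
      (brAt : ∀ m : M, EJetFiber I F V m → EJetFiber I F V m → EJetFiber I F V m),
      -- they are given by `{l₁, l₂}(D) = (l₁ ⊗ l₂)(Δ₀(D) · ∑ᵢ eᵢ ⊗ fᵢ)`
      (∀ m ϖ, Ω.IsInverseNear m ϖ → brAt m = Jet.bracket ϖ) ∧
      (∀ l₁ l₂ m, (br l₁ l₂).at m = brAt m (l₁.at m) (l₂.at m)) ∧
      (∀ ϖ, (∀ m, Ω.IsInverseNear m ϖ) → br = Jet.bracket ϖ) ∧
      -- they define Poisson algebras
      IsPoissonAlgebra C^∞⟮I, M; ℝ⟯ (EJets I F V) Jet.mul Jet.one br ∧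
      (∀ m, IsPoissonAlgebra ℝ (EJetFiber I F V m) Jet.mul Jet.one (brAt m)) ∧
      -- the bundle is locally trivial, with the standard Poisson algebra as fibre
      ∀ m : M, ∃ U : Set M, IsOpen U ∧ m ∈ U ∧
        ∃ φ : ∀ x : U, EJetFiber I F V x.1 ≃ₗ[ℝ] FormalPhaseSpace (Module.finrank ℝ F / 2),
          IsJetTrivialization (Module.finrank ℝ F / 2) U φ ∧
          ∀ x : U, IsStandardPoissonIso (Module.finrank ℝ F / 2) (brAt x.1) (φ x) := by
  have hex := ETwoForm.exists_isInverseNear hΩ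
  choose ϖ hϖ using hex
  let brAt (m : M) : EJetFiber I F V m → EJetFiber I F V m → EJetFiber I F V m :=
    Jet.bracket (ϖ m)
  have hAt (m : M) (ϖ') (h : Ω.IsInverseNear m ϖ') : brAt m = Jet.bracket ϖ' :=
    (hϖ m).bracket_eq hΩ h
  -- near `m`, the bracket of jets on `M` is the jet given by a fixed tensor
  have hsmooth (l₁ l₂ : EJets I F V) (D : EOp I F V) : ContMDiff I 𝓘(ℝ, ℝ) ∞
      fun x => (brAt x (l₁.at x) (l₂.at x) D : ℝ) := fun m => by
    refine ((Jet.bracket (ϖ m) l₁ l₂ D : C^∞⟮I, M; ℝ⟯).contMDiff m).congr_of_eventuallyEq ?_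
    filter_upwards [(hϖ m).eventually_nhds] with x hx
    rw [hAt x (ϖ m) hx, ← EJets.bracket_at]
    rfl
  let br (l₁ l₂ : EJets I F V) : EJets I F V :=
    { toFun := fun D => ⟨fun x => (brAt x (l₁.at x) (l₂.at x) D : ℝ), hsmooth l₁ l₂ D⟩
      map_add' := fun D D' => by
        ext x
        exact map_add (brAt x (l₁.at x) (l₂.at x)) D D'
      map_smul' := fun f D => by
        ext x
        exact map_smul (brAt x (l₁.at x) (l₂.at x)) f D }
  have hbr (l₁ l₂ : EJets I F V) (m : M) : (br l₁ l₂).at m = brAt m (l₁.at m) (l₂.at m) := rfl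
  have htriv (m : M) : ∃ U : Set M, IsOpen U ∧ m ∈ U ∧
      ∃ φ : ∀ x : U, EJetFiber I F V x.1 ≃ₗ[ℝ] FormalPhaseSpace (Module.finrank ℝ F / 2),
        IsJetTrivialization (Module.finrank ℝ F / 2) U φ ∧
        ∀ x : U, IsStandardPoissonIso (Module.finrank ℝ F / 2) (brAt x.1) (φ x) := by
    obtain ⟨U, hU, hm, φ, hφ, h⟩ := ETwoForm.exists_trivialization hΩ m
    refine ⟨U, hU, hm, φ, hφ, fun x => ?_⟩
    obtain ⟨ϖ', hϖ', h'⟩ := h x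
    rwa [hAt x.1 ϖ' hϖ']
  have hP (m : M) : IsPoissonAlgebra ℝ (EJetFiber I F V m) Jet.mul Jet.one (brAt m) := by
    obtain ⟨U, -, hm, φ, -, h⟩ := htriv m
    exact (h ⟨m, hm⟩).isPoissonAlgebra
  refine ⟨fun m => ⟨_, hϖ m⟩, br, brAt, hAt, hbr, fun ϖ' h => ?_, EJets.isPoissonAlgebra hbr hP, hP,
    htriv⟩
  funext l₁ l₂
  refine EJets.ext_at fun m => ?_
  rw [hbr, hAt m ϖ' (h m), EJets.bracket_at]
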